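/- **Posterior ratio consistency for hyper-pMOM priors with a complexity prior on the models.** *Setting.* For $n\ge 1$ let $X_n$ be a deterministic $n\times p_n$ design matrix. A model is a subset $\mathbf k\subseteq\{1,\dots,p_n\}$, of cardinality $|\mathbf k|$; $X_{\mathbf k}$ denotes the submatrix of the columns of $X_n$ in $\mathbf k$, and $A_{\mathbf k}$ the principal submatrix, with rows and columns in $\mathbf k$, of a symmetric $p_n\times p_n$ matrix $A_{p_n}$. Fix an integer $r\ge1$ and constants $\alpha_1,\alpha_2,c_1,c_2>0$. Consider the hierarchical model $$Y_n\mid \beta_{\mathbf k},\sigma^2,\mathbf k\sim N(X_{\mathbf k}\beta_{\mathbf k},\sigma^2 I_n),$$ $$\pi(\beta_{\mathbf k}\mid\tau,\sigma^2,\mathbf k)=d_{\mathbf k}(2\pi)^{-|\mathbf k|/2}(\tau\sigma^2)^{-r|\mathbf k|-|\mathbf k|/2}|A_{\mathbf k}|^{1/2}\exp\Big\{-\frac{\beta_{\mathbf k}^TA_{\mathbf k}\beta_{\mathbf k}}{2\tau\sigma^2}\Big\}\prod_{i\in\mathbf k}\beta_i^{2r},$$ $$\pi(\tau)=\frac{(n/2)^{1/2}}{\Gamma(1/2)}\tau^{-3/2}e^{-n/(2\tau)},\qquad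 \pi(\sigma^2)=\frac{\alpha_2^{\alpha_1}}{\Gamma(\alpha_1)}(\sigma^2)^{-(\alpha_1+1)}e^{-\alpha_2/\sigma^2}\qquad(\tau,\sigma^2>0),$$ where $d_{\mathbf k}$ is the normalizing constant, with the complexity prior on the models $$\pi(\mathbf k)\propto c_1^{-|\mathbf k|}p_n^{-c_2|\mathbf k|}\ \text{ if } |\mathbf k|\le q_n,\qquad \pi(\mathbf k)=0\ \text{ if }|\mathbf k|>q_n .$$ Let $m_{\mathbf k}(y)$ be the marginal density of $Y_n$ at $y$ under the model $\mathbf k$ (the integral of likelihood times priors over $\beta_{\mathbf k},\sigma^2,\tau$), and let $\pi(\mathbf k\mid y)=\pi(\mathbf k)m_{\mathbf k}(y)/\sum_{\mathbf l}\pi(\mathbf l)m_{\mathbf l}(y)$ be the posterior probability of $\mathbf k$. *Data.* The data are $y_n=X_n\beta_0+\epsilon_n$, where the entries of the random vector $\epsilon_n$ are i.i.d. $N(0,\sigma_0^2)$ with $\sigma_0^2>0$. The support $\mathbf t$ of $\beta_0$ is a finite set contained in $\{1,\dots,p_n\}$ for every $n\ge1$; and $\mathbf t$, the nonzero entries of $\beta_0$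 and $\sigma_0^2$ do not depend on $n$. *Assumptions.* 1. There are $\varepsilon_n$ with $0<\varepsilon_n<1$ and $\varepsilon_n^{-1}=O((\log n)^{1/8})$ such that for every $n\ge1$, every model $\mathbf k\subseteq\{1,\dots,p_n\}$ and every $1\le j\le\min(n,|\mathbf k|)$ one has $\varepsilon_n\le\nu_j\le\varepsilon_n^{-1}$, where $\nu_j$ is the $j$-th largest eigenvalue (counted with multiplicity) of $X_{\mathbf k}^TX_{\mathbf k}/n$. 2. $q_n=O(n^\xi)$ for some $\xi<1$, and $|\mathbf t|\le q_n$ for all large $n$. 3. There are constants $0<a_1<a_2<\infty$ such that for every $n\ge1$ all eigenvalues of $A_{p_n}$ lie in $(a_1,a_2)$. 4. $\log p_n=O(n^\kappa)$ for some $0<\kappa<1$. *Conclusion.* As $n\to\infty$, $$\max_{\mathbf k\ne\mathbf t}\frac{\pi(\mathbf k\mid y_n)}{\pi(\mathbf t\mid y_n)}\longrightarrow0\quad\text{in probability},$$ where the maximum is over all models $\mathbf k\subseteq\{1,\dots,p_n\}$ with $\mathbf k\ne\mathbf t$ (and is $0$ if there is none). -/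

import Mathlib

open MeasureTheory ProbabilityTheory Filter Matrix
open scoped NNReal ENNReal Topology

noncomputable section

namespace HyperPMOM

/- A model is a finite set `k : Finset (Fin p)` of column indices; `k` also denotes the subtype of
its elements, so that a coefficient vector of the model is a function `β : k → ℝ`. -/

/-- The design matrix `X_k`: the columns of `X` that belong to the model `k`. -/
def subDesign {n p : ℕ} (X : Matrix (Fin n) (Fin p) ℝ) (k : Finset (Fin p)) :
    Matrix (Fin n) k ℝ :=
  X.submatrix id Subtype.val

/-- The principal submatrix `A_k`. -/
def subPrec {p : ℕ} (A : Matrix (Fin p) (Fin p) ℝ) (k : Finset (Fin p)) : Matrix k k ℝ :=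
  A.submatrix Subtype.val Subtype.val

/-- The scaled Gram matrix `X_kᵀ X_k / n`. -/
def scaledGram {n p : ℕ} (X : Matrix (Fin n) (Fin p) ℝ) (k : Finset (Fin p)) : Matrix k k ℝ :=
  (n : ℝ)⁻¹ • ((subDesign X k)ᵀ * subDesign X k)

theorem scaledGram_isHermitian {n p : ℕ} (X : Matrix (Fin n) (Fin p) ℝ) (k : Finset (Fin p)) :
    (scaledGram X k).IsHermitian := by
  ext i j
  simp [scaledGram, Matrix.mul_apply, Matrix.conjTranspose_apply, mul_comm]

/-- For every model `k`, the `min(n, |k|)` largest eigenvalues (with multiplicity) of the positive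
semidefinite matrix `X_kᵀ X_k / n` lie in `[ε, ε⁻¹]`. `eigenvalues₀` lists the `|k|` eigenvalues in
decreasing order, starting with index `0`; as `ε` will be positive, the entry with index `j - 1` is
the `j`-th largest nonzero eigenvalue, for `1 ≤ j ≤ min(n, |k|)`. -/
def DesignEigenBounds {n p : ℕ} (X : Matrix (Fin n) (Fin p) ℝ) (ε : ℝ) : Prop :=
  ∀ (k : Finset (Fin p)) (j : Fin (Fintype.card k)), (j : ℕ) < min n k.card →
    ε ≤ (scaledGram_isHermitian X k).eigenvalues₀ j ∧
      (scaledGram_isHermitian X k).eigenvalues₀ j ≤ ε⁻¹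

/-- `A` is symmetric and all its eigenvalues lie in the open interval `(a₁, a₂)`. -/
def EigenvaluesBetween {p : ℕ} (A : Matrix (Fin p) (Fin p) ℝ) (a₁ a₂ : ℝ) : Prop :=
  ∃ h : A.IsHermitian, ∀ i, a₁ < h.eigenvalues i ∧ h.eigenvalues i < a₂

/-- The density at `y` of `N(X_k β, s I_n)`, where `s = σ²`. -/
def likelihood {n p : ℕ} (X : Matrix (Fin n) (Fin p) ℝ) (k : Finset (Fin p)) (y : Fin n → ℝ)
    (β : k → ℝ) (s : ℝ) : ℝ :=
  (2 * Real.pi * s) ^ (-((n : ℝ) / 2)) *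
    Real.exp (-(((y - subDesign X k *ᵥ β) ⬝ᵥ (y - subDesign X k *ᵥ β)) / (2 * s)))

/-- The pMOM prior density of order `r` without its normalizing constant; `v` is `τ σ²`. -/
def pmomKernel {p : ℕ} (A : Matrix (Fin p) (Fin p) ℝ) (r : ℕ) (k : Finset (Fin p))
    (β : k → ℝ) (v : ℝ) : ℝ :=
  (2 * Real.pi) ^ (-((k.card : ℝ) / 2)) * v ^ (-((r : ℝ) * k.card) - (k.card : ℝ) / 2) *
    Real.sqrt (subPrec A k).det * Real.exp (-((β ⬝ᵥ (subPrec A k *ᵥ β)) / (2 * v))) *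
    ∏ i, β i ^ (2 * r)

/-- The normalizing constant `d_k`. The integral of `pmomKernel` over `β` is the same for every
`v > 0` (substitute `β = √v b`), so that it may be computed at `v = 1`. -/
def pmomConst {p : ℕ} (A : Matrix (Fin p) (Fin p) ℝ) (r : ℕ) (k : Finset (Fin p)) : ℝ :=
  (∫ β : k → ℝ, pmomKernel A r k β 1)⁻¹

/-- The pMOM prior density of `β_k` given `τ` and `s = σ²`. -/
def pmomDensity {p : ℕ} (A : Matrix (Fin p) (Fin p) ℝ) (r : ℕ) (k : Finset (Fin p))
    (β : k → ℝ) (τ s : ℝ) : ℝ :=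
  pmomConst A r k * pmomKernel A r k β (τ * s)

/-- The Inverse-Gamma`(1/2, n/2)` prior density of `τ`. -/
def tauDensity (n : ℕ) (τ : ℝ) : ℝ :=
  ((n : ℝ) / 2) ^ (1 / 2 : ℝ) / Real.Gamma (1 / 2) * τ ^ (-(3 / 2) : ℝ) *
    Real.exp (-((n : ℝ) / (2 * τ)))

/-- The Inverse-Gamma`(α₁, α₂)` prior density of `s = σ²`. -/
def sigmaSqDensity (α₁ α₂ s : ℝ) : ℝ :=
  α₂ ^ α₁ / Real.Gamma α₁ * s ^ (-(α₁ + 1)) * Real.exp (-(α₂ / s))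

/-- The marginal density `m_k(y)`: the integral over `β`, `s = σ²` and `τ` of likelihood times
priors. The integrand is nonnegative, so the integral is a Lebesgue integral with values in
`[0, ∞]`. -/
def marginal {n p : ℕ} (X : Matrix (Fin n) (Fin p) ℝ) (A : Matrix (Fin p) (Fin p) ℝ) (r : ℕ)
    (α₁ α₂ : ℝ) (k : Finset (Fin p)) (y : Fin n → ℝ) : ℝ :=
  (∫⁻ τ in Set.Ioi (0 : ℝ), ∫⁻ s in Set.Ioi (0 : ℝ), ∫⁻ β : k → ℝ,
    ENNReal.ofReal (likelihood X k y β s * pmomDensity A r k β τ s * tauDensity n τ *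
      sigmaSqDensity α₁ α₂ s)).toReal

/-- The unnormalized complexity prior weight `c₁^{-|k|} p^{-c₂ |k|}` of the model `k`, set to `0`
for the models with more than `q` elements. -/
def priorWeight {p : ℕ} (q c₁ c₂ : ℝ) (k : Finset (Fin p)) : ℝ :=
  if (k.card : ℝ) ≤ q then c₁ ^ (-(k.card : ℝ)) * (p : ℝ) ^ (-(c₂ * k.card)) else 0

/-- The complexity prior `π(k)` on the models. -/
def modelPrior {p : ℕ} (q c₁ c₂ : ℝ) (k : Finset (Fin p)) : ℝ :=
  priorWeight q c₁ c₂ k / ∑ l : Finset (Fin p), priorWeight q c₁ c₂ l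

/-- The posterior probability `π(k | y) = π(k) m_k(y) / π(y)`, with `π(y) = ∑_l π(l) m_l(y)`. -/
def posterior {n p : ℕ} (X : Matrix (Fin n) (Fin p) ℝ) (A : Matrix (Fin p) (Fin p) ℝ) (r : ℕ)
    (α₁ α₂ q c₁ c₂ : ℝ) (k : Finset (Fin p)) (y : Fin n → ℝ) : ℝ :=
  modelPrior q c₁ c₂ k * marginal X A r α₁ α₂ k y /
    ∑ l : Finset (Fin p), modelPrior q c₁ c₂ l * marginal X A r α₁ α₂ l y

/-- The true model `t`: the indices below `p` at which the coefficient sequence is nonzero. -/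
def trueModel (p : ℕ) (β₀ : ℕ →₀ ℝ) : Finset (Fin p) :=
  Finset.univ.filter fun j => β₀ j ≠ 0

/-- The response vector `y = X β₀ + e`. -/
def response {n p : ℕ} (X : Matrix (Fin n) (Fin p) ℝ) (β₀ : ℕ →₀ ℝ) (e : Fin n → ℝ) :
    Fin n → ℝ :=
  X *ᵥ (fun j : Fin p => β₀ j) + e

/-- `max_{k ≠ t} π(k | y) / π(t | y)`; a supremum over a finite family of nonnegative numbers, equal
to `0` if there is no model other than `t`. -/
def maxPosteriorRatio {n p : ℕ} (X : Matrix (Fin n) (Fin p) ℝ) (A : Matrix (Fin p) (Fin p) ℝ)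
    (r : ℕ) (α₁ α₂ q c₁ c₂ : ℝ) (t : Finset (Fin p)) (y : Fin n → ℝ) : ℝ :=
  ⨆ k : {k : Finset (Fin p) // k ≠ t},
    posterior X A r α₁ α₂ q c₁ c₂ k.1 y / posterior X A r α₁ α₂ q c₁ c₂ t y

end HyperPMOM

end

/-! Put ρ = r + 1/2, so ρ ≥ 3/2. Once the coefficients, τ and σ² are integrated out, a marginal
density is, up to constants to the power |k| + 1, a dimension penalty times `rssFactor n W`, the
Gaussian likelihood with residual sum of squares W maximised over σ². A spurious column costs about
n^(-2ρ): a factor (nε)^(-ρ), because the likelihood confines its coefficient to the scale n^(-1/2)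
where β^(2r) is small, and a factor (|k|/n)^ρ from the hyperprior on τ. A true column gets n^r back.
The upper bounds are `exists_emarginal_le` and `exists_emarginal_response_le`; the matching lower
bound for the true model t, off by one factor n, is `exists_le_emarginal_response`.

Models containing t with d ≥ 1 extra columns: the extra columns improve the fit only by projecting
noise, which on typical errors is worth at most n^(5d/4 + 1/4) in likelihood. Since |k|^(ρ|k|) is at
most a constant to the power d + 1 times n^(ρ(d-1)), the net power of n is (5/4 - ρ)(d + 1), at most
-(d + 1)/4, and powers of 1/ε are harmless (`exists_overfit_ratio_le`). The decay comes from the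
pMOM prior; the complexity prior enters only through p^(-c₂d) ≤ 1.

Models missing a true column: the residual sum of squares grows by a multiple of nε, so the
likelihood drops by exp(-η₀nε), which beats every power of n (`exists_underfit_ratio_le`).

Both comparisons need the noise to be typical for all models at once. The eigenvalue assumption
applied to the full design forces p ≤ n ε⁻² (`DesignEigenBounds.card_le`), so p is at most n^(1.02)
eventually. A Chernoff bound of order n^(-1.03d - 0.05) for each superset of t with d extra columns
then survives the union bound (`measure_projSq_exceeds_le`). On the typical event a single
deterministic null sequence bounds all ratios (`exists_priorWeight_mul_marginal_le`). -/

noncomputable section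

namespace HyperPMOM

/-! ### Quadratic forms and eigenvalues. -/

section LinearAlgebra

variable {ι : Type*} [Fintype ι] [DecidableEq ι]

theorem quadForm_eq_sum_eigenvalues {H : Matrix ι ι ℝ} (hH : H.IsHermitian) (v : ι → ℝ) :
    ∃ w : ι → ℝ, w ⬝ᵥ w = v ⬝ᵥ v ∧ v ⬝ᵥ (H *ᵥ v) = ∑ i, hH.eigenvalues i * w i ^ 2 := by
  set U : Matrix ι ι ℝ := (hH.eigenvectorUnitary : Matrix ι ι ℝ) with hU
  have hUU : U * Uᵀ = 1 := by
    have := (Matrix.mem_unitaryGroup_iff (A := U)).1 hH.eigenvectorUnitary.2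
    simpa [Matrix.star_eq_conjTranspose, Matrix.conjTranspose_eq_transpose_of_trivial] using this
  have hsp : H = U * diagonal hH.eigenvalues * Uᵀ := by
    have := hH.spectral_theorem
    rw [Unitary.conjStarAlgAut_apply] at this
    simpa [Matrix.star_eq_conjTranspose, Matrix.conjTranspose_eq_transpose_of_trivial] using this
  refine ⟨Uᵀ *ᵥ v, ?_, ?_⟩
  · rw [Matrix.dotProduct_mulVec, Matrix.vecMul_transpose, Matrix.mulVec_mulVec, hUU,
      Matrix.one_mulVec]
  · conv_lhs => rw [hsp]
    rw [← Matrix.mulVec_mulVec, ← Matrix.mulVec_mulVec, Matrix.dotProduct_mulVec,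
      ← Matrix.mulVec_transpose]
    simp only [dotProduct, Matrix.mulVec_diagonal]
    exact Finset.sum_congr rfl fun i _ => by ring

theorem quadForm_mem_Icc_of_eigenvalues {H : Matrix ι ι ℝ} (hH : H.IsHermitian) {a b : ℝ}
    (h : ∀ i, a ≤ hH.eigenvalues i ∧ hH.eigenvalues i ≤ b) (v : ι → ℝ) :
    a * (v ⬝ᵥ v) ≤ v ⬝ᵥ (H *ᵥ v) ∧ v ⬝ᵥ (H *ᵥ v) ≤ b * (v ⬝ᵥ v) := by
  obtain ⟨w, hw, hv⟩ := quadForm_eq_sum_eigenvalues hH v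
  rw [hv, ← hw]
  simp only [dotProduct, Finset.mul_sum, ← sq]
  exact ⟨Finset.sum_le_sum fun i _ => mul_le_mul_of_nonneg_right (h i).1 (sq_nonneg _),
    Finset.sum_le_sum fun i _ => mul_le_mul_of_nonneg_right (h i).2 (sq_nonneg _)⟩

end LinearAlgebra

theorem sum_mul_self_nonneg {ι : Type*} [Fintype ι] (v : ι → ℝ) : 0 ≤ v ⬝ᵥ v :=
  Finset.sum_nonneg fun i _ => mul_self_nonneg (v i)

/-! ### Consequences of the eigenvalue assumptions on the design and on the prior scale matrix. -/

section Design

variable {n p : ℕ}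

theorem scaledGram_quadForm (X : Matrix (Fin n) (Fin p) ℝ) (k : Finset (Fin p)) (v : k → ℝ) :
    v ⬝ᵥ (scaledGram X k *ᵥ v) = (n : ℝ)⁻¹ * ((subDesign X k *ᵥ v) ⬝ᵥ (subDesign X k *ᵥ v)) := by
  rw [scaledGram, Matrix.smul_mulVec, dotProduct_smul, ← Matrix.mulVec_mulVec,
    Matrix.dotProduct_mulVec, Matrix.vecMul_transpose, smul_eq_mul]

/-- The Gram matrix of a model with at most `n` columns has all its eigenvalues in
`[n ε, n ε⁻¹]`. -/
theorem DesignEigenBounds.quadForm_bounds {X : Matrix (Fin n) (Fin p) ℝ} {ε : ℝ}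
    (h : DesignEigenBounds X ε) (hn : 1 ≤ n) {k : Finset (Fin p)} (hk : k.card ≤ n) (v : k → ℝ) :
    n * ε * (v ⬝ᵥ v) ≤ (subDesign X k *ᵥ v) ⬝ᵥ (subDesign X k *ᵥ v) ∧
      (subDesign X k *ᵥ v) ⬝ᵥ (subDesign X k *ᵥ v) ≤ n * ε⁻¹ * (v ⬝ᵥ v) := by
  have hn0 : (0 : ℝ) < n := by exact_mod_cast hn
  have key := quadForm_mem_Icc_of_eigenvalues (scaledGram_isHermitian X k) (a := ε) (b := ε⁻¹)
    (fun i => h k _ (by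
      rw [min_eq_right hk]
      simpa using (Fin.isLt _ : _ < Fintype.card k))) v
  rw [scaledGram_quadForm] at key
  constructor
  · have := mul_le_mul_of_nonneg_left key.1 hn0.le
    rw [mul_inv_cancel_left₀ hn0.ne'] at this
    linarith
  · have := mul_le_mul_of_nonneg_left key.2 hn0.le
    rw [mul_inv_cancel_left₀ hn0.ne'] at this
    linarith

/-- The bounds on the eigenvalues force the number of columns to be at most `n ε⁻²`. -/
theorem DesignEigenBounds.card_le {X : Matrix (Fin n) (Fin p) ℝ} {ε : ℝ}
    (h : DesignEigenBounds X ε) (hn : 1 ≤ n) (hε : 0 < ε) : (p : ℝ) ≤ n * (ε⁻¹ * ε⁻¹) := by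
  rcases Nat.eq_zero_or_pos p with rfl | hp
  · simp only [Nat.cast_zero]; positivity
  have hn0 : (0 : ℝ) < n := by exact_mod_cast hn
  set H := scaledGram_isHermitian X Finset.univ
  have hcard : Fintype.card (Finset.univ : Finset (Fin p)) = p := by simp
  have hle : ∀ i, H.eigenvalues i ≤ ε⁻¹ := by
    intro i
    -- Index 0 is the largest eigenvalue, so its bound controls all of them, including those beyond
    -- the first min(n, p), of which the assumption says nothing.
    have h0 := (h Finset.univ ⟨0, by omega⟩ (by simp; omega)).2
    exact (H.eigenvalues₀_antitone (Fin.le_def.2 (Nat.zero_le _))).trans h0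
  -- The trace is computed twice. At most n eigenvalues are nonzero, each at most ε⁻¹; each of the p
  -- diagonal entries is at least ε, by the assumption for one-column models.
  have hrank : Fintype.card {i // H.eigenvalues i ≠ 0} ≤ n := by
    rw [← H.rank_eq_card_non_zero_eigs]
    have h1 : (scaledGram X Finset.univ).rank ≤ (subDesign X Finset.univ).rank := by
      rw [scaledGram, ← Matrix.smul_mul]
      exact Matrix.rank_mul_le_right _ _
    exact h1.trans ((Matrix.rank_le_card_height _).trans (by simp))
  have htr : (scaledGram X Finset.univ).trace ≤ n * ε⁻¹ := by
    rw [H.trace_eq_sum_eigenvalues]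
    have hsum : ∑ i, H.eigenvalues i = ∑ i with H.eigenvalues i ≠ 0, H.eigenvalues i :=
      (Finset.sum_filter_ne_zero _).symm
    have hcast : ((∑ i, ((H.eigenvalues i : ℝ)) : ℝ)) ≤
        ((Finset.univ.filter fun i => H.eigenvalues i ≠ 0).card : ℝ) * ε⁻¹ := by
      rw [hsum, ← nsmul_eq_mul]
      exact Finset.sum_le_card_nsmul _ _ _ fun i _ => hle i
    refine (le_of_eq (by simp)).trans (hcast.trans (mul_le_mul_of_nonneg_right ?_ (by positivity)))
    rw [Fintype.card_subtype] at hrank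
    exact_mod_cast hrank
  have hdiag : ∀ i, ε ≤ scaledGram X Finset.univ i i := by
    intro i
    have := (h.quadForm_bounds hn (k := {i.1}) (by simpa using hn) (fun _ => 1)).1
    have h1 : scaledGram X Finset.univ i i = (n : ℝ)⁻¹ * ∑ l, X l i * X l i := by
      simp [scaledGram, subDesign, Matrix.mul_apply]
    rw [h1]
    have h2 : n * ε ≤ ∑ l, X l i * X l i := by
      simpa [dotProduct, Matrix.mulVec, subDesign] using this
    rw [le_inv_mul_iff₀ hn0]
    exact h2
  have hsum : (p : ℝ) * ε ≤ (scaledGram X Finset.univ).trace := by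
    have := Finset.card_nsmul_le_sum Finset.univ (fun i => scaledGram X Finset.univ i i) ε
      fun i _ => hdiag i
    simpa [Matrix.trace] using this
  have := hsum.trans htr
  rw [← le_div_iff₀ hε] at this
  refine this.trans (le_of_eq ?_)
  rw [div_eq_mul_inv]; ring

theorem EigenvaluesBetween.quadForm_bounds {A : Matrix (Fin p) (Fin p) ℝ} {a₁ a₂ : ℝ}
    (h : EigenvaluesBetween A a₁ a₂) (k : Finset (Fin p)) (v : k → ℝ) :
    a₁ * (v ⬝ᵥ v) ≤ v ⬝ᵥ (subPrec A k *ᵥ v) ∧ v ⬝ᵥ (subPrec A k *ᵥ v) ≤ a₂ * (v ⬝ᵥ v) := by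
  obtain ⟨hA, hev⟩ := h
  set w : Fin p → ℝ := fun j => if hj : j ∈ k then v ⟨j, hj⟩ else 0 with hw
  have key := quadForm_mem_Icc_of_eigenvalues hA (a := a₁) (b := a₂)
    (fun i => ⟨(hev i).1.le, (hev i).2.le⟩) w
  have hsum : ∀ f : Fin p → ℝ, (∑ j, w j * f j) = ∑ j : k, v j * f j := by
    intro f
    rw [← Finset.sum_subset (Finset.subset_univ k), ← Finset.sum_coe_sort k]
    · exact Finset.sum_congr rfl fun j _ => by simp [hw]
    · intro j _ hj; simp [hw, hj]
  have h1 : w ⬝ᵥ w = v ⬝ᵥ v := by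
    simp only [dotProduct]
    rw [hsum]
    exact Finset.sum_congr rfl fun j _ => by simp [hw]
  have h2 : w ⬝ᵥ (A *ᵥ w) = v ⬝ᵥ (subPrec A k *ᵥ v) := by
    simp only [dotProduct]
    rw [hsum]
    refine Finset.sum_congr rfl fun j _ => ?_
    congr 1
    simp only [Matrix.mulVec, dotProduct, subPrec, Matrix.submatrix_apply]
    simp_rw [mul_comm (A _ _)]
    exact hsum _
  rwa [h1, h2] at key

theorem EigenvaluesBetween.subPrec_posDef {A : Matrix (Fin p) (Fin p) ℝ} {a₁ a₂ : ℝ}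
    (h : EigenvaluesBetween A a₁ a₂) (ha : 0 < a₁) (k : Finset (Fin p)) :
    (subPrec A k).PosDef := by
  refine Matrix.PosDef.of_dotProduct_mulVec_pos (h.1.submatrix _) fun v hv => ?_
  have := (h.quadForm_bounds k v).1
  have h0 : 0 < v ⬝ᵥ v := lt_of_le_of_ne (sum_mul_self_nonneg v)
    (fun h => hv (dotProduct_self_eq_zero.1 h.symm))
  simpa using lt_of_lt_of_le (mul_pos ha h0) this

end Design

/-! ### Least squares and projections. -/

section LeastSquares

variable {m ι : Type*} [Fintype m] [Fintype ι] [DecidableEq ι]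

/-- The least squares coefficients of `e` on the columns of `M`. -/
def lsq (M : Matrix m ι ℝ) (e : m → ℝ) : ι → ℝ := (Mᵀ * M)⁻¹ *ᵥ (Mᵀ *ᵥ e)

/-- The squared length of the projection of `e` on the column space of `M`. -/
def projSq (M : Matrix m ι ℝ) (e : m → ℝ) : ℝ := (M *ᵥ lsq M e) ⬝ᵥ (M *ᵥ lsq M e)

theorem normalEquations {M : Matrix m ι ℝ} {c : ℝ} (hc : 0 < c)
    (hM : ∀ v, c * (v ⬝ᵥ v) ≤ (M *ᵥ v) ⬝ᵥ (M *ᵥ v)) (e : m → ℝ) (v : ι → ℝ) :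
    (M *ᵥ v) ⬝ᵥ (M *ᵥ lsq M e) = (M *ᵥ v) ⬝ᵥ e := by
  have hpd : (Mᵀ * M).PosDef := by
    refine Matrix.PosDef.of_dotProduct_mulVec_pos ?_ fun v hv => ?_
    · have := Matrix.isHermitian_conjTranspose_mul_self M
      simpa [Matrix.conjTranspose_eq_transpose_of_trivial] using this
    · have h0 : 0 < v ⬝ᵥ v := lt_of_le_of_ne (sum_mul_self_nonneg v)
        (fun h => hv (dotProduct_self_eq_zero.1 h.symm))
      have := lt_of_lt_of_le (mul_pos hc h0) (hM v)
      rw [← Matrix.mulVec_mulVec, Matrix.dotProduct_mulVec, Matrix.vecMul_transpose]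
      simpa using this
  have hdet : IsUnit (Mᵀ * M).det := hpd.det_pos.ne'.isUnit
  have h1 : (Mᵀ * M) *ᵥ lsq M e = Mᵀ *ᵥ e := by
    rw [lsq, Matrix.mulVec_mulVec, Matrix.mul_nonsing_inv _ hdet, Matrix.one_mulVec]
  have h2 : ∀ w : m → ℝ, (M *ᵥ v) ⬝ᵥ w = v ⬝ᵥ (Mᵀ *ᵥ w) := by
    intro w; rw [Matrix.dotProduct_mulVec, Matrix.vecMul_transpose]
  rw [h2, h2, Matrix.mulVec_mulVec, h1]

/-- Completing the square. -/
theorem sub_mulVec_dotProduct_self {M : Matrix m ι ℝ} {c : ℝ} (hc : 0 < c)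
    (hM : ∀ v, c * (v ⬝ᵥ v) ≤ (M *ᵥ v) ⬝ᵥ (M *ᵥ v)) (e : m → ℝ) (v : ι → ℝ) :
    (e - M *ᵥ v) ⬝ᵥ (e - M *ᵥ v) =
      e ⬝ᵥ e - projSq M e + (M *ᵥ (v - lsq M e)) ⬝ᵥ (M *ᵥ (v - lsq M e)) := by
  have h1 := normalEquations hc hM e v
  have h2 := normalEquations hc hM e (lsq M e)
  have c1 : e ⬝ᵥ (M *ᵥ v) = (M *ᵥ v) ⬝ᵥ e := dotProduct_comm _ _
  have c2 : (M *ᵥ lsq M e) ⬝ᵥ (M *ᵥ v) = (M *ᵥ v) ⬝ᵥ (M *ᵥ lsq M e) := dotProduct_comm _ _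
  simp only [projSq, Matrix.mulVec_sub, sub_dotProduct, dotProduct_sub] at *
  linarith

theorem projSq_nonneg (M : Matrix m ι ℝ) (e : m → ℝ) : 0 ≤ projSq M e := sum_mul_self_nonneg _

end LeastSquares

/-! ### Gaussian integrals and tails of projected noise. -/

theorem lintegral_ofReal_fintype_prod {ι : Type*} [Fintype ι] {μ : ι → Measure ℝ}
    [∀ i, SigmaFinite (μ i)] {f : ι → ℝ → ℝ} (hf : ∀ i, Integrable (f i) (μ i))
    (h0 : ∀ i x, 0 ≤ f i x) :
    ∫⁻ x, ENNReal.ofReal (∏ i, f i (x i)) ∂(Measure.pi μ) =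
      ENNReal.ofReal (∏ i, ∫ x, f i x ∂(μ i)) := by
  rw [← ofReal_integral_eq_lintegral_ofReal (Integrable.fintype_prod hf)
    (ae_of_all _ fun x => Finset.prod_nonneg fun i _ => h0 i _), integral_fintype_prod_eq_prod]

section GaussianTail

variable {m ι : Type*} [Fintype m] [Fintype ι]

theorem lintegral_exp_dotProduct_gaussian (v : ℝ≥0) (b : m → ℝ) :
    ∫⁻ e, ENNReal.ofReal (Real.exp (b ⬝ᵥ e)) ∂(Measure.pi fun _ : m => gaussianReal 0 v) =
      ENNReal.ofReal (Real.exp (v * (b ⬝ᵥ b) / 2)) := by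
  simp only [dotProduct, Real.exp_sum]
  rw [lintegral_ofReal_fintype_prod (f := fun i x => Real.exp (b i * x))
    (fun i => integrable_exp_mul_gaussianReal _) (fun i x => (Real.exp_pos _).le)]
  congr 1
  have h : ∀ i, ∫ x, Real.exp (b i * x) ∂(gaussianReal 0 v) = Real.exp (v * (b i * b i) / 2) := by
    intro i
    have := mgf_gaussianReal (p := gaussianReal 0 v) (X := id) (μ := 0) (v := v) (by simp) (b i)
    simp only [mgf, id] at this
    rw [this]; congr 1; ring
  simp_rw [h]
  rw [← Real.exp_sum, Finset.mul_sum, Finset.sum_div]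

/-- The integral of `exp (-a ‖M γ‖²)` over all coefficient vectors `γ`. -/
def gaussMass (M : Matrix m ι ℝ) (a : ℝ) : ℝ≥0∞ :=
  ∫⁻ γ : ι → ℝ, ENNReal.ofReal (Real.exp (-(a * ((M *ᵥ γ) ⬝ᵥ (M *ᵥ γ)))))

theorem continuous_mulVec_dotProduct_self (M : Matrix m ι ℝ) :
    Continuous fun γ : ι → ℝ => (M *ᵥ γ) ⬝ᵥ (M *ᵥ γ) := by
  have : Continuous fun γ : ι → ℝ => M *ᵥ γ := Continuous.matrix_mulVec continuous_const continuous_id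
  exact this.dotProduct this

theorem gaussMass_ne_zero (M : Matrix m ι ℝ) (a : ℝ) : gaussMass M a ≠ 0 := by
  have hmeas : Measurable fun γ : ι → ℝ =>
      ENNReal.ofReal (Real.exp (-(a * ((M *ᵥ γ) ⬝ᵥ (M *ᵥ γ))))) :=
    (ENNReal.continuous_ofReal.comp (Real.continuous_exp.comp
      ((continuous_mulVec_dotProduct_self M).const_mul a).neg)).measurable
  rw [gaussMass, Ne, lintegral_eq_zero_iff hmeas]
  intro h
  have h2 : ∀ᵐ _γ : ι → ℝ, False := by
    filter_upwards [h] with γ hγ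
    have := Real.exp_pos (-(a * ((M *ᵥ γ) ⬝ᵥ (M *ᵥ γ))))
    simp only [Pi.zero_apply, ENNReal.ofReal_eq_zero] at hγ
    linarith
  have h3 : (volume : Measure (ι → ℝ)) Set.univ = 0 := by simpa [ae_iff] using h2
  exact (NeZero.ne (volume : Measure (ι → ℝ))) (Measure.measure_univ_eq_zero.1 h3)

theorem gaussMass_ne_top {M : Matrix m ι ℝ} {c a : ℝ} (hc : 0 < c)
    (hM : ∀ v, c * (v ⬝ᵥ v) ≤ (M *ᵥ v) ⬝ᵥ (M *ᵥ v)) (ha : 0 < a) : gaussMass M a ≠ ⊤ := by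
  have hle : gaussMass M a ≤ ∫⁻ γ : ι → ℝ, ENNReal.ofReal (∏ i, Real.exp (-(a * c) * γ i ^ 2)) := by
    refine lintegral_mono fun γ => ENNReal.ofReal_le_ofReal ?_
    rw [← Real.exp_sum]
    refine Real.exp_le_exp.2 ?_
    have := mul_le_mul_of_nonneg_left (hM γ) ha.le
    simp only [dotProduct, ← sq, ← Finset.mul_sum] at this ⊢
    linarith
  refine ne_top_of_le_ne_top ?_ hle
  rw [volume_pi, lintegral_ofReal_fintype_prod (f := fun _ x => Real.exp (-(a * c) * x ^ 2))
    (fun i => integrable_exp_neg_mul_sq (mul_pos ha hc)) (fun i x => (Real.exp_pos _).le)]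
  exact ENNReal.ofReal_ne_top

theorem gaussMass_mul_sq (M : Matrix m ι ℝ) (a : ℝ) {t : ℝ} (ht : 0 < t) :
    gaussMass M (a * t ^ 2) = ENNReal.ofReal (t⁻¹ ^ Fintype.card ι) * gaussMass M a := by
  have h1 : gaussMass M (a * t ^ 2) = ∫⁻ γ : ι → ℝ, (fun γ' : ι → ℝ =>
      ENNReal.ofReal (Real.exp (-(a * ((M *ᵥ γ') ⬝ᵥ (M *ᵥ γ')))))) (t • γ) := by
    refine lintegral_congr fun γ => ?_
    simp only [Matrix.mulVec_smul, smul_dotProduct, dotProduct_smul, smul_eq_mul]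
    congr 2; ring
  have hmeas : Measurable fun γ : ι → ℝ =>
      ENNReal.ofReal (Real.exp (-(a * ((M *ᵥ γ) ⬝ᵥ (M *ᵥ γ))))) :=
    (ENNReal.continuous_ofReal.comp (Real.continuous_exp.comp
      ((continuous_mulVec_dotProduct_self M).const_mul a).neg)).measurable
  rw [h1, ← lintegral_map hmeas (measurable_const_smul t), Measure.map_addHaar_smul _ ht.ne',
    lintegral_smul_measure, gaussMass, smul_eq_mul, Module.finrank_fintype_fun_eq_card,
    abs_of_pos (by positivity), inv_pow]

variable [DecidableEq ι]

theorem continuous_projSq (M : Matrix m ι ℝ) : Continuous (projSq M) := by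
  have h1 : Continuous fun e : m → ℝ => Mᵀ *ᵥ e :=
    Continuous.matrix_mulVec continuous_const continuous_id
  have h2 : Continuous fun e : m → ℝ => lsq M e :=
    Continuous.matrix_mulVec continuous_const h1
  exact (continuous_mulVec_dotProduct_self M).comp h2

/-- The exponential moments of the squared length of a projection of Gaussian noise. -/
theorem lintegral_exp_projSq {M : Matrix m ι ℝ} {c : ℝ} (hc : 0 < c)
    (hM : ∀ v, c * (v ⬝ᵥ v) ≤ (M *ᵥ v) ⬝ᵥ (M *ᵥ v)) {v : ℝ≥0} (hv : 0 < v) {θ : ℝ}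
    (h0 : 0 < θ) (h1 : θ < 1) :
    ∫⁻ e, ENNReal.ofReal (Real.exp (θ / (2 * v) * projSq M e))
        ∂(Measure.pi fun _ : m => gaussianReal 0 v) =
      ENNReal.ofReal ((√(1 - θ))⁻¹ ^ Fintype.card ι) := by
  have hv' : (0 : ℝ) < v := by exact_mod_cast hv
  set a : ℝ := θ / (2 * v) with ha
  have ha0 : 0 < a := by positivity
  -- Linearisation: completing the square in γ and translating by the least squares solution writes
  -- exp(a · `projSq`) as a Gaussian mixture of exponentials that are linear in e. No orthonormal
  -- basis or chi-square law is needed.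
  have key : ∀ e : m → ℝ, ENNReal.ofReal (Real.exp (a * projSq M e)) * gaussMass M a =
      ∫⁻ γ : ι → ℝ, ENNReal.ofReal (Real.exp (a * (2 * ((M *ᵥ γ) ⬝ᵥ e) -
        (M *ᵥ γ) ⬝ᵥ (M *ᵥ γ)))) := by
    intro e
    rw [gaussMass, ← lintegral_const_mul' _ _ ENNReal.ofReal_ne_top,
      ← lintegral_sub_right_eq_self _ (lsq M e)]
    refine lintegral_congr fun γ => ?_
    rw [← ENNReal.ofReal_mul (Real.exp_pos _).le, ← Real.exp_add]
    congr 2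
    have := sub_mulVec_dotProduct_self hc hM e γ
    have c1 : e ⬝ᵥ (M *ᵥ γ) = (M *ᵥ γ) ⬝ᵥ e := dotProduct_comm _ _
    have e1 : (e - M *ᵥ γ) ⬝ᵥ (e - M *ᵥ γ) =
        e ⬝ᵥ e - 2 * ((M *ᵥ γ) ⬝ᵥ e) + (M *ᵥ γ) ⬝ᵥ (M *ᵥ γ) := by
      simp only [sub_dotProduct, dotProduct_sub]; linarith
    rw [e1] at this
    rw [show (M *ᵥ (γ - lsq M e)) ⬝ᵥ (M *ᵥ (γ - lsq M e)) =
      projSq M e - 2 * ((M *ᵥ γ) ⬝ᵥ e) + (M *ᵥ γ) ⬝ᵥ (M *ᵥ γ) by linarith]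
    ring
  have hcont : Continuous fun z : (m → ℝ) × (ι → ℝ) =>
      Real.exp (a * (2 * ((M *ᵥ z.2) ⬝ᵥ z.1) - (M *ᵥ z.2) ⬝ᵥ (M *ᵥ z.2))) := by
    have h : Continuous fun z : (m → ℝ) × (ι → ℝ) => M *ᵥ z.2 :=
      Continuous.matrix_mulVec continuous_const continuous_snd
    exact Real.continuous_exp.comp
      (((h.dotProduct continuous_fst).const_mul 2 |>.sub (h.dotProduct h)).const_mul a)
  have h2 : (∫⁻ e, ENNReal.ofReal (Real.exp (a * projSq M e))
        ∂(Measure.pi fun _ : m => gaussianReal 0 v)) * gaussMass M a =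
      ENNReal.ofReal ((√(1 - θ))⁻¹ ^ Fintype.card ι) * gaussMass M a := by
    rw [← lintegral_mul_const' _ _ (gaussMass_ne_top hc hM ha0)]
    simp_rw [key]
    -- After Tonelli, the expectation over the noise replaces a by a(1 - θ) in the integral over γ,
    -- and rescaling γ by √(1 - θ) produces the constant.
    rw [lintegral_lintegral_swap (f := fun (e : m → ℝ) (γ : ι → ℝ) => ENNReal.ofReal
      (Real.exp (a * (2 * ((M *ᵥ γ) ⬝ᵥ e) - (M *ᵥ γ) ⬝ᵥ (M *ᵥ γ)))))
      (ENNReal.continuous_ofReal.comp hcont).measurable.aemeasurable,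
      ← gaussMass_mul_sq M a (Real.sqrt_pos.2 (by linarith)), Real.sq_sqrt (by linarith), gaussMass]
    refine lintegral_congr fun γ => ?_
    have h3 : ∀ e : m → ℝ, ENNReal.ofReal (Real.exp (a * (2 * ((M *ᵥ γ) ⬝ᵥ e) -
        (M *ᵥ γ) ⬝ᵥ (M *ᵥ γ)))) = ENNReal.ofReal (Real.exp (-(a * ((M *ᵥ γ) ⬝ᵥ (M *ᵥ γ))))) *
          ENNReal.ofReal (Real.exp (((2 * a) • (M *ᵥ γ)) ⬝ᵥ e)) := by
      intro e
      rw [← ENNReal.ofReal_mul (Real.exp_pos _).le, ← Real.exp_add, smul_dotProduct, smul_eq_mul]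
      congr 2; ring
    simp_rw [h3]
    rw [lintegral_const_mul' _ _ ENNReal.ofReal_ne_top, lintegral_exp_dotProduct_gaussian,
      ← ENNReal.ofReal_mul (Real.exp_pos _).le, ← Real.exp_add]
    congr 2
    rw [smul_dotProduct, dotProduct_smul, smul_eq_mul, smul_eq_mul, ha]
    field_simp
    ring
  exact (ENNReal.mul_left_inj (gaussMass_ne_zero M a) (gaussMass_ne_top hc hM ha0)).1 h2

/-- Chernoff's bound. The parameter θ stays free because the union bound needs it close to 1. -/
theorem measure_le_projSq_le {M : Matrix m ι ℝ} {c : ℝ} (hc : 0 < c)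
    (hM : ∀ v, c * (v ⬝ᵥ v) ≤ (M *ᵥ v) ⬝ᵥ (M *ᵥ v)) {v : ℝ≥0} (hv : 0 < v) {θ : ℝ}
    (h0 : 0 < θ) (h1 : θ < 1) (x : ℝ) :
    (Measure.pi fun _ : m => gaussianReal 0 v) {e | 2 * v * x < projSq M e} ≤
      ENNReal.ofReal (Real.exp (-(θ * x)) * (√(1 - θ))⁻¹ ^ Fintype.card ι) := by
  have hv' : (0 : ℝ) < v := by exact_mod_cast hv
  have hmeas : Measurable fun e => ENNReal.ofReal (Real.exp (θ / (2 * v) * projSq M e)) :=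
    (ENNReal.continuous_ofReal.comp (Real.continuous_exp.comp
      ((continuous_projSq M).const_mul _))).measurable
  have hmk := mul_meas_ge_le_lintegral (μ := Measure.pi fun _ : m => gaussianReal 0 v) hmeas
    (ENNReal.ofReal (Real.exp (θ * x)))
  rw [lintegral_exp_projSq hc hM hv h0 h1] at hmk
  have hsub : {e : m → ℝ | 2 * v * x < projSq M e} ⊆ {e | ENNReal.ofReal (Real.exp (θ * x)) ≤
      ENNReal.ofReal (Real.exp (θ / (2 * v) * projSq M e))} := by
    intro e he
    refine ENNReal.ofReal_le_ofReal (Real.exp_le_exp.2 ?_)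
    have := mul_le_mul_of_nonneg_left (le_of_lt he) (by positivity : 0 ≤ θ / (2 * v))
    refine le_trans (le_of_eq ?_) this
    field_simp
  refine (measure_mono hsub).trans ?_
  rw [ENNReal.ofReal_mul (Real.exp_pos _).le, Real.exp_neg,
    ENNReal.ofReal_inv_of_pos (Real.exp_pos _), mul_comm (ENNReal.ofReal (Real.exp (θ * x)))⁻¹,
    ← div_eq_mul_inv,
    ENNReal.le_div_iff_mul_le (by simp [Real.exp_pos]) (by simp), mul_comm]
  exact hmk

end GaussianTail

/-! ### One-dimensional integrals and moments. -/

section OneDimensional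

/-- The right-hand side is the maximum over x, attained at x = b/N; with z = b/(Nx) the claim is z
e^(1-z) ≤ 1 raised to the power N. This maximum replaces exact Inverse-Gamma integrals for both τ
and σ². -/
theorem rpow_neg_mul_exp_neg_div_le {x b N : ℝ} (hx : 0 < x) (hb : 0 < b) (hN : 0 ≤ N) :
    x ^ (-N) * Real.exp (-(b / x)) ≤ (N / (Real.exp 1 * b)) ^ N := by
  rcases hN.eq_or_lt with rfl | hN
  · simp only [neg_zero, Real.rpow_zero, one_mul]
    exact Real.exp_le_one_iff.2 (neg_nonpos.2 (by positivity))
  set z : ℝ := b / (N * x) with hz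
  have hz0 : 0 < z := by positivity
  have h1 : z * Real.exp (1 - z) ≤ 1 := by
    have h := Real.add_one_le_exp (z - 1)
    calc z * Real.exp (1 - z) ≤ Real.exp (z - 1) * Real.exp (1 - z) :=
          mul_le_mul_of_nonneg_right (by linarith) (Real.exp_pos _).le
      _ = 1 := by rw [← Real.exp_add]; simp
  have h2 : (z * Real.exp (1 - z)) ^ N ≤ 1 := Real.rpow_le_one (by positivity) h1 hN.le
  have h3 : x ^ (-N) * Real.exp (-(b / x)) =
      (N / (Real.exp 1 * b)) ^ N * (z * Real.exp (1 - z)) ^ N := by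
    rw [← Real.mul_rpow (by positivity) (by positivity)]
    have : N / (Real.exp 1 * b) * (z * Real.exp (1 - z)) = x⁻¹ * Real.exp (-z) := by
      rw [sub_eq_add_neg, Real.exp_add, hz]
      field_simp
    rw [this, Real.mul_rpow (by positivity) (by positivity), Real.rpow_neg hx.le,
      Real.inv_rpow hx.le, ← Real.exp_mul, hz]
    congr 2
    field_simp
  rw [h3]
  exact mul_le_of_le_one_right (by positivity) h2

/-- Only the order b^(-a) matters. Below x = b the integrand is bounded by its maximum, above it the
exponential is bounded by 1. -/
theorem exists_lintegral_rpow_mul_exp_neg_div_le {a : ℝ} (ha : 0 < a) :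
    ∃ C, 0 < C ∧ ∀ b, 0 < b →
      ∫⁻ x in Set.Ioi (0 : ℝ), ENNReal.ofReal (x ^ (-(a + 1)) * Real.exp (-(b / x))) ≤
        ENNReal.ofReal (C * b ^ (-a)) := by
  refine ⟨((a + 1) / Real.exp 1) ^ (a + 1) + 1 / a, by positivity, fun b hb => ?_⟩
  have hsplit : Set.Ioi (0 : ℝ) = Set.Ioc 0 b ∪ Set.Ioi b := (Set.Ioc_union_Ioi_eq_Ioi hb.le).symm
  rw [hsplit, add_mul, ENNReal.ofReal_add (by positivity) (by positivity)]
  refine (lintegral_union_le _ _ _).trans (add_le_add ?_ ?_)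
  · calc ∫⁻ x in Set.Ioc 0 b, ENNReal.ofReal (x ^ (-(a + 1)) * Real.exp (-(b / x)))
        ≤ ∫⁻ x in Set.Ioc 0 b, ENNReal.ofReal (((a + 1) / (Real.exp 1 * b)) ^ (a + 1)) := by
          refine setLIntegral_mono measurable_const fun x hx => ENNReal.ofReal_le_ofReal ?_
          exact rpow_neg_mul_exp_neg_div_le hx.1 hb (by linarith)
      _ = ENNReal.ofReal (((a + 1) / Real.exp 1) ^ (a + 1) * b ^ (-a)) := by
          rw [setLIntegral_const, Real.volume_Ioc, ← ENNReal.ofReal_mul (by positivity)]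
          congr 1
          rw [← div_div, Real.div_rpow (by positivity) hb.le, sub_zero, Real.rpow_add hb,
            Real.rpow_one, Real.rpow_neg hb.le]
          field_simp
  · calc ∫⁻ x in Set.Ioi b, ENNReal.ofReal (x ^ (-(a + 1)) * Real.exp (-(b / x)))
        ≤ ∫⁻ x in Set.Ioi b, ENNReal.ofReal (x ^ (-(a + 1))) := by
          refine setLIntegral_mono' measurableSet_Ioi fun x hx => ENNReal.ofReal_le_ofReal ?_
          have hx0 : 0 < x := hb.trans hx
          refine mul_le_of_le_one_right (by positivity) (Real.exp_le_one_iff.2 ?_)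
          exact neg_nonpos.2 (by positivity)
      _ = ENNReal.ofReal (1 / a * b ^ (-a)) := by
          rw [← ofReal_integral_eq_lintegral_ofReal (integrableOn_Ioi_rpow_of_lt (by linarith) hb)
            ((ae_restrict_iff' measurableSet_Ioi).2 (ae_of_all _ fun x hx =>
              Real.rpow_nonneg (hb.trans hx).le _)), integral_Ioi_rpow_of_lt (by linarith) hb]
          congr 1
          rw [show -(a + 1) + 1 = -a by ring]
          field_simp

theorem integrable_exp_neg_mul_sq_mul_pow {b : ℝ} (hb : 0 < b) (r : ℕ) :
    Integrable fun x : ℝ => Real.exp (-(b * x ^ 2)) * x ^ (2 * r) := by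
  have := integrable_rpow_mul_exp_neg_mul_sq hb (s := ((2 * r : ℕ) : ℝ))
    (lt_of_lt_of_le (by norm_num) (Nat.cast_nonneg _))
  simp_rw [Real.rpow_natCast] at this
  refine this.congr (ae_of_all _ fun x => ?_)
  simp only [neg_mul]; ring

/-- The dominating function in the bound on Gaussian moments. -/
def momKernel (r : ℕ) (u : ℝ) : ℝ := Real.exp (-(1 / 2 * u ^ 2)) * (1 + u ^ 2) ^ r

theorem momKernel_nonneg (r : ℕ) (u : ℝ) : 0 ≤ momKernel r u := by unfold momKernel; positivity

theorem integrable_momKernel (r : ℕ) : Integrable (momKernel r) := by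
  have h1 := integrable_exp_neg_mul_sq_mul_pow (b := 1 / 2) (by norm_num) 0
  have h2 := integrable_exp_neg_mul_sq_mul_pow (b := 1 / 2) (by norm_num) r
  refine ((h1.add h2).const_mul (2 ^ (r - 1))).mono' ?_ (ae_of_all _ fun u => ?_)
  · unfold momKernel
    exact (by fun_prop : Continuous fun u : ℝ =>
      Real.exp (-(1 / 2 * u ^ 2)) * (1 + u ^ 2) ^ r).aestronglyMeasurable
  · rw [Real.norm_of_nonneg (momKernel_nonneg r u)]
    have := add_pow_le (zero_le_one (α := ℝ)) (sq_nonneg u) r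
    rw [one_pow, ← pow_mul] at this
    have h := mul_le_mul_of_nonneg_left this (Real.exp_pos (-(1 / 2 * u ^ 2))).le
    simp only [momKernel, Pi.add_apply, mul_zero, pow_zero, mul_one]
    linarith

/-- With u = √(a/s)(x - c), Cauchy–Schwarz gives x² = (c + √(s/a) u)² ≤ (c² + s/a)(1 + u²). -/
theorem exp_mul_pow_le_momKernel {a s : ℝ} (ha : 0 < a) (hs : 0 < s) (r : ℕ) (c x : ℝ) :
    Real.exp (-(a * (x - c) ^ 2 / (2 * s))) * x ^ (2 * r) ≤
      (s / a * (1 + a * c ^ 2 / s)) ^ r * momKernel r (√(a / s) * (x - c)) := by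
  have hw : √(a / s) ^ 2 = a / s := Real.sq_sqrt (by positivity)
  unfold momKernel
  rw [show -(1 / 2 * (√(a / s) * (x - c)) ^ 2) = -(a * (x - c) ^ 2 / (2 * s)) by
    rw [mul_pow, hw]; field_simp, mul_left_comm]
  refine mul_le_mul_of_nonneg_left ?_ (Real.exp_pos _).le
  rw [← mul_pow, pow_mul]
  refine pow_le_pow_left₀ (sq_nonneg x) ?_ r
  rw [mul_pow, hw]
  have : s / a * (1 + a * c ^ 2 / s) * (1 + a / s * (x - c) ^ 2) =
      x ^ 2 + (s / a) * (1 - a / s * (c * (x - c))) ^ 2 := by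
    field_simp; ring
  rw [this]
  nlinarith [show 0 ≤ (s / a) * (1 - a / s * (c * (x - c))) ^ 2 by positivity]

theorem integral_momKernel_comp (r : ℕ) {w : ℝ} (hw : 0 < w) (c : ℝ) :
    Integrable (fun x => momKernel r (w * (x - c))) ∧
      ∫ x, momKernel r (w * (x - c)) = w⁻¹ * ∫ u, momKernel r u := by
  constructor
  · exact (((integrable_momKernel r).comp_mul_left' hw.ne').comp_sub_right c)
  · rw [integral_sub_right_eq_self (fun x => momKernel r (w * x)) c,
      Measure.integral_comp_mul_left, abs_of_pos (inv_pos.2 hw), smul_eq_mul]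

/-- The factors 1 + a cᵢ²/s separate the two kinds of columns: for a true column this is of order a,
for a spurious one it only reflects noise. -/
theorem lintegral_exp_mul_prod_pow_le {ι : Type*} [Fintype ι] {a s : ℝ} (ha : 0 < a) (hs : 0 < s)
    (r : ℕ) (c : ι → ℝ) :
    ∫⁻ β : ι → ℝ, ENNReal.ofReal (Real.exp (-(a * (∑ i, (β i - c i) ^ 2) / (2 * s))) *
        ∏ i, β i ^ (2 * r)) ≤
      ENNReal.ofReal (((s / a) ^ ((r : ℝ) + 1 / 2) * ∫ u, momKernel r u) ^ Fintype.card ι *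
        (∏ i, (1 + a * c i ^ 2 / s)) ^ r) := by
  have hw : 0 < √(a / s) := Real.sqrt_pos.2 (by positivity)
  calc _ ≤ ∫⁻ β : ι → ℝ, ENNReal.ofReal (∏ i, ((s / a * (1 + a * c i ^ 2 / s)) ^ r *
          momKernel r (√(a / s) * (β i - c i)))) := by
        refine lintegral_mono fun β => ENNReal.ofReal_le_ofReal ?_
        rw [show -(a * (∑ i, (β i - c i) ^ 2) / (2 * s)) = ∑ i, -(a * (β i - c i) ^ 2 / (2 * s)) by
          rw [Finset.mul_sum, Finset.sum_div, Finset.sum_neg_distrib], Real.exp_sum,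
          ← Finset.prod_mul_distrib]
        exact Finset.prod_le_prod (fun i _ => mul_nonneg (Real.exp_pos _).le
          (by rw [pow_mul]; positivity)) fun i _ => exp_mul_pow_le_momKernel ha hs r _ _
    _ = _ := by
        rw [volume_pi, lintegral_ofReal_fintype_prod
          (f := fun i x => (s / a * (1 + a * c i ^ 2 / s)) ^ r *
            momKernel r (√(a / s) * (x - c i)))
          (fun i => (integral_momKernel_comp r hw (c i)).1.const_mul _)
          (fun i x => mul_nonneg (by positivity) (momKernel_nonneg _ _))]
        congr 1
        simp_rw [integral_const_mul, (integral_momKernel_comp r hw _).2]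
        have h1 : (s / a) ^ ((r : ℝ) + 1 / 2) = (s / a) ^ r * (√(a / s))⁻¹ := by
          rw [Real.rpow_add (by positivity), Real.rpow_natCast, ← Real.sqrt_eq_rpow,
            ← Real.sqrt_inv, inv_div]
        rw [h1, ← Finset.prod_pow, ← Finset.card_univ, ← Finset.prod_const,
          ← Finset.prod_mul_distrib]
        exact Finset.prod_congr rfl fun i _ => by rw [mul_pow]; ring

end OneDimensional

/-! ### The normalizing constant of the pMOM prior. -/

section PriorConstant

variable {p : ℕ}

/-- The moment `∫ exp (-b x² / 2) x^{2r}`. -/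
def pureMom (r : ℕ) (b : ℝ) : ℝ := ∫ x : ℝ, Real.exp (-(b / 2 * x ^ 2)) * x ^ (2 * r)

theorem pureMom_pos (r : ℕ) {b : ℝ} (hb : 0 < b) : 0 < pureMom r b := by
  rw [pureMom, integral_pos_iff_support_of_nonneg _
    (integrable_exp_neg_mul_sq_mul_pow (half_pos hb) r)]
  · refine lt_of_lt_of_le ?_ (measure_mono (s := Set.Ioi (0 : ℝ)) fun x hx => ?_)
    · simp
    · have : (0 : ℝ) < x := hx
      simp only [Function.mem_support]
      positivity
  · exact fun x => mul_nonneg (Real.exp_pos _).le (by rw [pow_mul]; positivity)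

/-- The integral of the pMOM kernel without the Gaussian normalization. -/
def pmomInt (A : Matrix (Fin p) (Fin p) ℝ) (r : ℕ) (k : Finset (Fin p)) : ℝ :=
  ∫ b : k → ℝ, Real.exp (-((b ⬝ᵥ (subPrec A k *ᵥ b)) / 2)) * ∏ i, b i ^ (2 * r)

theorem prod_pow_two_mul_nonneg {ι : Type*} [Fintype ι] (b : ι → ℝ) (r : ℕ) :
    0 ≤ ∏ i, b i ^ (2 * r) :=
  Finset.prod_nonneg fun i _ => by rw [pow_mul]; positivity

theorem integral_exp_mul_prod_pow (r : ℕ) {b : ℝ} (hb : 0 < b) (ι : Type*) [Fintype ι] :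
    Integrable (fun x : ι → ℝ => Real.exp (-(b * (x ⬝ᵥ x) / 2)) * ∏ i, x i ^ (2 * r)) ∧
    ∫ x : ι → ℝ, Real.exp (-(b * (x ⬝ᵥ x) / 2)) * ∏ i, x i ^ (2 * r) =
      pureMom r b ^ Fintype.card ι := by
  have h : (fun x : ι → ℝ => Real.exp (-(b * (x ⬝ᵥ x) / 2)) * ∏ i, x i ^ (2 * r)) =
      fun x => ∏ i, (Real.exp (-(b / 2 * x i ^ 2)) * x i ^ (2 * r)) := by
    ext x
    rw [Finset.prod_mul_distrib, ← Real.exp_sum]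
    congr 2
    simp only [dotProduct, Finset.mul_sum, Finset.sum_div, ← Finset.sum_neg_distrib]
    exact Finset.sum_congr rfl fun i _ => by ring
  rw [h]
  constructor
  · exact Integrable.fintype_prod (f := fun _ x => Real.exp (-(b / 2 * x ^ 2)) * x ^ (2 * r))
      fun i => integrable_exp_neg_mul_sq_mul_pow (half_pos hb) r
  · rw [integral_fintype_prod_volume_eq_pow
      (f := fun x => Real.exp (-(b / 2 * x ^ 2)) * x ^ (2 * r)), pureMom]

theorem EigenvaluesBetween.pmomInt_bounds {A : Matrix (Fin p) (Fin p) ℝ} {a₁ a₂ : ℝ}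
    (h : EigenvaluesBetween A a₁ a₂) (h1 : 0 < a₁) (h2 : 0 < a₂) (r : ℕ) (k : Finset (Fin p)) :
    pureMom r a₂ ^ k.card ≤ pmomInt A r k ∧ pmomInt A r k ≤ pureMom r a₁ ^ k.card := by
  have i1 := integral_exp_mul_prod_pow r h1 k
  have i2 := integral_exp_mul_prod_pow r h2 k
  have hcard : Fintype.card k = k.card := by simp
  have e1 : ∀ b : k → ℝ, Real.exp (-((b ⬝ᵥ (subPrec A k *ᵥ b)) / 2)) * ∏ i, b i ^ (2 * r) ≤
      Real.exp (-(a₁ * (b ⬝ᵥ b) / 2)) * ∏ i, b i ^ (2 * r) := fun b =>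
    mul_le_mul_of_nonneg_right (Real.exp_le_exp.2 (by linarith [(h.quadForm_bounds k b).1]))
      (prod_pow_two_mul_nonneg b r)
  have e2 : ∀ b : k → ℝ, Real.exp (-(a₂ * (b ⬝ᵥ b) / 2)) * ∏ i, b i ^ (2 * r) ≤
      Real.exp (-((b ⬝ᵥ (subPrec A k *ᵥ b)) / 2)) * ∏ i, b i ^ (2 * r) := fun b =>
    mul_le_mul_of_nonneg_right (Real.exp_le_exp.2 (by linarith [(h.quadForm_bounds k b).2]))
      (prod_pow_two_mul_nonneg b r)
  have hcont : Continuous fun b : k → ℝ =>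
      Real.exp (-((b ⬝ᵥ (subPrec A k *ᵥ b)) / 2)) * ∏ i, b i ^ (2 * r) := by
    have h3 : Continuous fun b : k → ℝ => subPrec A k *ᵥ b :=
      Continuous.matrix_mulVec continuous_const continuous_id
    have h4 : Continuous fun b : k → ℝ => b ⬝ᵥ (subPrec A k *ᵥ b) := continuous_id.dotProduct h3
    exact (Real.continuous_exp.comp (h4.div_const 2).neg).mul (by fun_prop)
  have hint : Integrable fun b : k → ℝ =>
      Real.exp (-((b ⬝ᵥ (subPrec A k *ᵥ b)) / 2)) * ∏ i, b i ^ (2 * r) := by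
    refine i1.1.mono' hcont.aestronglyMeasurable (ae_of_all _ fun b => ?_)
    rw [Real.norm_of_nonneg (mul_nonneg (Real.exp_pos _).le (prod_pow_two_mul_nonneg b r))]
    exact e1 b
  rw [← hcard]
  exact ⟨i2.2 ▸ integral_mono i2.1 hint e2, i1.2 ▸ integral_mono hint i1.1 e1⟩

/-- The Gaussian constant and the determinant occur both in the kernel and in `pmomConst`, hence
cancel; only `pmomInt` has to be estimated. -/
theorem EigenvaluesBetween.pmomDensity_eq {A : Matrix (Fin p) (Fin p) ℝ} {a₁ a₂ : ℝ}
    (h : EigenvaluesBetween A a₁ a₂) (h1 : 0 < a₁) (r : ℕ) (k : Finset (Fin p))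
    (β : k → ℝ) (τ s : ℝ) :
    pmomDensity A r k β τ s = (pmomInt A r k)⁻¹ * (τ * s) ^ (-(((r : ℝ) + 1 / 2) * k.card)) *
      (Real.exp (-((β ⬝ᵥ (subPrec A k *ᵥ β)) / (2 * (τ * s)))) * ∏ i, β i ^ (2 * r)) := by
  set D : ℝ := (2 * Real.pi) ^ (-((k.card : ℝ) / 2)) * Real.sqrt (subPrec A k).det with hD
  have hD0 : D ≠ 0 := by
    have := (h.subPrec_posDef h1 k).det_pos
    positivity
  have hconst : pmomConst A r k = D⁻¹ * (pmomInt A r k)⁻¹ := by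
    rw [pmomConst, ← mul_inv, pmomInt, ← integral_const_mul]
    congr 2
    ext b
    rw [pmomKernel, Real.one_rpow, mul_one, mul_one, hD]
    ring
  rw [pmomDensity, hconst, pmomKernel,
    show -((r : ℝ) * k.card) - (k.card : ℝ) / 2 = -(((r : ℝ) + 1 / 2) * k.card) by ring]
  field_simp
  rw [hD]
  ring

end PriorConstant

/-! ### Upper bounds for marginal densities. -/

section MarginalUpper

/-- The marginal density with values in `[0, ∞]`. -/
def emarginal {n p : ℕ} (X : Matrix (Fin n) (Fin p) ℝ) (A : Matrix (Fin p) (Fin p) ℝ) (r : ℕ)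
    (α₁ α₂ : ℝ) (k : Finset (Fin p)) (y : Fin n → ℝ) : ℝ≥0∞ :=
  ∫⁻ τ in Set.Ioi (0 : ℝ), ∫⁻ s in Set.Ioi (0 : ℝ), ∫⁻ β : k → ℝ,
    ENNReal.ofReal (likelihood X k y β s * pmomDensity A r k β τ s * tauDensity n τ *
      sigmaSqDensity α₁ α₂ s)

theorem tauDensity_nonneg (n : ℕ) {τ : ℝ} (hτ : 0 < τ) : 0 ≤ tauDensity n τ := by
  have := Real.Gamma_pos_of_pos (show (0 : ℝ) < 1 / 2 by norm_num)
  unfold tauDensity; positivity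

theorem sigmaSqDensity_nonneg {α₁ α₂ : ℝ} (h1 : 0 < α₁) (h2 : 0 < α₂) {s : ℝ} (hs : 0 < s) :
    0 ≤ sigmaSqDensity α₁ α₂ s := by
  have := Real.Gamma_pos_of_pos h1
  unfold sigmaSqDensity; positivity

theorem exists_lintegral_tauDensity_le :
    ∃ C, 1 ≤ C ∧ ∀ n : ℕ, 1 ≤ n → ∀ N a : ℝ, 0 ≤ N → 0 < a →
      ∫⁻ τ in Set.Ioi (0 : ℝ), ENNReal.ofReal ((τ * a) ^ (-N) * tauDensity n τ) ≤
        ENNReal.ofReal (C * (a ^ (-N) * (2 * N / n) ^ N)) := by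
  obtain ⟨C, hC, h⟩ := exists_lintegral_rpow_mul_exp_neg_div_le (a := 1 / 2) (by norm_num)
  have hG := Real.Gamma_pos_of_pos (show (0 : ℝ) < 1 / 2 by norm_num)
  refine ⟨max 1 (C / Real.Gamma (1 / 2) * 2 ^ (1 / 2 : ℝ)), le_max_left _ _,
    fun n hn N a hN ha => ?_⟩
  have hn0 : (0 : ℝ) < n := by exact_mod_cast hn
  have he : (2 : ℝ) ≤ Real.exp 1 := by linarith [Real.add_one_le_exp 1]
  set c : ℝ := a ^ (-N) * (2 * N / n) ^ N with hc
  have hc0 : 0 ≤ c := by positivity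
  calc _ ≤ ∫⁻ τ in Set.Ioi (0 : ℝ), ENNReal.ofReal (c * (((n : ℝ) / 2) ^ (1 / 2 : ℝ) /
          Real.Gamma (1 / 2)) * (τ ^ (-((1 / 2 : ℝ) + 1)) * Real.exp (-((n / 4 : ℝ) / τ)))) := by
        refine setLIntegral_mono' measurableSet_Ioi fun τ (hτ : 0 < τ) =>
          ENNReal.ofReal_le_ofReal ?_
        have h1 := rpow_neg_mul_exp_neg_div_le hτ (show (0 : ℝ) < n / 4 by positivity) hN
        have h2 : (N / (Real.exp 1 * (n / 4))) ^ N ≤ (2 * N / n) ^ N := by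
          refine Real.rpow_le_rpow (by positivity) ?_ hN
          rw [div_le_div_iff₀ (by positivity) hn0]
          have := mul_le_mul_of_nonneg_right he (mul_nonneg hN hn0.le)
          linarith
        have h3 := h1.trans h2
        -- The exponential is split into equal halves: one compensates τ^(-N), the other keeps the
        -- density integrable, with an integral bounded uniformly in n.
        rw [Real.mul_rpow hτ.le ha.le, tauDensity,
          show -((n : ℝ) / (2 * τ)) = -((n / 4 : ℝ) / τ) + -((n / 4 : ℝ) / τ) by field_simp; ring,
          Real.exp_add, show (-(3 / 2) : ℝ) = -((1 / 2 : ℝ) + 1) by norm_num]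
        have h4 : 0 ≤ a ^ (-N) * (((n : ℝ) / 2) ^ (1 / 2 : ℝ) / Real.Gamma (1 / 2)) *
            (τ ^ (-((1 / 2 : ℝ) + 1)) * Real.exp (-((n / 4 : ℝ) / τ))) := by positivity
        have h5 := mul_le_mul_of_nonneg_left h3 h4
        rw [hc]
        refine (le_of_eq ?_).trans (h5.trans (le_of_eq ?_)) <;> ring
    _ = ENNReal.ofReal (c * (((n : ℝ) / 2) ^ (1 / 2 : ℝ) / Real.Gamma (1 / 2))) *
          ∫⁻ τ in Set.Ioi (0 : ℝ), ENNReal.ofReal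
            (τ ^ (-((1 / 2 : ℝ) + 1)) * Real.exp (-((n / 4 : ℝ) / τ))) := by
        rw [← lintegral_const_mul' _ _ ENNReal.ofReal_ne_top]
        exact lintegral_congr fun τ => ENNReal.ofReal_mul (by positivity)
    _ ≤ ENNReal.ofReal (c * (((n : ℝ) / 2) ^ (1 / 2 : ℝ) / Real.Gamma (1 / 2))) *
          ENNReal.ofReal (C * (n / 4 : ℝ) ^ (-(1 / 2 : ℝ))) :=
        mul_le_mul_right (h _ (by positivity)) _
    _ ≤ _ := by
        rw [← ENNReal.ofReal_mul (by positivity)]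
        refine ENNReal.ofReal_le_ofReal ?_
        have h6 : ((n : ℝ) / 2) ^ (1 / 2 : ℝ) * (n / 4 : ℝ) ^ (-(1 / 2 : ℝ)) = 2 ^ (1 / 2 : ℝ) := by
          rw [Real.rpow_neg (by positivity), ← div_eq_mul_inv,
            ← Real.div_rpow (by positivity) (by positivity)]
          congr 1
          field_simp; norm_num
        calc _ = (C / Real.Gamma (1 / 2) *
              (((n : ℝ) / 2) ^ (1 / 2 : ℝ) * (n / 4 : ℝ) ^ (-(1 / 2 : ℝ)))) * c := by
              field_simp
          _ ≤ _ := by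
              rw [h6]
              exact mul_le_mul_of_nonneg_right (le_max_right _ _) hc0

/-- The likelihood part s^(-n/2) exp(-B/s) is bounded by its maximum over s, so the prior integrates
to a constant free of n. -/
theorem exists_lintegral_sigmaSqDensity_le {α₁ α₂ : ℝ} (h1 : 0 < α₁) (h2 : 0 < α₂) :
    ∃ C, 1 ≤ C ∧ ∀ n : ℕ, ∀ B : ℝ, 0 < B →
      ∫⁻ s in Set.Ioi (0 : ℝ), ENNReal.ofReal ((2 * Real.pi * s) ^ (-((n : ℝ) / 2)) *
          Real.exp (-(B / s)) * sigmaSqDensity α₁ α₂ s) ≤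
        ENNReal.ofReal (C * ((2 * Real.pi) ^ (-((n : ℝ) / 2)) *
          (n / (Real.exp 1 * (2 * B))) ^ ((n : ℝ) / 2))) := by
  obtain ⟨C, hC, h⟩ := exists_lintegral_rpow_mul_exp_neg_div_le h1
  have hG := Real.Gamma_pos_of_pos h1
  refine ⟨max 1 (C * α₂ ^ (-α₁) * (α₂ ^ α₁ / Real.Gamma α₁)), le_max_left _ _, fun n B hB => ?_⟩
  set c : ℝ := (2 * Real.pi) ^ (-((n : ℝ) / 2)) *
    (n / (Real.exp 1 * (2 * B))) ^ ((n : ℝ) / 2) with hc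
  have hc0 : 0 ≤ c := by positivity
  calc _ ≤ ∫⁻ s in Set.Ioi (0 : ℝ), ENNReal.ofReal (c * (α₂ ^ α₁ / Real.Gamma α₁) *
          (s ^ (-(α₁ + 1)) * Real.exp (-(α₂ / s)))) := by
        refine setLIntegral_mono' measurableSet_Ioi fun s (hs : 0 < s) =>
          ENNReal.ofReal_le_ofReal ?_
        have h3 := rpow_neg_mul_exp_neg_div_le hs hB (show (0 : ℝ) ≤ n / 2 by positivity)
        rw [show (n / 2 : ℝ) / (Real.exp 1 * B) = n / (Real.exp 1 * (2 * B)) by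
          field_simp] at h3
        rw [Real.mul_rpow (by positivity) hs.le, sigmaSqDensity]
        have h4 : 0 ≤ (2 * Real.pi) ^ (-((n : ℝ) / 2)) * (α₂ ^ α₁ / Real.Gamma α₁) *
          (s ^ (-(α₁ + 1)) * Real.exp (-(α₂ / s))) := by positivity
        have h5 := mul_le_mul_of_nonneg_left h3 h4
        rw [hc]
        refine (le_of_eq ?_).trans (h5.trans (le_of_eq ?_)) <;> ring
    _ = ENNReal.ofReal (c * (α₂ ^ α₁ / Real.Gamma α₁)) *
          ∫⁻ s in Set.Ioi (0 : ℝ), ENNReal.ofReal (s ^ (-(α₁ + 1)) * Real.exp (-(α₂ / s))) := by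
        rw [← lintegral_const_mul' _ _ ENNReal.ofReal_ne_top]
        exact lintegral_congr fun τ => ENNReal.ofReal_mul (by positivity)
    _ ≤ ENNReal.ofReal (c * (α₂ ^ α₁ / Real.Gamma α₁)) * ENNReal.ofReal (C * α₂ ^ (-α₁)) :=
        mul_le_mul_right (h _ h2) _
    _ ≤ _ := by
        rw [← ENNReal.ofReal_mul (by positivity)]
        refine ENNReal.ofReal_le_ofReal ?_
        calc _ = (C * α₂ ^ (-α₁) * (α₂ ^ α₁ / Real.Gamma α₁)) * c := by ring
          _ ≤ _ := mul_le_mul_of_nonneg_right (le_max_right _ _) hc0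

variable {n p : ℕ}

/-- The integral over the coefficients, when the residual sum of squares grows at least like
`Q + a ‖β - c‖²`. -/
theorem lintegral_likelihood_mul_pmomDensity_le {X : Matrix (Fin n) (Fin p) ℝ}
    {A : Matrix (Fin p) (Fin p) ℝ} {a₁ a₂ : ℝ} (hA : EigenvaluesBetween A a₁ a₂) (h1 : 0 < a₁)
    (h2 : 0 < a₂) (r : ℕ) {k : Finset (Fin p)} {y : Fin n → ℝ} {c N v : k → ℝ} {a Q B : ℝ}
    (ha : 0 < a)
    (hQ : ∀ β : k → ℝ, Q + a * ∑ i, (β i - c i) ^ 2 ≤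
      (y - subDesign X k *ᵥ β) ⬝ᵥ (y - subDesign X k *ᵥ β))
    (hN : ∀ i, ∀ s : ℝ, 0 < s → 1 + a * c i ^ 2 / s ≤ N i * Real.exp (v i / s))
    (hB : 2 * B ≤ Q - 2 * r * ∑ i, v i) {τ s : ℝ} (hτ : 0 < τ) (hs : 0 < s) :
    ∫⁻ β : k → ℝ, ENNReal.ofReal (likelihood X k y β s * pmomDensity A r k β τ s) ≤
      ENNReal.ofReal (((∫ u, momKernel r u) / pureMom r a₂) ^ k.card * (∏ i, N i) ^ r *
        (τ * a) ^ (-(((r : ℝ) + 1 / 2) * k.card)) *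
        ((2 * Real.pi * s) ^ (-((n : ℝ) / 2)) * Real.exp (-(B / s)))) := by
  set ρ : ℝ := (r : ℝ) + 1 / 2 with hρ
  have hρ0 : 0 ≤ ρ := by positivity
  set G : ℝ := ∫ u, momKernel r u with hG
  have hG0 : 0 ≤ G := integral_nonneg fun u => momKernel_nonneg r u
  set J : ℝ := pureMom r a₂ with hJ
  have hJ0 : 0 < J := pureMom_pos r h2
  have hI := (hA.pmomInt_bounds h1 h2 r k).1
  rw [← hJ] at hI
  have hI0 : 0 < pmomInt A r k := lt_of_lt_of_le (pow_pos hJ0 _) hI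
  set P : ℝ := (2 * Real.pi * s) ^ (-((n : ℝ) / 2)) with hP
  have hP0 : 0 ≤ P := by positivity
  set T : ℝ := (τ * s) ^ (-(ρ * k.card)) with hT
  have hT0 : 0 ≤ T := by positivity
  calc _ ≤ ∫⁻ β : k → ℝ, ENNReal.ofReal (P * Real.exp (-(Q / (2 * s))) * ((J ^ k.card)⁻¹ * T)) *
          ENNReal.ofReal (Real.exp (-(a * (∑ i, (β i - c i) ^ 2) / (2 * s))) *
            ∏ i, β i ^ (2 * r)) := by
        refine lintegral_mono fun β => ?_
        rw [← ENNReal.ofReal_mul (by positivity)]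
        refine ENNReal.ofReal_le_ofReal ?_
        rw [hA.pmomDensity_eq h1, likelihood, ← hP, ← hρ, ← hT]
        have e1 : Real.exp (-(((y - subDesign X k *ᵥ β) ⬝ᵥ (y - subDesign X k *ᵥ β)) / (2 * s))) ≤
            Real.exp (-(Q / (2 * s))) * Real.exp (-(a * (∑ i, (β i - c i) ^ 2) / (2 * s))) := by
          rw [← Real.exp_add]
          refine Real.exp_le_exp.2 ?_
          rw [← neg_add, ← add_div]
          exact neg_le_neg (div_le_div_of_nonneg_right (hQ β) (by positivity))
        have e2 : Real.exp (-((β ⬝ᵥ (subPrec A k *ᵥ β)) / (2 * (τ * s)))) ≤ 1 := by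
          refine Real.exp_le_one_iff.2 (neg_nonpos.2 (div_nonneg ?_ (by positivity)))
          exact le_trans (mul_nonneg h1.le (sum_mul_self_nonneg β)) (hA.quadForm_bounds k β).1
        have e3 : (pmomInt A r k)⁻¹ ≤ (J ^ k.card)⁻¹ := inv_anti₀ (pow_pos hJ0 _) hI
        have e4 := prod_pow_two_mul_nonneg β r
        calc _ ≤ P * (Real.exp (-(Q / (2 * s))) *
              Real.exp (-(a * (∑ i, (β i - c i) ^ 2) / (2 * s)))) * ((J ^ k.card)⁻¹ * T *
                (1 * ∏ i, β i ^ (2 * r))) := by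
              gcongr
          _ = _ := by ring
    _ ≤ ENNReal.ofReal (P * Real.exp (-(Q / (2 * s))) * ((J ^ k.card)⁻¹ * T)) *
          ENNReal.ofReal (((s / a) ^ ρ * G) ^ k.card * (∏ i, (1 + a * c i ^ 2 / s)) ^ r) := by
        rw [lintegral_const_mul' _ _ ENNReal.ofReal_ne_top]
        refine mul_le_mul_right ?_ _
        have := lintegral_exp_mul_prod_pow_le ha hs r c
        simpa only [Fintype.card_coe] using this
    _ ≤ _ := by
        rw [← ENNReal.ofReal_mul (by positivity)]
        refine ENNReal.ofReal_le_ofReal ?_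
        have hprod0 : 0 ≤ ∏ i, (1 + a * c i ^ 2 / s) := Finset.prod_nonneg fun i _ => by positivity
        have hN0 : 0 ≤ ∏ i, N i := Finset.prod_nonneg fun i _ => by
          have := hN i s hs
          have h0 : 0 < N i * Real.exp (v i / s) := lt_of_lt_of_le (by positivity) this
          exact (pos_of_mul_pos_left h0 (Real.exp_pos _).le).le
        have e1 : (∏ i, (1 + a * c i ^ 2 / s)) ^ r ≤
            (∏ i, N i) ^ r * Real.exp (r * (∑ i, v i) / s) := by
          have : ∏ i, (1 + a * c i ^ 2 / s) ≤ (∏ i, N i) * Real.exp ((∑ i, v i) / s) := by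
            rw [Finset.sum_div, Real.exp_sum, ← Finset.prod_mul_distrib]
            exact Finset.prod_le_prod (fun i _ => by positivity) fun i _ => hN i s hs
          refine (pow_le_pow_left₀ hprod0 this r).trans (le_of_eq ?_)
          rw [mul_pow, ← Real.exp_nat_mul]
          congr 2; ring
        -- The powers of s cancel: the prior contributes s^(-ρ|k|) and the Gaussian moments
        -- s^(ρ|k|). What is left factors into a function of τ and a function of s.
        have e2 : T * ((s / a) ^ ρ) ^ k.card = (τ * a) ^ (-(ρ * k.card)) := by
          rw [hT, ← Real.rpow_natCast ((s / a) ^ ρ), ← Real.rpow_mul (by positivity),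
            Real.rpow_neg (by positivity), Real.rpow_neg (by positivity),
            ← Real.inv_rpow (by positivity), ← Real.inv_rpow (by positivity),
            ← Real.mul_rpow (by positivity) (by positivity)]
          congr 1
          field_simp
        -- The noncentral parts of the moments were bounded by exponentials in 1/s precisely so that
        -- they can be charged to the residual sum of squares here.
        have e3 : Real.exp (-(Q / (2 * s))) * Real.exp (r * (∑ i, v i) / s) ≤
            Real.exp (-(B / s)) := by
          rw [← Real.exp_add]
          refine Real.exp_le_exp.2 ?_
          have : -(Q / (2 * s)) + r * (∑ i, v i) / s = -((Q - 2 * r * ∑ i, v i) / (2 * s)) := by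
            field_simp; ring
          rw [this, show B / s = (2 * B) / (2 * s) by field_simp]
          exact neg_le_neg (div_le_div_of_nonneg_right hB (by positivity))
        calc _ ≤ P * Real.exp (-(Q / (2 * s))) * ((J ^ k.card)⁻¹ * T) *
              (((s / a) ^ ρ * G) ^ k.card * ((∏ i, N i) ^ r * Real.exp (r * (∑ i, v i) / s))) := by
              gcongr
          _ = ((G / J) ^ k.card * (∏ i, N i) ^ r * (T * ((s / a) ^ ρ) ^ k.card) * P) *
              (Real.exp (-(Q / (2 * s))) * Real.exp (r * (∑ i, v i) / s)) := by
              rw [mul_pow, div_pow]; field_simp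
          _ ≤ ((G / J) ^ k.card * (∏ i, N i) ^ r * (T * ((s / a) ^ ρ) ^ k.card) * P) *
              Real.exp (-(B / s)) := by gcongr
          _ = _ := by rw [e2]; ring

/-- After the integration over β the bound is a product, so the τ and s integrals separate. The
constant depends on r, α₁, α₂, a₂ only, and the centre c, the pairs N, v and the level B are left to
the application. -/
theorem exists_emarginal_le (r : ℕ) {α₁ α₂ a₂ : ℝ} (hα₁ : 0 < α₁) (hα₂ : 0 < α₂) (h2 : 0 < a₂) :
    ∃ C : ℝ, 1 ≤ C ∧ ∀ (n p : ℕ) (X : Matrix (Fin n) (Fin p) ℝ) (A : Matrix (Fin p) (Fin p) ℝ)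
      (a₁ : ℝ) (k : Finset (Fin p)) (y : Fin n → ℝ) (c N v : k → ℝ) (a Q B : ℝ),
      1 ≤ n → EigenvaluesBetween A a₁ a₂ → 0 < a₁ → 0 < a →
      (∀ β : k → ℝ, Q + a * ∑ i, (β i - c i) ^ 2 ≤
        (y - subDesign X k *ᵥ β) ⬝ᵥ (y - subDesign X k *ᵥ β)) →
      (∀ i, ∀ s : ℝ, 0 < s → 1 + a * c i ^ 2 / s ≤ N i * Real.exp (v i / s)) →
      0 < B → 2 * B ≤ Q - 2 * r * ∑ i, v i →
      emarginal X A r α₁ α₂ k y ≤ ENNReal.ofReal (C ^ (k.card + 1) * (∏ i, N i) ^ r *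
        (a ^ (-(((r : ℝ) + 1 / 2) * k.card)) *
          ((k.card : ℝ) / n) ^ (((r : ℝ) + 1 / 2) * k.card)) *
        ((2 * Real.pi) ^ (-((n : ℝ) / 2)) * (n / (Real.exp 1 * (2 * B))) ^ ((n : ℝ) / 2))) := by
  obtain ⟨C₁, hC₁, ht⟩ := exists_lintegral_tauDensity_le
  obtain ⟨C₂, hC₂, hsig⟩ := exists_lintegral_sigmaSqDensity_le hα₁ hα₂
  set ρ : ℝ := (r : ℝ) + 1 / 2 with hρ
  have hρ0 : 0 ≤ ρ := by positivity
  set G : ℝ := ∫ u, momKernel r u with hG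
  have hG0 : 0 ≤ G := integral_nonneg fun u => momKernel_nonneg r u
  set J : ℝ := pureMom r a₂ with hJ
  have hJ0 : 0 < J := pureMom_pos r h2
  set C₃ : ℝ := max 1 (G / J * (2 * ρ) ^ ρ) with hC₃
  have hC₃1 : 1 ≤ C₃ := le_max_left _ _
  refine ⟨C₁ * C₂ * C₃, one_le_mul_of_one_le_of_one_le
    (one_le_mul_of_one_le_of_one_le hC₁ hC₂) hC₃1, ?_⟩
  intro n p X A a₁ k y c N v a Q B hn hA h1 ha hQ hN hB hB2
  set m : ℕ := k.card with hm
  have hn0 : (0 : ℝ) < n := by exact_mod_cast hn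
  have hN0 : 0 ≤ ∏ i, N i := Finset.prod_nonneg fun i _ => by
    have := hN i 1 one_pos
    have h0 : 0 < N i * Real.exp (v i / 1) := lt_of_lt_of_le (by positivity) this
    exact (pos_of_mul_pos_left h0 (Real.exp_pos _).le).le
  set c₀ : ℝ := (G / J) ^ m * (∏ i, N i) ^ r with hc₀
  have hc₀0 : 0 ≤ c₀ := by positivity
  set F : ℝ → ℝ := fun τ => (τ * a) ^ (-(ρ * m)) * tauDensity n τ with hF
  set H : ℝ → ℝ := fun s => (2 * Real.pi * s) ^ (-((n : ℝ) / 2)) * Real.exp (-(B / s)) *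
    sigmaSqDensity α₁ α₂ s with hH
  have hF0 : ∀ τ, 0 < τ → 0 ≤ F τ := fun τ hτ =>
    mul_nonneg (Real.rpow_nonneg (by positivity) _) (tauDensity_nonneg n hτ)
  calc emarginal X A r α₁ α₂ k y
      ≤ ∫⁻ τ in Set.Ioi (0 : ℝ), ∫⁻ s in Set.Ioi (0 : ℝ),
          ENNReal.ofReal (c₀ * F τ) * ENNReal.ofReal (H s) := by
        refine setLIntegral_mono' measurableSet_Ioi fun τ (hτ : 0 < τ) => ?_
        refine setLIntegral_mono' measurableSet_Ioi fun s (hs : 0 < s) => ?_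
        have hd : 0 ≤ tauDensity n τ * sigmaSqDensity α₁ α₂ s :=
          mul_nonneg (tauDensity_nonneg n hτ) (sigmaSqDensity_nonneg hα₁ hα₂ hs)
        have e1 : ∀ β : k → ℝ, ENNReal.ofReal (likelihood X k y β s * pmomDensity A r k β τ s *
            tauDensity n τ * sigmaSqDensity α₁ α₂ s) =
            ENNReal.ofReal (likelihood X k y β s * pmomDensity A r k β τ s) *
              ENNReal.ofReal (tauDensity n τ * sigmaSqDensity α₁ α₂ s) := fun β => by
          rw [← ENNReal.ofReal_mul' hd, ← mul_assoc]
        simp_rw [e1]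
        rw [lintegral_mul_const' _ _ ENNReal.ofReal_ne_top]
        refine (mul_le_mul_left (lintegral_likelihood_mul_pmomDensity_le hA h1 h2 r ha hQ hN hB2
          hτ hs) _).trans (le_of_eq ?_)
        rw [← ENNReal.ofReal_mul' hd, ← ENNReal.ofReal_mul (mul_nonneg hc₀0 (hF0 τ hτ))]
        congr 1
        simp only [hF, hH, hc₀]
        ring
    _ = ∫⁻ τ in Set.Ioi (0 : ℝ), ENNReal.ofReal (F τ) *
          (ENNReal.ofReal c₀ * ∫⁻ s in Set.Ioi (0 : ℝ), ENNReal.ofReal (H s)) := by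
        refine setLIntegral_congr_fun measurableSet_Ioi fun τ (hτ : 0 < τ) => ?_
        rw [lintegral_const_mul' _ _ ENNReal.ofReal_ne_top, ENNReal.ofReal_mul hc₀0]
        ring
    _ = (∫⁻ τ in Set.Ioi (0 : ℝ), ENNReal.ofReal (F τ)) *
          (ENNReal.ofReal c₀ * ∫⁻ s in Set.Ioi (0 : ℝ), ENNReal.ofReal (H s)) := by
        rw [lintegral_mul_const']
        exact ENNReal.mul_ne_top ENNReal.ofReal_ne_top
          (ne_top_of_le_ne_top ENNReal.ofReal_ne_top (hsig n B hB))
    _ ≤ ENNReal.ofReal (C₁ * (a ^ (-(ρ * m)) * (2 * (ρ * m) / n) ^ (ρ * m))) *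
          (ENNReal.ofReal c₀ * ENNReal.ofReal (C₂ * ((2 * Real.pi) ^ (-((n : ℝ) / 2)) *
          (n / (Real.exp 1 * (2 * B))) ^ ((n : ℝ) / 2)))) :=
        mul_le_mul' (ht n hn (ρ * m) a (by positivity) ha)
          (mul_le_mul_right (hsig n B hB) _)
    _ ≤ _ := by
        rw [← ENNReal.ofReal_mul hc₀0, ← ENNReal.ofReal_mul (by positivity)]
        refine ENNReal.ofReal_le_ofReal ?_
        have e1 : (2 * (ρ * m) / n) ^ (ρ * m) = ((2 * ρ) ^ ρ) ^ m * ((m : ℝ) / n) ^ (ρ * m) := by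
          rw [show 2 * (ρ * m) / n = 2 * ρ * (m / n : ℝ) by ring,
            Real.mul_rpow (by positivity) (by positivity), Real.rpow_mul (by positivity),
            Real.rpow_natCast]
        have e2 : C₁ * C₂ * (G / J * (2 * ρ) ^ ρ) ^ m ≤ (C₁ * C₂ * C₃) ^ (m + 1) := by
          have f1 : (G / J * (2 * ρ) ^ ρ) ^ m ≤ C₃ ^ m :=
            pow_le_pow_left₀ (by positivity) (le_max_right _ _) m
          have f2 : C₃ ^ m ≤ (C₁ * C₂ * C₃) ^ m := by
            refine pow_le_pow_left₀ (by positivity) ?_ m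
            exact le_mul_of_one_le_left (by positivity) (one_le_mul_of_one_le_of_one_le hC₁ hC₂)
          have f3 : C₁ * C₂ ≤ C₁ * C₂ * C₃ := le_mul_of_one_le_right (by positivity) hC₃1
          rw [pow_succ, mul_comm ((C₁ * C₂ * C₃) ^ m)]
          exact mul_le_mul f3 (f1.trans f2) (by positivity) (by positivity)
        set W : ℝ := (2 * Real.pi) ^ (-((n : ℝ) / 2)) *
          (n / (Real.exp 1 * (2 * B))) ^ ((n : ℝ) / 2) with hW
        have hW0 : 0 ≤ W := by positivity
        calc _ = (C₁ * C₂ * (G / J * (2 * ρ) ^ ρ) ^ m) * ((∏ i, N i) ^ r *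
              (a ^ (-(ρ * m)) * ((m : ℝ) / n) ^ (ρ * m)) * W) := by
              rw [e1, hc₀, mul_pow]; ring
          _ ≤ (C₁ * C₂ * C₃) ^ (m + 1) * ((∏ i, N i) ^ r *
              (a ^ (-(ρ * m)) * ((m : ℝ) / n) ^ (ρ * m)) * W) := by gcongr
          _ = _ := by ring

end MarginalUpper

/-! ### Lower bound for the marginal density of a model of fixed size. -/

section MarginalLower

/-- Stated so that only the box must be measurable, not the inner integrals. -/
theorem mul_measure_le_setLIntegral {α : Type*} [MeasurableSpace α] {μ : Measure α} {s t : Set α}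
    (ht : MeasurableSet t) (hts : t ⊆ s) {c : ℝ≥0∞} {f : α → ℝ≥0∞} (h : ∀ x ∈ t, c ≤ f x) :
    c * μ t ≤ ∫⁻ x in s, f x ∂μ := by
  rw [← setLIntegral_const]
  exact (setLIntegral_mono' ht h).trans (lintegral_mono_set hts)

variable {n p : ℕ}

/-- The likelihood is maximal at s = W/n. A relative window of width 1/n costs only the factor (1 +
1/n)^(n/2) ≤ e^(1/2). -/
theorem le_likelihood {X : Matrix (Fin n) (Fin p) ℝ} {k : Finset (Fin p)} {y : Fin n → ℝ}
    {β : k → ℝ} {W s : ℝ} (hn : 1 ≤ n) (hW : 0 < W)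
    (hβ : (y - subDesign X k *ᵥ β) ⬝ᵥ (y - subDesign X k *ᵥ β) ≤ W)
    (hs1 : W / n ≤ s) (hs2 : s ≤ W / n * (1 + 1 / n)) :
    Real.exp (-(1 / 2)) * ((2 * Real.pi) ^ (-((n : ℝ) / 2)) *
      (n / (Real.exp 1 * W)) ^ ((n : ℝ) / 2)) ≤ likelihood X k y β s := by
  have hn0 : (0 : ℝ) < n := by exact_mod_cast hn
  have hs0 : 0 < s := lt_of_lt_of_le (by positivity) hs1
  have e1 : Real.exp (-((n : ℝ) / 2)) ≤
      Real.exp (-(((y - subDesign X k *ᵥ β) ⬝ᵥ (y - subDesign X k *ᵥ β)) / (2 * s))) := by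
    refine Real.exp_le_exp.2 (neg_le_neg ?_)
    rw [div_le_div_iff₀ (by positivity) (by positivity)]
    rw [div_le_iff₀ hn0] at hs1
    linarith
  have e2 : Real.exp (-(1 / 2)) * ((n / W) ^ ((n : ℝ) / 2)) ≤ s ^ (-((n : ℝ) / 2)) := by
    have f1 : (1 + 1 / n : ℝ) ^ ((n : ℝ) / 2) ≤ Real.exp (1 / 2) := by
      have : (1 + 1 / n : ℝ) ≤ Real.exp (1 / n) := by
        rw [add_comm]; exact Real.add_one_le_exp _
      refine (Real.rpow_le_rpow (by positivity) this (by positivity)).trans (le_of_eq ?_)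
      rw [← Real.exp_mul]
      congr 1; field_simp
    have f2 : (W / n * (1 + 1 / n)) ^ (-((n : ℝ) / 2)) ≤ s ^ (-((n : ℝ) / 2)) :=
      Real.rpow_le_rpow_of_nonpos hs0 hs2 (by linarith)
    refine le_trans ?_ f2
    rw [Real.mul_rpow (by positivity) (by positivity), Real.rpow_neg (by positivity),
      Real.rpow_neg (by positivity), ← Real.inv_rpow (by positivity), inv_div, mul_comm,
      Real.exp_neg]
    exact mul_le_mul_of_nonneg_left (inv_anti₀ (by positivity) f1) (by positivity)
  have e3 : (n / (Real.exp 1 * W)) ^ ((n : ℝ) / 2) =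
      (n / W) ^ ((n : ℝ) / 2) * Real.exp (-((n : ℝ) / 2)) := by
    rw [show (n / (Real.exp 1 * W) : ℝ) = n / W * Real.exp (-1) by
      rw [Real.exp_neg]; field_simp, Real.mul_rpow (by positivity) (by positivity),
      ← Real.exp_mul]
    congr 2; ring
  rw [likelihood, Real.mul_rpow (by positivity) hs0.le, e3]
  calc _ = (2 * Real.pi) ^ (-((n : ℝ) / 2)) * (Real.exp (-(1 / 2)) * (n / W) ^ ((n : ℝ) / 2)) *
        Real.exp (-((n : ℝ) / 2)) := by ring
    _ ≤ _ := by gcongr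

theorem le_pmomDensity {A : Matrix (Fin p) (Fin p) ℝ} {a₁ a₂ : ℝ} (hA : EigenvaluesBetween A a₁ a₂)
    (h1 : 0 < a₁) (h2 : 0 < a₂) (r : ℕ) {k : Finset (Fin p)} {β : k → ℝ} {u v b M : ℝ}
    {τ s : ℝ} (hb : 0 ≤ b) (hβ : ∀ i, b ≤ |β i| ∧ |β i| ≤ M) (hu : 0 < u) (hu1 : u ≤ τ * s)
    (hv : τ * s ≤ v) :
    (pureMom r a₁ ^ k.card)⁻¹ * v ^ (-(((r : ℝ) + 1 / 2) * k.card)) *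
      (Real.exp (-(a₂ * (k.card * M ^ 2) / (2 * u))) * (b ^ (2 * r)) ^ k.card) ≤
    pmomDensity A r k β τ s := by
  have hI := hA.pmomInt_bounds h1 h2 r k
  have hI0 : 0 < pmomInt A r k := lt_of_lt_of_le (pow_pos (pureMom_pos r h2) _) hI.1
  have hJ := pureMom_pos r h1
  have hτs : 0 < τ * s := hu.trans_le hu1
  have hv0 : 0 < v := hτs.trans_le hv
  rw [hA.pmomDensity_eq h1]
  have e1 : v ^ (-(((r : ℝ) + 1 / 2) * k.card)) ≤ (τ * s) ^ (-(((r : ℝ) + 1 / 2) * k.card)) :=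
    Real.rpow_le_rpow_of_nonpos hτs hv (neg_nonpos.2 (by positivity))
  have e2 : β ⬝ᵥ β ≤ k.card * M ^ 2 := by
    have : ∀ i ∈ (Finset.univ : Finset k), β i * β i ≤ M ^ 2 := fun i _ => by
      rw [← sq, ← sq_abs]
      exact pow_le_pow_left₀ (abs_nonneg _) (hβ i).2 2
    simpa [dotProduct] using Finset.sum_le_card_nsmul _ _ _ this
  have e3 : Real.exp (-(a₂ * (k.card * M ^ 2) / (2 * u))) ≤
      Real.exp (-((β ⬝ᵥ (subPrec A k *ᵥ β)) / (2 * (τ * s)))) := by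
    refine Real.exp_le_exp.2 (neg_le_neg ?_)
    refine div_le_div₀ (by positivity) ?_ (by positivity) (by linarith)
    exact (hA.quadForm_bounds k β).2.trans (mul_le_mul_of_nonneg_left e2 h2.le)
  have e4 : (b ^ (2 * r)) ^ k.card ≤ ∏ i, β i ^ (2 * r) := by
    rw [← Fintype.card_coe k, ← Finset.card_univ, ← Finset.prod_const]
    refine Finset.prod_le_prod (fun i _ => by positivity) fun i _ => ?_
    rw [← (even_two_mul r).pow_abs (β i)]
    exact pow_le_pow_left₀ hb (hβ i).1 _
  have e5 : (pureMom r a₁ ^ k.card)⁻¹ ≤ (pmomInt A r k)⁻¹ := inv_anti₀ hI0 hI.2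
  gcongr

theorem le_tauDensity (hn : 1 ≤ n) {τ : ℝ} (h1 : (n : ℝ) ≤ τ) (h2 : τ ≤ 2 * n) :
    (Real.exp (-(1 / 2)) / (4 * Real.Gamma (1 / 2))) * (n : ℝ)⁻¹ ≤ tauDensity n τ := by
  have hn0 : (0 : ℝ) < n := by exact_mod_cast hn
  have hτ : 0 < τ := hn0.trans_le h1
  have hG := Real.Gamma_pos_of_pos (show (0 : ℝ) < 1 / 2 by norm_num)
  have e1 : (2 * n : ℝ) ^ (-(3 / 2) : ℝ) ≤ τ ^ (-(3 / 2) : ℝ) :=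
    Real.rpow_le_rpow_of_nonpos hτ h2 (by norm_num)
  have e2 : Real.exp (-(1 / 2)) ≤ Real.exp (-((n : ℝ) / (2 * τ))) := by
    refine Real.exp_le_exp.2 (neg_le_neg ?_)
    rw [div_le_div_iff₀ (by positivity) (by positivity)]
    linarith
  have e3 : ((n : ℝ) / 2) ^ (1 / 2 : ℝ) * (2 * n : ℝ) ^ (-(3 / 2) : ℝ) = (4 * n : ℝ)⁻¹ := by
    have : (2 * n : ℝ) ^ (-(3 / 2) : ℝ) = (2 * n : ℝ) ^ (-(1 / 2) : ℝ) * (2 * n : ℝ)⁻¹ := by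
      rw [← Real.rpow_neg_one, ← Real.rpow_add (by positivity)]; norm_num
    rw [this, Real.rpow_neg (by positivity), ← mul_assoc, ← Real.inv_rpow (by positivity),
      ← Real.mul_rpow (by positivity) (by positivity), ← Real.sqrt_eq_rpow,
      show (n : ℝ) / 2 * (2 * n : ℝ)⁻¹ = (1 / 2) ^ 2 by field_simp,
      Real.sqrt_sq (by norm_num)]
    field_simp; norm_num
  rw [tauDensity]
  calc _ = (((n : ℝ) / 2) ^ (1 / 2 : ℝ) * (2 * n : ℝ) ^ (-(3 / 2) : ℝ)) / Real.Gamma (1 / 2) *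
        Real.exp (-(1 / 2)) := by rw [e3]; field_simp
    _ = ((n : ℝ) / 2) ^ (1 / 2 : ℝ) / Real.Gamma (1 / 2) * (2 * n : ℝ) ^ (-(3 / 2) : ℝ) *
        Real.exp (-(1 / 2)) := by ring
    _ ≤ _ := by gcongr

theorem le_sigmaSqDensity {α₁ α₂ : ℝ} (h1 : 0 < α₁) (h2 : 0 < α₂) {s s₀ s₁ : ℝ} (hs₀ : 0 < s₀)
    (hs : s₀ ≤ s) (hs' : s ≤ s₁) :
    α₂ ^ α₁ / Real.Gamma α₁ * s₁ ^ (-(α₁ + 1)) * Real.exp (-(α₂ / s₀)) ≤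
      sigmaSqDensity α₁ α₂ s := by
  have hG := Real.Gamma_pos_of_pos h1
  have h0 : 0 < s := hs₀.trans_le hs
  have h0' : 0 < s₁ := h0.trans_le hs'
  have e1 : s₁ ^ (-(α₁ + 1)) ≤ s ^ (-(α₁ + 1)) :=
    Real.rpow_le_rpow_of_nonpos h0 hs' (by linarith)
  rw [sigmaSqDensity]
  gcongr

/-- The integral is restricted to a box: τ in [n, 2n], where the density of order 1/n meets length
n; s in a window of length at least s₀/n, the source of the factor n⁻¹; β in a cube of half-side h.
On the box τs is at most 4s₁n, so the prior of β costs n^(-ρT). -/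
theorem exists_le_emarginal (r : ℕ) {α₁ α₂ a₁ a₂ s₀ s₁ b : ℝ} (M : ℝ) (T : ℕ) (hα₁ : 0 < α₁)
    (hα₂ : 0 < α₂) (h1 : 0 < a₁) (h2 : 0 < a₂) (hs₀ : 0 < s₀) (hs₁ : 0 < s₁) (hb : 0 < b) :
    ∃ C : ℝ, 0 < C ∧ ∀ (n p : ℕ) (X : Matrix (Fin n) (Fin p) ℝ) (A : Matrix (Fin p) (Fin p) ℝ)
      (k : Finset (Fin p)) (y : Fin n → ℝ) (c : k → ℝ) (h W : ℝ),
      1 ≤ n → EigenvaluesBetween A a₁ a₂ → k.card = T → 0 < h →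
      (∀ β : k → ℝ, (∀ i, |β i - c i| ≤ h) → (∀ i, b ≤ |β i| ∧ |β i| ≤ M) ∧
        (y - subDesign X k *ᵥ β) ⬝ᵥ (y - subDesign X k *ᵥ β) ≤ W) →
      s₀ * n ≤ W → W ≤ s₁ * n →
      ENNReal.ofReal (C * (n : ℝ) ^ (-(((r : ℝ) + 1 / 2) * T)) * (n : ℝ)⁻¹ * h ^ T *
        ((2 * Real.pi) ^ (-((n : ℝ) / 2)) * (n / (Real.exp 1 * W)) ^ ((n : ℝ) / 2))) ≤
      emarginal X A r α₁ α₂ k y := by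
  have hG := Real.Gamma_pos_of_pos (show (0 : ℝ) < 1 / 2 by norm_num)
  have hG1 := Real.Gamma_pos_of_pos hα₁
  have hJ := pureMom_pos r h1
  set K₁ : ℝ := (pureMom r a₁ ^ T)⁻¹ * (4 * s₁) ^ (-(((r : ℝ) + 1 / 2) * T)) *
      (Real.exp (-(a₂ * (T * M ^ 2) / (2 * s₀))) * (b ^ (2 * r)) ^ T) with hK₁
  set K₂ : ℝ := Real.exp (-(1 / 2)) / (4 * Real.Gamma (1 / 2)) with hK₂
  set K₃ : ℝ := α₂ ^ α₁ / Real.Gamma α₁ * (2 * s₁) ^ (-(α₁ + 1)) * Real.exp (-(α₂ / s₀)) with hK₃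
  refine ⟨Real.exp (-(1 / 2)) * K₁ * K₂ * K₃ * s₀ * 2 ^ T, by positivity, ?_⟩
  intro n p X A k y c h W hn hA hk hh hβ hW0 hW1
  have hn0 : (0 : ℝ) < n := by exact_mod_cast hn
  have hn1 : (1 : ℝ) ≤ n := by exact_mod_cast hn
  have hWpos : 0 < W := lt_of_lt_of_le (by positivity) hW0
  set L : ℝ := (2 * Real.pi) ^ (-((n : ℝ) / 2)) * (n / (Real.exp 1 * W)) ^ ((n : ℝ) / 2) with hL
  set V : ℝ := (n : ℝ) ^ (-(((r : ℝ) + 1 / 2) * T)) with hV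
  set c₀ : ℝ := (Real.exp (-(1 / 2)) * L) * (K₁ * V) * (K₂ * (n : ℝ)⁻¹) * K₃ with hc₀
  have hc₀0 : 0 ≤ c₀ := by positivity
  have hpt : ∀ τ ∈ Set.Icc (n : ℝ) (2 * n), ∀ s ∈ Set.Icc (W / n) (W / n * (1 + 1 / n)),
      ∀ β ∈ Set.Icc (fun i => c i - h) (fun i => c i + h), ENNReal.ofReal c₀ ≤
        ENNReal.ofReal (likelihood X k y β s * pmomDensity A r k β τ s * tauDensity n τ *
          sigmaSqDensity α₁ α₂ s) := by
    intro τ hτ s hs β hβI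
    have hβ' := hβ β fun i => abs_le.2 ⟨by linarith [hβI.1 i], by linarith [hβI.2 i]⟩
    have q1 : s₀ ≤ W / n := (le_div_iff₀ hn0).2 hW0
    have q2 : W / n ≤ s₁ := (div_le_iff₀ hn0).2 hW1
    have q3 : s₀ ≤ s := q1.trans hs.1
    have q4 : s ≤ 2 * s₁ := by
      have : (1 / n : ℝ) ≤ 1 := by rw [div_le_one hn0]; exact hn1
      calc s ≤ W / n * (1 + 1 / n) := hs.2
        _ ≤ s₁ * 2 := mul_le_mul q2 (by linarith) (by positivity) hs₁.le
        _ = 2 * s₁ := by ring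
    have hτ0 : 0 < τ := hn0.trans_le hτ.1
    have g1 := le_likelihood hn hWpos hβ'.2 hs.1 hs.2
    have g2 := le_pmomDensity (A := A) (τ := τ) (s := s) (u := s₀) (v := 4 * s₁ * n) hA h1 h2 r
      hb.le hβ'.1 hs₀
      (by nlinarith [mul_le_mul (hn1.trans hτ.1) q3 hs₀.le hτ0.le])
      (by
        calc τ * s ≤ (2 * n) * (2 * s₁) := mul_le_mul hτ.2 q4 (hs₀.le.trans q3) (by positivity)
          _ = _ := by ring)
    have g3 := le_tauDensity hn hτ.1 hτ.2
    have g4 := le_sigmaSqDensity hα₁ hα₂ hs₀ q3 q4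
    have g2' : K₁ * V ≤ pmomDensity A r k β τ s := by
      refine le_trans (le_of_eq ?_) g2
      rw [hk, hK₁, hV, Real.mul_rpow (by positivity) hn0.le]
      ring
    refine ENNReal.ofReal_le_ofReal ?_
    have p1 : 0 ≤ likelihood X k y β s := le_trans (by positivity) g1
    have p2 : 0 ≤ pmomDensity A r k β τ s := le_trans (by positivity) g2'
    have p3 : 0 ≤ tauDensity n τ := le_trans (by positivity) g3
    rw [hc₀]
    gcongr
  have hvolβ : volume (Set.Icc (fun i : k => c i - h) (fun i => c i + h)) =
      ENNReal.ofReal ((2 * h) ^ T) := by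
    rw [Real.volume_Icc_pi]
    simp only [show ∀ i : k, c i + h - (c i - h) = 2 * h from fun i => by ring, Finset.prod_const,
      Finset.card_univ, Fintype.card_coe, hk]
    rw [ENNReal.ofReal_pow (by positivity)]
  have step1 : ∀ τ ∈ Set.Icc (n : ℝ) (2 * n), ∀ s ∈ Set.Icc (W / n) (W / n * (1 + 1 / n)),
      ENNReal.ofReal c₀ * ENNReal.ofReal ((2 * h) ^ T) ≤ ∫⁻ β : k → ℝ,
        ENNReal.ofReal (likelihood X k y β s * pmomDensity A r k β τ s * tauDensity n τ *
          sigmaSqDensity α₁ α₂ s) := by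
    intro τ hτ s hs
    rw [← hvolβ, ← setLIntegral_univ]
    exact mul_measure_le_setLIntegral measurableSet_Icc (Set.subset_univ _) (hpt τ hτ s hs)
  have step2 : ∀ τ ∈ Set.Icc (n : ℝ) (2 * n),
      ENNReal.ofReal c₀ * ENNReal.ofReal ((2 * h) ^ T) *
        volume (Set.Icc (W / n) (W / n * (1 + 1 / n))) ≤
      ∫⁻ s in Set.Ioi (0 : ℝ), ∫⁻ β : k → ℝ,
        ENNReal.ofReal (likelihood X k y β s * pmomDensity A r k β τ s * tauDensity n τ *
          sigmaSqDensity α₁ α₂ s) := fun τ hτ =>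
    mul_measure_le_setLIntegral measurableSet_Icc
      (fun s hs => lt_of_lt_of_le (by positivity : (0 : ℝ) < W / n) hs.1) (step1 τ hτ)
  have step3 : ENNReal.ofReal c₀ * ENNReal.ofReal ((2 * h) ^ T) *
        volume (Set.Icc (W / n) (W / n * (1 + 1 / n))) * volume (Set.Icc (n : ℝ) (2 * n)) ≤
      emarginal X A r α₁ α₂ k y :=
    mul_measure_le_setLIntegral measurableSet_Icc
      (fun τ hτ => lt_of_lt_of_le hn0 hτ.1) step2
  refine le_trans ?_ step3
  rw [Real.volume_Icc, Real.volume_Icc, ← ENNReal.ofReal_mul (by positivity),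
    ← ENNReal.ofReal_mul (by positivity), ← ENNReal.ofReal_mul' (by linarith)]
  refine ENNReal.ofReal_le_ofReal ?_
  have hvs : s₀ * (n : ℝ)⁻¹ ≤ W / n * (1 + 1 / n) - W / n := by
    have : W / n * (1 + 1 / n) - W / n = W / n * (n : ℝ)⁻¹ := by field_simp; ring
    rw [this]
    exact mul_le_mul_of_nonneg_right ((le_div_iff₀ hn0).2 hW0) (by positivity)
  calc _ = c₀ * (2 * h) ^ T * (s₀ * (n : ℝ)⁻¹) * (2 * n - n) := by
        rw [hc₀, mul_pow]; field_simp; ring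
    _ ≤ _ := by
        have : (0 : ℝ) ≤ 2 * n - n := by linarith
        gcongr

end MarginalLower

/-! ### Marginal densities at data generated by the true model. -/

section TrueModel

variable {n p : ℕ}

theorem mulVec_eq_subDesign_mulVec (X : Matrix (Fin n) (Fin p) ℝ) {K : Finset (Fin p)}
    {w : Fin p → ℝ} (hw : ∀ j ∉ K, w j = 0) :
    X *ᵥ w = subDesign X K *ᵥ fun j => w j := by
  ext i
  simp only [Matrix.mulVec, dotProduct, subDesign, Matrix.submatrix_apply, id]
  rw [Finset.sum_coe_sort K fun j => X i j * w j]
  exact (Finset.sum_subset (Finset.subset_univ K) fun j _ hj => by rw [hw j hj, mul_zero]).symm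

/-- The coefficient vector of a model, extended by `0`. -/
def extendZero {k : Finset (Fin p)} (β : k → ℝ) (j : Fin p) : ℝ :=
  if h : j ∈ k then β ⟨j, h⟩ else 0

theorem subDesign_mulVec (X : Matrix (Fin n) (Fin p) ℝ) {k : Finset (Fin p)} (β : k → ℝ) :
    subDesign X k *ᵥ β = X *ᵥ extendZero β := by
  rw [mulVec_eq_subDesign_mulVec X (K := k) fun j hj => by simp [extendZero, hj]]
  congr 1
  ext j
  simp [extendZero]

theorem mem_trueModel {β₀ : ℕ →₀ ℝ} {j : Fin p} : j ∈ trueModel p β₀ ↔ β₀ j ≠ 0 := by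
  simp [trueModel]

/-- On the columns of any K containing both k and the true model, the fit of k to the response
becomes a fit to the pure noise with shifted coefficients. -/
theorem response_sub_mulVec (X : Matrix (Fin n) (Fin p) ℝ) (β₀ : ℕ →₀ ℝ) (e : Fin n → ℝ)
    {k K : Finset (Fin p)} (hk : k ⊆ K) (ht : trueModel p β₀ ⊆ K) (β : k → ℝ) :
    response X β₀ e - subDesign X k *ᵥ β =
      e - subDesign X K *ᵥ fun j => extendZero β j - β₀ j := by
  have h := mulVec_eq_subDesign_mulVec X (K := K) (w := fun j => extendZero β j - β₀ j)
    (fun j hj => by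
      have h1 : j ∉ k := fun h => hj (hk h)
      have h2 : β₀ j = 0 := by
        by_contra h0; exact hj (ht (mem_trueModel.2 h0))
      simp [extendZero, h1, h2])
  rw [← h, response, subDesign_mulVec]
  have h3 : (fun j : Fin p => extendZero β j - β₀ j) = extendZero β - fun j : Fin p => β₀ j := rfl
  rw [h3, Matrix.mulVec_sub]
  abel

/-- The residual sum of squares of any model `k` in terms of the projection of the errors on the
columns of `k ∪ t`. -/
theorem DesignEigenBounds.residual_ge {X : Matrix (Fin n) (Fin p) ℝ} {ε : ℝ}
    (h : DesignEigenBounds X ε) (hn : 1 ≤ n) (hε : 0 < ε) (β₀ : ℕ →₀ ℝ) (e : Fin n → ℝ)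
    {k : Finset (Fin p)} (hK : (k ∪ trueModel p β₀).card ≤ n) :
    ∃ g : Fin p → ℝ, n * ε * ∑ j ∈ k ∪ trueModel p β₀, g j ^ 2 ≤
        projSq (subDesign X (k ∪ trueModel p β₀)) e ∧
      ∀ β : k → ℝ, e ⬝ᵥ e - projSq (subDesign X (k ∪ trueModel p β₀)) e +
          n * ε * ∑ j ∈ k ∪ trueModel p β₀, (extendZero β j - β₀ j - g j) ^ 2 ≤
        (response X β₀ e - subDesign X k *ᵥ β) ⬝ᵥ (response X β₀ e - subDesign X k *ᵥ β) := by
  set K := k ∪ trueModel p β₀ with hKdef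
  have hn0 : (0 : ℝ) < n := by exact_mod_cast hn
  have hM : ∀ v, n * ε * (v ⬝ᵥ v) ≤ (subDesign X K *ᵥ v) ⬝ᵥ (subDesign X K *ᵥ v) := fun v =>
    (h.quadForm_bounds hn hK v).1
  have hg : ∀ j : K, extendZero (lsq (subDesign X K) e) j = lsq (subDesign X K) e j := fun j => by
    simp [extendZero]
  refine ⟨extendZero (lsq (subDesign X K) e), ?_, fun β => ?_⟩
  · refine le_trans (le_of_eq ?_) (hM (lsq (subDesign X K) e))
    rw [← Finset.sum_coe_sort K]
    simp only [hg, dotProduct, ← sq]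
  · rw [response_sub_mulVec X β₀ e (K := K) Finset.subset_union_left Finset.subset_union_right,
      sub_mulVec_dotProduct_self (mul_pos hn0 hε) hM]
    refine add_le_add_right ((le_of_eq ?_).trans (hM _)) _
    rw [← Finset.sum_coe_sort K]
    simp only [hg, dotProduct, ← sq, Pi.sub_apply]

theorem sum_sq_trueModel_le (p : ℕ) (β₀ : ℕ →₀ ℝ) (k : Finset (Fin p)) :
    ∑ j ∈ k, β₀ j ^ 2 ≤ ∑ j ∈ β₀.support, β₀ j ^ 2 := by
  rw [← Finset.sum_filter_add_sum_filter_not k (fun j : Fin p => β₀ j ≠ 0),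
    Finset.sum_eq_zero (s := k.filter fun j : Fin p => ¬ β₀ j ≠ 0) (fun j hj => by
      have := (Finset.mem_filter.1 hj).2
      simp only [ne_eq, not_not] at this
      simp [this]), add_zero]
  have hmap : ∑ j ∈ k.filter (fun j : Fin p => β₀ j ≠ 0), β₀ j ^ 2 =
      ∑ j ∈ (k.filter fun j : Fin p => β₀ j ≠ 0).map Fin.valEmbedding, β₀ j ^ 2 := by
    rw [Finset.sum_map]; rfl
  rw [hmap]
  refine Finset.sum_le_sum_of_subset_of_nonneg (fun j hj => ?_) fun j _ _ => sq_nonneg _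
  simp only [Finset.mem_map, Finset.mem_filter, Fin.valEmbedding_apply] at hj
  obtain ⟨i, hi, rfl⟩ := hj
  exact Finsupp.mem_support_iff.2 hi.2

/-- Both parts of the centre use 1 + x ≤ eˣ at different prices. The noise part g pays a constant K
to have its exponent divided by K; the true part pays a factor n so that its exponent no longer
grows with a. -/
theorem one_add_mul_sq_div_le {a c g b₀ s n K : ℝ} (hs : 0 < s) (ha : 0 < a) (han : a ≤ n)
    (hn : 1 ≤ n) (hK : 1 ≤ K) (hc : c = b₀ + g) :
    1 + a * c ^ 2 / s ≤ (K * if b₀ ≠ 0 then n else 1) *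
      Real.exp ((2 * a * g ^ 2 / K + 2 * b₀ ^ 2) / s) := by
  have hn0 : 0 < n := by linarith
  have hK0 : 0 < K := by linarith
  have e1 : 1 + 2 * a * g ^ 2 / s ≤ K * Real.exp (2 * a * g ^ 2 / K / s) := by
    have h1 := Real.add_one_le_exp (2 * a * g ^ 2 / K / s)
    have h2 := mul_le_mul_of_nonneg_left h1 hK0.le
    have h3 : K * (2 * a * g ^ 2 / K / s + 1) = 2 * a * g ^ 2 / s + K := by field_simp
    linarith
  have e2 : 1 + 2 * a * b₀ ^ 2 / s ≤
      (if b₀ ≠ 0 then n else 1) * Real.exp (2 * b₀ ^ 2 / s) := by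
    split_ifs with h
    · have h1 := Real.add_one_le_exp (2 * b₀ ^ 2 / s)
      have h2 := mul_le_mul_of_nonneg_left h1 hn0.le
      have h3 : a * (2 * b₀ ^ 2 / s) ≤ n * (2 * b₀ ^ 2 / s) :=
        mul_le_mul_of_nonneg_right han (by positivity)
      have h4 : 2 * a * b₀ ^ 2 / s = a * (2 * b₀ ^ 2 / s) := by ring
      rw [h4]; linarith
    · simp only [ne_eq, not_not] at h
      simp [h]
  have e3 : 1 + a * c ^ 2 / s ≤ (1 + 2 * a * g ^ 2 / s) * (1 + 2 * a * b₀ ^ 2 / s) := by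
    have h1 : c ^ 2 ≤ 2 * g ^ 2 + 2 * b₀ ^ 2 := by
      rw [hc]; nlinarith [sq_nonneg (b₀ - g)]
    have h2 : a * c ^ 2 / s ≤ a * (2 * g ^ 2 + 2 * b₀ ^ 2) / s := by gcongr
    have h3 : a * (2 * g ^ 2 + 2 * b₀ ^ 2) / s = 2 * a * g ^ 2 / s + 2 * a * b₀ ^ 2 / s := by ring
    have h4 : 0 ≤ (2 * a * g ^ 2 / s) * (2 * a * b₀ ^ 2 / s) := by positivity
    nlinarith
  calc _ ≤ _ := e3
    _ ≤ (K * Real.exp (2 * a * g ^ 2 / K / s)) *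
        ((if b₀ ≠ 0 then n else 1) * Real.exp (2 * b₀ ^ 2 / s)) :=
      mul_le_mul e1 e2 (by positivity) (by positivity)
    _ = _ := by rw [add_div, Real.exp_add]; ring

/-- The part of the marginal densities that depends on the residual sum of squares `W`. -/
def rssFactor (n : ℕ) (W : ℝ) : ℝ :=
  (2 * Real.pi) ^ (-((n : ℝ) / 2)) * (n / (Real.exp 1 * W)) ^ ((n : ℝ) / 2)

theorem rssFactor_nonneg (n : ℕ) {W : ℝ} (hW : 0 ≤ W) : 0 ≤ rssFactor n W := by
  unfold rssFactor; positivity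

/-- The coefficients are centred at β₀ plus the least squares fit of the noise. If a true column is
missing, its coefficient is stuck at 0, which adds a multiple of nε to the residual; the tuning
parameter δ keeps the inflation of the projection term small. -/
theorem exists_emarginal_response_le {r : ℕ} (hr : 1 ≤ r) {α₁ α₂ a₂ : ℝ} (hα₁ : 0 < α₁)
    (hα₂ : 0 < α₂) (h2 : 0 < a₂) (β₀ : ℕ →₀ ℝ) {b δ : ℝ} (hb : 0 < b)
    (hβ₀ : ∀ j ∈ β₀.support, b ≤ |β₀ j|) (hδ : 0 < δ) (hδ1 : δ ≤ 1) :
    ∃ C : ℝ, 1 ≤ C ∧ ∀ (n p : ℕ) (X : Matrix (Fin n) (Fin p) ℝ) (A : Matrix (Fin p) (Fin p) ℝ)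
      (a₁ ε : ℝ) (k : Finset (Fin p)) (e : Fin n → ℝ) (B : ℝ),
      1 ≤ n → EigenvaluesBetween A a₁ a₂ → 0 < a₁ → DesignEigenBounds X ε → 0 < ε → ε < 1 →
      (k ∪ trueModel p β₀).card ≤ n → 0 < B →
      (trueModel p β₀ ⊆ k →
        2 * B ≤ e ⬝ᵥ e - (1 + δ) * projSq (subDesign X (k ∪ trueModel p β₀)) e - C) →
      (¬ trueModel p β₀ ⊆ k → 2 * B ≤ e ⬝ᵥ e + n * ε * (b ^ 2 / 2) -
        (2 + δ) * projSq (subDesign X (k ∪ trueModel p β₀)) e - C) →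
      emarginal X A r α₁ α₂ k (response X β₀ e) ≤
        ENNReal.ofReal (C ^ (k.card + 1) * (n : ℝ) ^ (r * (k ∩ trueModel p β₀).card) *
        ((n * ε) ^ (-(((r : ℝ) + 1 / 2) * k.card)) *
          ((k.card : ℝ) / n) ^ (((r : ℝ) + 1 / 2) * k.card)) * rssFactor n (2 * B)) := by
  obtain ⟨C₀, hC₀, hmain⟩ := exists_emarginal_le r hα₁ hα₂ h2
  have hr1 : (1 : ℝ) ≤ r := by exact_mod_cast hr
  -- Chosen so that 2r · (2/K) = δ: the moments then inflate the projection term by exactly δD.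
  set K : ℝ := 4 * r / δ with hKdef
  have hK : 1 ≤ K := by rw [hKdef, le_div_iff₀ hδ]; linarith
  have hK0 : 0 < K := by linarith
  set S : ℝ := ∑ j ∈ β₀.support, β₀ j ^ 2 with hS
  have hS0 : 0 ≤ S := Finset.sum_nonneg fun _ _ => sq_nonneg _
  have hKr : 1 ≤ K ^ r := one_le_pow₀ hK
  have hC1 : 1 ≤ C₀ * K ^ r := one_le_mul_of_one_le_of_one_le hC₀ hKr
  refine ⟨C₀ * K ^ r + 4 * r * S, le_add_of_le_of_nonneg hC1 (by positivity), ?_⟩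
  intro n p X A a₁ ε k e B hn hA h1 hX hε hε1 hKn hB hB1 hB2
  have hn1 : (1 : ℝ) ≤ n := by exact_mod_cast hn
  have hn0 : (0 : ℝ) < n := by linarith
  set t := trueModel p β₀ with htdef
  set D := projSq (subDesign X (k ∪ t)) e with hD
  obtain ⟨g, hg, hres⟩ := hX.residual_ge hn hε β₀ e hKn
  rw [← htdef, ← hD] at hg hres
  have ha : (0 : ℝ) < n * ε := mul_pos hn0 hε
  have hgk : n * ε * ∑ j ∈ k, g j ^ 2 ≤ D := le_trans (mul_le_mul_of_nonneg_left
    (Finset.sum_le_sum_of_subset_of_nonneg Finset.subset_union_left fun _ _ _ => sq_nonneg _)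
    ha.le) hg
  set Q : ℝ := 2 * B + 2 * r * ∑ i : k, (2 * (n * ε) * g i ^ 2 / K + 2 * β₀ i ^ 2) with hQ
  have hv : 2 * r * ∑ i : k, (2 * (n * ε) * g i ^ 2 / K + 2 * β₀ i ^ 2) ≤ δ * D + 4 * r * S := by
    have e1 : ∑ i : k, (2 * (n * ε) * g i ^ 2 / K + 2 * β₀ i ^ 2) =
        2 / K * (n * ε * ∑ j ∈ k, g j ^ 2) + 2 * ∑ j ∈ k, β₀ j ^ 2 := by
      rw [Finset.sum_coe_sort k fun i : Fin p => (2 * (n * ε) * g i ^ 2 / K + 2 * β₀ i ^ 2),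
        Finset.sum_add_distrib, Finset.mul_sum, Finset.mul_sum, Finset.mul_sum]
      congr 1
      exact Finset.sum_congr rfl fun j _ => by ring
    have e2 := sum_sq_trueModel_le p β₀ k
    have e3 : 2 * r * (2 / K) = δ := by rw [hKdef]; field_simp; ring
    rw [e1]
    calc _ = 2 * r * (2 / K) * (n * ε * ∑ j ∈ k, g j ^ 2) + 4 * r * ∑ j ∈ k, β₀ j ^ 2 := by ring
      _ ≤ _ := by rw [e3]; gcongr
  have hsplit : ∀ β : k → ℝ, ∑ j ∈ k ∪ t, (extendZero β j - β₀ j - g j) ^ 2 =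
      ∑ i : k, (β i - (β₀ i + g i)) ^ 2 + ∑ j ∈ t \ k, (β₀ j + g j) ^ 2 := by
    intro β
    rw [← Finset.union_sdiff_self_eq_union, Finset.sum_union Finset.disjoint_sdiff,
      ← Finset.sum_coe_sort k]
    congr 1
    · exact Finset.sum_congr rfl fun i _ => by simp [extendZero]; ring
    · refine Finset.sum_congr rfl fun i hi => ?_
      simp only [extendZero, (Finset.mem_sdiff.1 hi).2, dite_false]
      ring
  have hKprod : ∏ i : k, (K * if β₀ i ≠ 0 then (n : ℝ) else 1) = K ^ k.card *
      (n : ℝ) ^ (k ∩ t).card := by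
    rw [Finset.prod_coe_sort k fun i : Fin p => (K * if β₀ i ≠ 0 then (n : ℝ) else 1),
      Finset.prod_mul_distrib, Finset.prod_const, Finset.prod_ite, Finset.prod_const_one, mul_one,
      Finset.prod_const]
    congr 3
    ext j
    simp [htdef, mem_trueModel]
  have hfin := hmain n p X A a₁ k (response X β₀ e) (fun i => β₀ i + g i)
    (fun i => K * if β₀ i ≠ 0 then (n : ℝ) else 1)
    (fun i => 2 * (n * ε) * g i ^ 2 / K + 2 * β₀ i ^ 2) (n * ε) Q B hn hA h1 ha ?_
    (fun i s hs => one_add_mul_sq_div_le hs ha (mul_le_of_le_one_right hn0.le hε1.le) hn1 hK rfl)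
    hB (by rw [hQ]; linarith)
  · refine hfin.trans (ENNReal.ofReal_le_ofReal ?_)
    have hL : 0 ≤ (2 * Real.pi) ^ (-((n : ℝ) / 2)) *
      (n / (Real.exp 1 * (2 * B))) ^ ((n : ℝ) / 2) := by positivity
    rw [hKprod, rssFactor]
    have e1 : C₀ ^ (k.card + 1) * (K ^ k.card) ^ r ≤ (C₀ * K ^ r + 4 * r * S) ^ (k.card + 1) := by
      calc _ = C₀ ^ (k.card + 1) * (K ^ r) ^ k.card := by rw [← pow_mul, ← pow_mul, mul_comm r]
        _ ≤ C₀ ^ (k.card + 1) * (K ^ r) ^ (k.card + 1) := by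
            gcongr
            exact Nat.le_succ _
        _ = (C₀ * K ^ r) ^ (k.card + 1) := by rw [mul_pow]
        _ ≤ _ := by
            gcongr
            exact le_add_of_nonneg_right (by positivity)
    calc _ = (C₀ ^ (k.card + 1) * (K ^ k.card) ^ r) * ((n : ℝ) ^ (r * (k ∩ t).card) *
          ((n * ε) ^ (-(((r : ℝ) + 1 / 2) * k.card)) *
          ((k.card : ℝ) / n) ^ (((r : ℝ) + 1 / 2) * k.card)) *
          ((2 * Real.pi) ^ (-((n : ℝ) / 2)) *
            (n / (Real.exp 1 * (2 * B))) ^ ((n : ℝ) / 2))) := by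
          rw [mul_pow (K ^ k.card), ← pow_mul (n : ℝ), mul_comm r]; ring
      _ ≤ _ := by
          refine (mul_le_mul_of_nonneg_right e1 (by positivity)).trans (le_of_eq ?_)
          ring
  · intro β
    refine le_trans ?_ (hres β)
    rw [hsplit]
    by_cases htk : t ⊆ k
    · have := hB1 htk
      have h0 : 0 ≤ ∑ j ∈ t \ k, (β₀ j + g j) ^ 2 := Finset.sum_nonneg fun _ _ => sq_nonneg _
      have h3 := mul_nonneg ha.le h0
      have hCK : 0 ≤ C₀ * K ^ r := by positivity
      rw [mul_add]
      linarith
    · have := hB2 htk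
      obtain ⟨j, hjt, hjk⟩ := Finset.not_subset.1 htk
      have hj : j ∈ t \ k := Finset.mem_sdiff.2 ⟨hjt, hjk⟩
      have h0 : (β₀ j + g j) ^ 2 ≤ ∑ j ∈ t \ k, (β₀ j + g j) ^ 2 :=
        Finset.single_le_sum (f := fun j : Fin p => (β₀ j + g j) ^ 2) (fun _ _ => sq_nonneg _) hj
      have hbj : b ^ 2 ≤ β₀ j ^ 2 := by
        rw [← sq_abs (β₀ j)]
        exact pow_le_pow_left₀ hb.le
          (hβ₀ j (Finsupp.mem_support_iff.2 (mem_trueModel.1 hjt))) 2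
      have hgj : n * ε * g j ^ 2 ≤ D := by
        refine le_trans (mul_le_mul_of_nonneg_left ?_ ha.le) hg
        exact Finset.single_le_sum (f := fun j : Fin p => g j ^ 2) (fun _ _ => sq_nonneg _)
          (Finset.mem_union_right k hjt)
      -- The subtracted noise term satisfies nε g² ≤ D, so D is charged a second time; hence the
      -- coefficient 2 + δ in the case of a missing column.
      have h4 : b ^ 2 / 2 - g j ^ 2 ≤ (β₀ j + g j) ^ 2 := by
        nlinarith [sq_nonneg (β₀ j + 2 * g j)]
      have h5 := mul_le_mul_of_nonneg_left (h4.trans h0) ha.le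
      have hCK : 0 ≤ C₀ * K ^ r := by positivity
      rw [mul_sub] at h5
      rw [mul_add]
      linarith

theorem card_trueModel {β₀ : ℕ →₀ ℝ} (h : ∀ j ∈ β₀.support, j < p) :
    (trueModel p β₀).card = β₀.support.card := by
  rw [← Finset.card_map Fin.valEmbedding]
  congr 1
  ext j
  simp only [Finset.mem_map, mem_trueModel, Fin.valEmbedding_apply, Finsupp.mem_support_iff]
  exact ⟨fun ⟨i, hi, hij⟩ => hij ▸ hi,
    fun hj => ⟨⟨j, h j (Finsupp.mem_support_iff.2 hj)⟩, hj, rfl⟩⟩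

/-- The half-side √(ε/n) is the largest scale for which moving β over the cube changes the fitted
values by at most T in squared length, since the Gram matrix is at most n/ε. It also has to stay
below b/2, so that the coefficients remain away from 0. -/
theorem exists_le_emarginal_response (r : ℕ) {α₁ α₂ a₁ a₂ s₀ s₁ : ℝ} (hα₁ : 0 < α₁) (hα₂ : 0 < α₂)
    (h1 : 0 < a₁) (h2 : 0 < a₂) (hs₀ : 0 < s₀) (hs₁ : 0 < s₁) (β₀ : ℕ →₀ ℝ) {b : ℝ} (hb : 0 < b)
    (hβ₀ : ∀ j ∈ β₀.support, b ≤ |β₀ j|) :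
    ∃ C : ℝ, 0 < C ∧ ∀ (n p : ℕ) (X : Matrix (Fin n) (Fin p) ℝ) (A : Matrix (Fin p) (Fin p) ℝ)
      (ε : ℝ) (e : Fin n → ℝ) (W : ℝ),
      1 ≤ n → EigenvaluesBetween A a₁ a₂ → DesignEigenBounds X ε → 0 < ε →
      (∀ j ∈ β₀.support, j < p) → β₀.support.card ≤ n → √(ε / n) ≤ b / 2 →
      W = e ⬝ᵥ e + projSq (subDesign X (trueModel p β₀)) e + 2 * β₀.support.card →
      s₀ * n ≤ W → W ≤ s₁ * n →
      ENNReal.ofReal (C * (n : ℝ) ^ (-(((r : ℝ) + 1 / 2) * β₀.support.card)) * (n : ℝ)⁻¹ *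
        √(ε / n) ^ β₀.support.card * rssFactor n W) ≤
      emarginal X A r α₁ α₂ (trueModel p β₀) (response X β₀ e) := by
  set T := β₀.support.card with hT
  set M : ℝ := ∑ j ∈ β₀.support, |β₀ j| with hM
  obtain ⟨C, hC, hmain⟩ := exists_le_emarginal r (M + b) T hα₁ hα₂ h1 h2 hs₀ hs₁ (half_pos hb)
  refine ⟨C, hC, ?_⟩
  intro n p X A ε e W hn hA hX hε hp hTn hh hW hW0 hW1
  have hn0 : (0 : ℝ) < n := by exact_mod_cast hn
  have hcard : (trueModel p β₀).card = T := card_trueModel hp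
  have hh0 : 0 < √(ε / n) := Real.sqrt_pos.2 (by positivity)
  refine hmain n p X A (trueModel p β₀) (response X β₀ e) (fun i => β₀ i) (√(ε / n)) W hn hA
    hcard hh0 (fun β hβ => ⟨fun i => ?_, ?_⟩) hW0 hW1
  · have hi : (i : ℕ) ∈ β₀.support := Finsupp.mem_support_iff.2 (mem_trueModel.1 i.2)
    have g1 := hβ₀ i hi
    have g2 : |β₀ i| ≤ M := Finset.single_le_sum (f := fun j => |β₀ j|)
      (fun _ _ => abs_nonneg _) hi
    have g3 := abs_sub_abs_le_abs_sub (β₀ i) (β i)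
    have g4 := abs_sub_abs_le_abs_sub (β i) (β₀ i)
    rw [abs_sub_comm] at g3
    have g5 := (hβ i).trans hh
    constructor <;> linarith
  · have hk : (trueModel p β₀).card ≤ n := hcard ▸ hTn
    rw [response_sub_mulVec X β₀ e (K := trueModel p β₀) subset_rfl subset_rfl]
    set v : trueModel p β₀ → ℝ := fun j => extendZero β j - β₀ j with hv
    set Mt := subDesign X (trueModel p β₀) with hMt
    have q1 := hX.quadForm_bounds hn hk
    have q2 := sub_mulVec_dotProduct_self (mul_pos hn0 hε) (fun v => (q1 v).1) e (-v)
    have q3 : 0 ≤ (Mt *ᵥ (-v - lsq Mt e)) ⬝ᵥ (Mt *ᵥ (-v - lsq Mt e)) := sum_mul_self_nonneg _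
    have q4 : (Mt *ᵥ v) ⬝ᵥ (Mt *ᵥ v) ≤ T := by
      refine (q1 v).2.trans ?_
      have q5 : v ⬝ᵥ v ≤ T * (ε / n) := by
        have : ∀ i ∈ (Finset.univ : Finset (trueModel p β₀)), v i * v i ≤ ε / n := fun i _ => by
          have hvi : |v i| ≤ √(ε / n) := by simpa [hv, extendZero] using hβ i
          rw [← abs_mul_abs_self, ← Real.mul_self_sqrt (show 0 ≤ ε / n by positivity)]
          exact mul_le_mul hvi hvi (abs_nonneg _) hh0.le
        simpa [dotProduct, hcard] using Finset.sum_le_card_nsmul _ _ _ this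
      refine (mul_le_mul_of_nonneg_left q5 (by positivity)).trans (le_of_eq ?_)
      field_simp
    -- Parallelogram identity: the lower bound on the residual at -v turns into an upper bound at v.
    have q6 : (e - Mt *ᵥ v) ⬝ᵥ (e - Mt *ᵥ v) + (e - Mt *ᵥ (-v)) ⬝ᵥ (e - Mt *ᵥ (-v)) =
        2 * (e ⬝ᵥ e) + 2 * ((Mt *ᵥ v) ⬝ᵥ (Mt *ᵥ v)) := by
      simp only [Matrix.mulVec_neg, sub_neg_eq_add, sub_dotProduct, dotProduct_sub, add_dotProduct,
        dotProduct_add]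
      ring
    rw [hW]
    linarith

end TrueModel

/-! ### Comparison of the upper and lower bounds. -/

section Ratios

/-- The ratio is (W/V)^(n/2), and W/V = 1 + (W - V)/V is at most the exponential of (W - V)/V. The
sign of W - V is free: overfitting uses it with W ≥ V, underfitting with W < V. -/
theorem rssFactor_le (n : ℕ) {V W : ℝ} (hV : 0 < V) (hW : 0 < W) :
    rssFactor n V ≤ Real.exp (n / 2 * ((W - V) / V)) * rssFactor n W := by
  have h1 : (W / V) ^ ((n : ℝ) / 2) ≤ Real.exp (n / 2 * ((W - V) / V)) := by
    have : W / V ≤ Real.exp ((W - V) / V) := by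
      have := Real.add_one_le_exp ((W - V) / V)
      rwa [sub_div, div_self hV.ne', sub_add_cancel, ← div_self hV.ne', ← sub_div] at this
    refine (Real.rpow_le_rpow (by positivity) this (by positivity)).trans (le_of_eq ?_)
    rw [← Real.exp_mul, mul_comm]
  have h2 : (n / (Real.exp 1 * V)) ^ ((n : ℝ) / 2) =
      (W / V) ^ ((n : ℝ) / 2) * (n / (Real.exp 1 * W)) ^ ((n : ℝ) / 2) := by
    rw [← Real.mul_rpow (by positivity) (by positivity)]
    congr 1; field_simp
  rw [rssFactor, rssFactor, h2]
  calc _ = (W / V) ^ ((n : ℝ) / 2) * ((2 * Real.pi) ^ (-((n : ℝ) / 2)) *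
        (n / (Real.exp 1 * W)) ^ ((n : ℝ) / 2)) := by ring
    _ ≤ _ := mul_le_mul_of_nonneg_right h1 (by positivity)

theorem pow_eq_exp {x : ℝ} (hx : 0 < x) (m : ℕ) : x ^ m = Real.exp (m * Real.log x) := by
  rw [Real.exp_nat_mul, Real.exp_log hx]

theorem sqrt_div_pow_eq_exp {x y : ℝ} (hx : 0 < x) (hy : 0 < y) (m : ℕ) :
    √(x / y) ^ m = Real.exp (m / 2 * (Real.log x - Real.log y)) := by
  rw [pow_eq_exp (Real.sqrt_pos.2 (by positivity)), Real.log_sqrt (by positivity),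
    Real.log_div hx.ne' hy.ne']
  congr 1; ring

/-- The lower bound on the weighted marginal density of the true model, in exponential form. -/
theorem lowerWeight_eq {c₁ c₂ c ε : ℝ} (hc₁ : 0 < c₁) (hc : 0 < c) (hε : 0 < ε) (ρ : ℝ) (T : ℕ)
    {n p : ℕ} (hn : 1 ≤ n) (hp : 1 ≤ p) (F : ℝ) :
    c₁ ^ (-(T : ℝ)) * (p : ℝ) ^ (-(c₂ * T)) * (c * (n : ℝ) ^ (-(ρ * T)) * (n : ℝ)⁻¹ *
        √(ε / n) ^ T * F) =
      Real.exp (-(T * Real.log c₁) - c₂ * T * Real.log p + Real.log c - ρ * T * Real.log n -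
        Real.log n + T / 2 * (Real.log ε - Real.log n)) * F := by
  have hn0 : (0 : ℝ) < n := by exact_mod_cast hn
  have hp0 : (0 : ℝ) < p := by exact_mod_cast hp
  rw [Real.rpow_def_of_pos hc₁, Real.rpow_def_of_pos hp0, Real.rpow_def_of_pos hn0,
    sqrt_div_pow_eq_exp hε hn0]
  nth_rewrite 1 [← Real.exp_log hc]
  nth_rewrite 2 [← Real.exp_log hn0]
  rw [← Real.exp_neg]
  simp only [← mul_assoc, ← Real.exp_add]
  congr 2; ring

theorem log_le_mul_log_two {x : ℕ} (hx : 1 ≤ x) : Real.log x ≤ x * Real.log 2 := by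
  have h : (x : ℝ) ≤ 2 ^ x := by exact_mod_cast Nat.lt_two_pow_self.le
  have h0 : (0 : ℝ) < x := by exact_mod_cast hx
  rw [← Real.log_pow]
  exact Real.log_le_log h0 h

/-- The comparison of the bounds for a model with `d` superfluous variables. -/
theorem exists_overfit_ratio_le {r T : ℕ} (hr : 1 ≤ r) {c₁ c₂ C c : ℝ} (hc₁ : 0 < c₁) (hc₂ : 0 < c₂)
    (hC : 1 ≤ C) (hc : 0 < c) (C' : ℝ) :
    ∃ C₃ E : ℝ, 0 < C₃ ∧ 0 ≤ E ∧ ∀ (n p d : ℕ) (ε V W : ℝ), 1 ≤ n → 1 ≤ p → 1 ≤ d → T + d ≤ n →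
      0 < ε → ε < 1 → 0 < V → 0 < W →
      n / 2 * ((W - V) / V) ≤ (5 / 4 * d + 1 / 4) * Real.log n + C' →
      c₁ ^ (-((T + d : ℕ) : ℝ)) * (p : ℝ) ^ (-(c₂ * (T + d : ℕ))) *
          (C ^ (T + d + 1) * (n : ℝ) ^ (r * T) *
            ((n * ε) ^ (-(((r : ℝ) + 1 / 2) * (T + d : ℕ))) *
              (((T + d : ℕ) : ℝ) / n) ^ (((r : ℝ) + 1 / 2) * (T + d : ℕ))) * rssFactor n V) ≤
        (C₃ * ε⁻¹ ^ E * (n : ℝ) ^ (-(1 / 4) : ℝ)) ^ (d + 1) *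
          (c₁ ^ (-(T : ℝ)) * (p : ℝ) ^ (-(c₂ * T)) *
            (c * (n : ℝ) ^ (-(((r : ℝ) + 1 / 2) * T)) * (n : ℝ)⁻¹ * √(ε / n) ^ T *
              rssFactor n W)) := by
  obtain ⟨ρ, hρ⟩ : ∃ ρ : ℝ, (r : ℝ) + 1 / 2 = ρ := ⟨_, rfl⟩
  rw [hρ]
  have hr1 : (1 : ℝ) ≤ r := by exact_mod_cast hr
  have hρ32 : 3 / 2 ≤ ρ := by linarith
  set LC : ℝ := |Real.log c₁| + (T + 1) * Real.log C + |C'| + |Real.log c| +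
    ρ * (T + 1) * (T + 1) * Real.log 2 with hLC
  refine ⟨Real.exp LC, ρ * (T + 1) + T / 2, Real.exp_pos _, by positivity, ?_⟩
  intro n p d ε V W hn hp hd hTd hε hε1 hV hW hF
  have hn0 : (0 : ℝ) < n := by exact_mod_cast hn
  have hp0 : (0 : ℝ) < p := by exact_mod_cast hp
  have hd1 : (1 : ℝ) ≤ d := by exact_mod_cast hd
  have hm0 : (0 : ℝ) < (T + d : ℕ) := by exact_mod_cast (by omega : 0 < T + d)
  have hC0 : 0 < C := by linarith
  rw [lowerWeight_eq hc₁ hc hε ρ T hn hp]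
  have hlhs : c₁ ^ (-((T + d : ℕ) : ℝ)) * (p : ℝ) ^ (-(c₂ * (T + d : ℕ))) *
          (C ^ (T + d + 1) * (n : ℝ) ^ (r * T) * ((n * ε) ^ (-(ρ * (T + d : ℕ))) *
              (((T + d : ℕ) : ℝ) / n) ^ (ρ * (T + d : ℕ))) * rssFactor n V) =
      Real.exp (-((T + d) * Real.log c₁) - c₂ * (T + d) * Real.log p + (T + d + 1) * Real.log C +
        r * T * Real.log n - ρ * (T + d) * (Real.log n + Real.log ε) +
        ρ * (T + d) * (Real.log (T + d : ℕ) - Real.log n)) * rssFactor n V := by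
    rw [Real.rpow_def_of_pos hc₁, Real.rpow_def_of_pos hp0, pow_eq_exp hC0, pow_eq_exp hn0,
      Real.rpow_def_of_pos (mul_pos hn0 hε), Real.rpow_def_of_pos (div_pos hm0 hn0),
      Real.log_div hm0.ne' hn0.ne', Real.log_mul hn0.ne' hε.ne']
    simp only [← mul_assoc, ← Real.exp_add]
    congr 2; push_cast; ring
  have hbase : (Real.exp LC * ε⁻¹ ^ (ρ * (T + 1) + T / 2) * (n : ℝ) ^ (-(1 / 4) : ℝ)) ^ (d + 1) =
      Real.exp ((d + 1) * (LC - (ρ * (T + 1) + T / 2) * Real.log ε - 1 / 4 * Real.log n)) := by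
    rw [Real.rpow_def_of_pos (inv_pos.2 hε), Real.rpow_def_of_pos hn0, Real.log_inv,
      ← Real.exp_add, ← Real.exp_add, ← Real.exp_nat_mul]
    congr 1; push_cast; ring
  rw [hlhs, hbase]
  have hF0 := rssFactor_nonneg n hW.le
  refine (mul_le_mul_of_nonneg_left (rssFactor_le n hV hW) (Real.exp_pos _).le).trans ?_
  rw [← mul_assoc, ← mul_assoc, ← Real.exp_add, ← Real.exp_add]
  refine mul_le_mul_of_nonneg_right (Real.exp_le_exp.2 ?_) hF0
  have hl0 : 0 ≤ Real.log n := Real.log_nonneg (by exact_mod_cast hn)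
  have hlp0 : 0 ≤ Real.log p := Real.log_nonneg (by exact_mod_cast hp)
  have hle0 : Real.log ε ≤ 0 := Real.log_nonpos hε.le hε1.le
  have hlC : 0 ≤ Real.log C := Real.log_nonneg hC
  have hl2 : 0 ≤ Real.log 2 := Real.log_nonneg (by norm_num)
  have hμ1 : Real.log (T + d : ℕ) ≤ (T + d) * Real.log 2 := by
    have := log_le_mul_log_two (x := T + d) (by omega)
    rwa [Nat.cast_add] at this ⊢
  have hμ2 : Real.log (T + d : ℕ) ≤ Real.log n := Real.log_le_log hm0 (by exact_mod_cast hTd)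
  generalize Real.log (T + d : ℕ) = μ at *
  generalize Real.log n = ℓ at *
  have hT0 : (0 : ℝ) ≤ T := Nat.cast_nonneg T
  -- Of the T + d copies of μ = log(T + d), T + 1 are bounded linearly in the number of columns and
  -- d - 1 by log n. Keeping the latter to d - 1 is what leaves the power n^(-ρ(d+1)).
  have hmμ : ρ * ((T + d) * μ) ≤ ρ * ((T + 1) * ((T + d) * Real.log 2) + (d - 1) * ℓ) := by
    refine mul_le_mul_of_nonneg_left ?_ (by linarith)
    have g1 := mul_le_mul_of_nonneg_left hμ1 (by linarith : (0 : ℝ) ≤ T + 1)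
    have g2 := mul_le_mul_of_nonneg_left hμ2 (by linarith : (0 : ℝ) ≤ d - 1)
    linarith
  -- Here r ≥ 1 is decisive. The fit gain 5d/4 + 1/4 and the factor n lost in the lower bound add up
  -- to (5/4)(d + 1), which ρ ≥ 3/2 exceeds by (d + 1)/4.
  have k1 : (3 / 2 - ρ) * (d + 1) * ℓ ≤ 0 :=
    mul_nonpos_of_nonpos_of_nonneg (mul_nonpos_of_nonpos_of_nonneg (by linarith) (by linarith)) hl0
  have hTd' : (0 : ℝ) ≤ T * d := by positivity
  have k2 : (ρ * (T * d + 1) + d * (T / 2)) * Real.log ε ≤ 0 :=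
    mul_nonpos_of_nonneg_of_nonpos (by positivity) hle0
  have k3 : 0 ≤ c₂ * d * Real.log p := by positivity
  have k4 : -(d * Real.log c₁) ≤ (d + 1) * |Real.log c₁| := by
    have h1 := mul_le_mul_of_nonneg_left (neg_le_abs (Real.log c₁)) (by linarith : (0 : ℝ) ≤ d)
    have h2 := abs_nonneg (Real.log c₁)
    linarith
  have k5 : (T + d + 1) * Real.log C ≤ (d + 1) * ((T + 1) * Real.log C) := by
    have := mul_nonneg hTd' hlC
    linarith
  have k6 : C' ≤ (d + 1) * |C'| :=
    (le_abs_self _).trans (le_mul_of_one_le_left (abs_nonneg _) (by linarith))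
  have k7 : - Real.log c ≤ (d + 1) * |Real.log c| :=
    (neg_le_abs _).trans (le_mul_of_one_le_left (abs_nonneg _) (by linarith))
  have k8 : ρ * ((T + 1) * ((T + d) * Real.log 2)) ≤
      (d + 1) * (ρ * (T + 1) * (T + 1) * Real.log 2) := by
    have : 0 ≤ ρ * (T + 1) * Real.log 2 * (T * d + 1) := by positivity
    linarith
  have hrρ : (r : ℝ) = ρ - 1 / 2 := by linarith
  rw [hrρ, hLC]
  linarith

/-- The comparison of the bounds for a model that misses a variable of the true model. -/
theorem exists_underfit_ratio_le {r T : ℕ} (hr : 1 ≤ r) {c₁ c₂ C c : ℝ} (hc₁ : 0 < c₁)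
    (hc₂ : 0 < c₂) (hC : 1 ≤ C) (hc : 0 < c) :
    ∃ C₃ : ℝ, 0 < C₃ ∧ ∀ (n p m j : ℕ) (ε V W η : ℝ), 1 ≤ n → 1 ≤ p → m ≤ n → j ≤ T →
      0 < ε → ε < 1 → 0 < V → 0 < W → (p : ℝ) ≤ (n : ℝ) ^ 2 →
      -Real.log ε ≤ Real.log n / 2 → C₃ ≤ Real.log n → n / 2 * ((W - V) / V) ≤ -η →
      c₁ ^ (-(m : ℝ)) * (p : ℝ) ^ (-(c₂ * m)) *
          (C ^ (m + 1) * (n : ℝ) ^ (r * j) * ((n * ε) ^ (-(((r : ℝ) + 1 / 2) * m)) *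
              ((m : ℝ) / n) ^ (((r : ℝ) + 1 / 2) * m)) * rssFactor n V) ≤
        Real.exp (C₃ * Real.log n - η) *
          (c₁ ^ (-(T : ℝ)) * (p : ℝ) ^ (-(c₂ * T)) *
            (c * (n : ℝ) ^ (-(((r : ℝ) + 1 / 2) * T)) * (n : ℝ)⁻¹ * √(ε / n) ^ T *
              rssFactor n W)) := by
  obtain ⟨ρ, hρ⟩ : ∃ ρ : ℝ, (r : ℝ) + 1 / 2 = ρ := ⟨_, rfl⟩
  rw [hρ]
  have hr1 : (1 : ℝ) ≤ r := by exact_mod_cast hr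
  have hρ32 : 3 / 2 ≤ ρ := by linarith
  have hlC : 0 ≤ Real.log C := Real.log_nonneg hC
  -- C₃ serves both as the exponent of n and as the threshold for log n; the first summand serves
  -- the threshold, the bracket collects the exponents.
  set C₃ : ℝ := 2 * (|Real.log c₁| + Real.log C) + (T * |Real.log c₁| + Real.log C +
    |Real.log c| + 2 * c₂ * T + r * T + ρ * T + 1 + T) with hC₃
  refine ⟨C₃, by positivity, ?_⟩
  intro n p m j ε V W η hn hp hm hj hε hε1 hV hW hpn hεn hCn hF
  have hn0 : (0 : ℝ) < n := by exact_mod_cast hn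
  have hp0 : (0 : ℝ) < p := by exact_mod_cast hp
  have hC0 : 0 < C := by linarith
  rw [lowerWeight_eq hc₁ hc hε ρ T hn hp]
  have hF0 := rssFactor_nonneg n hW.le
  have hV0 := rssFactor_nonneg n hV.le
  have hmn : ((m : ℝ) / n) ^ (ρ * m) ≤ 1 := by
    refine Real.rpow_le_one (by positivity) ?_ (by positivity)
    rw [div_le_one hn0]; exact_mod_cast hm
  have hlhs : c₁ ^ (-(m : ℝ)) * (p : ℝ) ^ (-(c₂ * m)) *
          (C ^ (m + 1) * (n : ℝ) ^ (r * j) * ((n * ε) ^ (-(ρ * m)) * 1) * rssFactor n V) =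
      Real.exp (-(m * Real.log c₁) - c₂ * m * Real.log p + (m + 1) * Real.log C +
        r * j * Real.log n - ρ * m * (Real.log n + Real.log ε)) * rssFactor n V := by
    rw [Real.rpow_def_of_pos hc₁, Real.rpow_def_of_pos hp0, pow_eq_exp hC0, pow_eq_exp hn0,
      Real.rpow_def_of_pos (mul_pos hn0 hε), Real.log_mul hn0.ne' hε.ne', mul_one]
    simp only [← mul_assoc, ← Real.exp_add]
    congr 2; push_cast; ring
  have hle : c₁ ^ (-(m : ℝ)) * (p : ℝ) ^ (-(c₂ * m)) *
          (C ^ (m + 1) * (n : ℝ) ^ (r * j) * ((n * ε) ^ (-(ρ * m)) *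
              ((m : ℝ) / n) ^ (ρ * m)) * rssFactor n V) ≤
      c₁ ^ (-(m : ℝ)) * (p : ℝ) ^ (-(c₂ * m)) *
          (C ^ (m + 1) * (n : ℝ) ^ (r * j) * ((n * ε) ^ (-(ρ * m)) * 1) * rssFactor n V) := by
    gcongr
  refine hle.trans ?_
  rw [hlhs]
  refine (mul_le_mul_of_nonneg_left (rssFactor_le n hV hW) (Real.exp_pos _).le).trans ?_
  rw [← mul_assoc, ← mul_assoc, ← Real.exp_add, ← Real.exp_add]
  refine mul_le_mul_of_nonneg_right (Real.exp_le_exp.2 ?_) hF0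
  have hlp0 : 0 ≤ Real.log p := Real.log_nonneg (by exact_mod_cast hp)
  have hlp : Real.log p ≤ 2 * Real.log n := by
    have := Real.log_le_log hp0 hpn
    rwa [Real.log_pow] at this
  have hle0 : Real.log ε ≤ 0 := Real.log_nonpos hε.le hε1.le
  set ℓ := Real.log n with hℓ
  have hT0 : (0 : ℝ) ≤ T := Nat.cast_nonneg T
  have hm0 : (0 : ℝ) ≤ m := Nat.cast_nonneg m
  have hjT : (j : ℝ) ≤ T := by exact_mod_cast hj
  have hA : 2 * (|Real.log c₁| + Real.log C) ≤ ℓ := by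
    refine le_trans ?_ hCn
    rw [hC₃]
    exact le_add_of_nonneg_right (by positivity)
  have hℓ1 : 1 ≤ ℓ := by
    refine le_trans ?_ hCn
    rw [hC₃]
    have : 0 ≤ 2 * (|Real.log c₁| + Real.log C) + (T * |Real.log c₁| + Real.log C +
      |Real.log c| + 2 * c₂ * T + r * T + ρ * T + T) := by positivity
    linarith
  -- Each column costs (nε)^(-ρ) with nε ≥ √n, which outweighs its constants, so the size m of the
  -- model disappears from the bound.
  have k1 : m * (|Real.log c₁| + Real.log C - ρ * (ℓ + Real.log ε)) ≤ 0 := by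
    refine mul_nonpos_of_nonneg_of_nonpos hm0 ?_
    have h1 : ℓ / 2 ≤ ℓ + Real.log ε := by linarith
    have h2 : 1 * (ℓ / 2) ≤ ρ * (ℓ + Real.log ε) :=
      mul_le_mul (by linarith) h1 (by linarith) (by linarith)
    linarith
  have k2 : -(m * Real.log c₁) ≤ m * |Real.log c₁| := by
    have := mul_le_mul_of_nonneg_left (neg_le_abs (Real.log c₁)) hm0
    linarith
  have k3 : T * Real.log c₁ ≤ T * |Real.log c₁| * ℓ := by
    have h1 := mul_le_mul_of_nonneg_left (le_abs_self (Real.log c₁)) hT0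
    have h2 : T * |Real.log c₁| * 1 ≤ T * |Real.log c₁| * ℓ :=
      mul_le_mul_of_nonneg_left hℓ1 (by positivity)
    linarith
  have k4 : c₂ * T * Real.log p ≤ c₂ * T * (2 * ℓ) :=
    mul_le_mul_of_nonneg_left hlp (by positivity)
  have k5 : 0 ≤ c₂ * m * Real.log p := by positivity
  have k6 : Real.log C ≤ Real.log C * ℓ := le_mul_of_one_le_right hlC hℓ1
  have k7 : -Real.log c ≤ |Real.log c| * ℓ :=
    (neg_le_abs _).trans (le_mul_of_one_le_right (abs_nonneg _) hℓ1)
  have k8 : r * j * ℓ ≤ r * T * ℓ := by gcongr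
  have k9 : T / 2 * (ℓ - Real.log ε) ≤ T * ℓ := by
    have := mul_le_mul_of_nonneg_left (by linarith : ℓ - Real.log ε ≤ 2 * ℓ)
      (by positivity : (0 : ℝ) ≤ T / 2)
    linarith
  have k10 : 0 ≤ 2 * (|Real.log c₁| + Real.log C) * ℓ := by positivity
  rw [hC₃]
  linarith

end Ratios

/-! ### Growth rates. -/

section Growth

theorem eventually_inv_le_rpow {ε : ℕ → ℝ}
    (hεO : (fun n => (ε n)⁻¹) =O[atTop] fun n : ℕ => Real.log n ^ (1 / 8 : ℝ)) {η : ℝ}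
    (hη : 0 < η) : ∀ᶠ n : ℕ in atTop, (ε n)⁻¹ ≤ (n : ℝ) ^ η := by
  have h1 := (isLittleO_log_rpow_rpow_atTop (1 / 8 : ℝ) hη).comp_tendsto
    (tendsto_natCast_atTop_atTop (R := ℝ))
  have h2 := (hεO.trans_isLittleO h1).bound one_pos
  filter_upwards [h2] with n hn
  rw [one_mul] at hn
  refine (le_abs_self _).trans (hn.trans (le_of_eq ?_))
  rw [Function.comp_apply, Real.norm_of_nonneg (Real.rpow_nonneg (Nat.cast_nonneg n) _)]

theorem eventually_log_le_rpow {η : ℝ} (hη : 0 < η) :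
    ∀ᶠ n : ℕ in atTop, Real.log n ≤ (n : ℝ) ^ η := by
  have h1 := ((isLittleO_log_rpow_atTop hη).comp_tendsto
    (tendsto_natCast_atTop_atTop (R := ℝ))).bound one_pos
  filter_upwards [h1] with n hn
  rw [one_mul] at hn
  refine (le_abs_self _).trans (hn.trans (le_of_eq ?_))
  rw [Function.comp_apply, Real.norm_of_nonneg (Real.rpow_nonneg (Nat.cast_nonneg n) _)]

theorem tendsto_natCast_rpow {η : ℝ} (hη : 0 < η) :
    Tendsto (fun n : ℕ => (n : ℝ) ^ η) atTop atTop :=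
  (tendsto_rpow_atTop hη).comp tendsto_natCast_atTop_atTop

theorem eventually_le_mul_eps {ε q : ℕ → ℝ} {ξ : ℝ} (hε : ∀ n, 1 ≤ n → 0 < ε n)
    (hεO : (fun n => (ε n)⁻¹) =O[atTop] fun n : ℕ => Real.log n ^ (1 / 8 : ℝ))
    (hξ : ξ < 1) (hq : q =O[atTop] fun n : ℕ => (n : ℝ) ^ ξ) (C : ℝ) :
    ∀ᶠ n : ℕ in atTop, C * ((|q n| + 1) * Real.log n + 1) ≤ n * ε n := by
  obtain ⟨C₁, hC₁, hq1⟩ := hq.exists_pos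
  set ζ : ℝ := max ξ 0 with hζ
  have hζ0 : 0 ≤ ζ := le_max_right _ _
  have hζ1 : ζ < 1 := max_lt hξ one_pos
  -- The gap 1 - ζ is shared equally by 1/ε, log n and the constant, each eventually at most n^η.
  -- Here ζ is the positive part of ξ, as ξ may be negative.
  set η : ℝ := (1 - ζ) / 3 with hη
  have hη0 : 0 < η := by rw [hη]; linarith
  filter_upwards [eventually_inv_le_rpow hεO hη0, eventually_log_le_rpow hη0, hq1.bound,
    (tendsto_natCast_rpow hη0).eventually_ge_atTop (|C| * (C₁ + 2)), eventually_ge_atTop 1]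
    with n h1 h2 h3 h4 h5
  have hn1 : (1 : ℝ) ≤ n := by exact_mod_cast h5
  have hn0 : (0 : ℝ) < n := by linarith
  have hl0 : 0 ≤ Real.log n := Real.log_nonneg hn1
  have hζn : 1 ≤ (n : ℝ) ^ ζ := Real.one_le_rpow hn1 hζ0
  have hηn : 1 ≤ (n : ℝ) ^ η := Real.one_le_rpow hn1 hη0.le
  have hqn : |q n| ≤ C₁ * (n : ℝ) ^ ζ := by
    refine h3.trans ?_
    rw [Real.norm_of_nonneg (Real.rpow_nonneg hn0.le _)]
    exact mul_le_mul_of_nonneg_left (Real.rpow_le_rpow_of_exponent_le hn1 (le_max_left _ _)) hC₁.le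
  have e1 : (|q n| + 1) * Real.log n + 1 ≤ (C₁ + 2) * ((n : ℝ) ^ ζ * (n : ℝ) ^ η) := by
    have f1 : (|q n| + 1) * Real.log n ≤ ((C₁ + 1) * (n : ℝ) ^ ζ) * (n : ℝ) ^ η :=
      mul_le_mul (by linarith) h2 hl0 (by positivity)
    have f2 : 1 ≤ (n : ℝ) ^ ζ * (n : ℝ) ^ η := one_le_mul_of_one_le_of_one_le hζn hηn
    linarith
  have e2 : (n : ℝ) ^ η * ((n : ℝ) ^ ζ * (n : ℝ) ^ η) * (n : ℝ) ^ η = n := by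
    rw [← Real.rpow_add hn0, ← Real.rpow_add hn0, ← Real.rpow_add hn0]
    rw [show η + (ζ + η) + η = 1 by rw [hη]; ring, Real.rpow_one]
  have e3 : (n : ℝ) ^ η * ((n : ℝ) ^ ζ * (n : ℝ) ^ η) ≤ n * ε n := by
    have hεn := hε n h5
    rw [← div_le_iff₀ hεn, div_eq_mul_inv]
    refine le_trans ?_ e2.le
    exact mul_le_mul_of_nonneg_left h1 (by positivity)
  calc C * ((|q n| + 1) * Real.log n + 1) ≤ |C| * ((C₁ + 2) * ((n : ℝ) ^ ζ * (n : ℝ) ^ η)) :=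
        mul_le_mul (le_abs_self C) e1 (by positivity) (abs_nonneg C)
    _ = (|C| * (C₁ + 2)) * ((n : ℝ) ^ ζ * (n : ℝ) ^ η) := by ring
    _ ≤ (n : ℝ) ^ η * ((n : ℝ) ^ ζ * (n : ℝ) ^ η) := by gcongr
    _ ≤ _ := e3

theorem tendsto_overfit_bound {ε : ℕ → ℝ} (hε : ∀ n, 1 ≤ n → 0 < ε n)
    (hεO : (fun n => (ε n)⁻¹) =O[atTop] fun n : ℕ => Real.log n ^ (1 / 8 : ℝ)) {C E : ℝ}
    (hC : 0 < C) (hE : 0 ≤ E) :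
    Tendsto (fun n : ℕ => C * (ε n)⁻¹ ^ E * (n : ℝ) ^ (-(1 / 4) : ℝ)) atTop (𝓝 0) := by
  have hE1 : 0 < E + 1 := by linarith
  have hlim : Tendsto (fun n : ℕ => C * (n : ℝ) ^ (-(1 / 8) : ℝ)) atTop (𝓝 0) := by
    have := ((tendsto_rpow_neg_atTop (show (0 : ℝ) < 1 / 8 by norm_num)).comp
      (tendsto_natCast_atTop_atTop (R := ℝ))).const_mul C
    simpa using this
  refine squeeze_zero' ?_ ?_ hlim
  · filter_upwards [eventually_ge_atTop 1] with n hn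
    have := hε n hn
    positivity
  · filter_upwards [eventually_inv_le_rpow hεO (show 0 < 1 / (8 * (E + 1)) by positivity),
      eventually_ge_atTop 1] with n h1 h2
    have hn1 : (1 : ℝ) ≤ n := by exact_mod_cast h2
    have hn0 : (0 : ℝ) < n := by linarith
    have hε0 := hε n h2
    have h3 : (ε n)⁻¹ ^ E ≤ (n : ℝ) ^ (1 / 8 : ℝ) := by
      refine (Real.rpow_le_rpow (by positivity) h1 hE).trans ?_
      rw [← Real.rpow_mul hn0.le]
      refine Real.rpow_le_rpow_of_exponent_le hn1 ?_
      rw [div_mul_eq_mul_div, one_mul, div_le_div_iff₀ (by positivity) (by norm_num)]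
      linarith
    have h4 : (n : ℝ) ^ (1 / 8 : ℝ) * (n : ℝ) ^ (-(1 / 4) : ℝ) = (n : ℝ) ^ (-(1 / 8) : ℝ) := by
      rw [← Real.rpow_add hn0]; norm_num
    rw [mul_assoc, ← h4]
    gcongr

theorem tendsto_underfit_bound {ε q : ℕ → ℝ} {ξ : ℝ} (hε : ∀ n, 1 ≤ n → 0 < ε n)
    (hεO : (fun n => (ε n)⁻¹) =O[atTop] fun n : ℕ => Real.log n ^ (1 / 8 : ℝ))
    (hξ : ξ < 1) (hq : q =O[atTop] fun n : ℕ => (n : ℝ) ^ ξ) {C c : ℝ} (hc : 0 < c) :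
    Tendsto (fun n : ℕ => Real.exp (C * Real.log n - c * (n * ε n))) atTop (𝓝 0) := by
  refine Real.tendsto_exp_atBot.comp ?_
  have hlog : Tendsto (fun n : ℕ => -Real.log n) atTop atBot :=
    tendsto_neg_atTop_atBot.comp (Real.tendsto_log_atTop.comp tendsto_natCast_atTop_atTop)
  refine tendsto_atBot_mono' _ ?_ hlog
  filter_upwards [eventually_le_mul_eps hε hεO hξ hq ((|C| + 1) / c), eventually_ge_atTop 1]
    with n h1 h2
  have hl0 : 0 ≤ Real.log n := Real.log_nonneg (by exact_mod_cast h2)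
  have h3 := mul_le_mul_of_nonneg_left h1 hc.le
  rw [← mul_assoc, mul_div_cancel₀ _ hc.ne'] at h3
  have h4 : (|C| + 1) * Real.log n ≤ (|C| + 1) * ((|q n| + 1) * Real.log n + 1) := by
    refine mul_le_mul_of_nonneg_left ?_ (by positivity)
    nlinarith [mul_nonneg (abs_nonneg (q n)) hl0]
  have h5 : C * Real.log n ≤ |C| * Real.log n := mul_le_mul_of_nonneg_right (le_abs_self C) hl0
  linarith

theorem exists_pos_le_abs (β₀ : ℕ →₀ ℝ) : ∃ b : ℝ, 0 < b ∧ ∀ j ∈ β₀.support, b ≤ |β₀ j| := by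
  rcases β₀.support.eq_empty_or_nonempty with h | h
  · exact ⟨1, one_pos, by simp [h]⟩
  · obtain ⟨j, hj, hmin⟩ := Finset.exists_min_image β₀.support (fun j => |β₀ j|) h
    exact ⟨|β₀ j|, abs_pos.2 (Finsupp.mem_support_iff.1 hj), hmin⟩

end Growth

/-! ### The comparison of all models on typical errors. -/

section Deterministic

/-- The error vectors for which the noise level is estimated well and no model explains too much of
the noise. -/
def typicalErrors {n p : ℕ} (X : Matrix (Fin n) (Fin p) ℝ) (t : Finset (Fin p)) (v : ℝ) :
    Set (Fin n → ℝ) :=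
  {e | 19 / 20 * v * n ≤ e ⬝ᵥ e ∧ e ⬝ᵥ e ≤ 21 / 20 * v * n ∧
    ∀ K : Finset (Fin p), t ⊆ K → K.card ≤ n → projSq (subDesign X K) e ≤
      2 * v * (21 / 20 * ((K \ t).card + 1 / 20) * Real.log n)}

set_option maxHeartbeats 1000000 in
/-- On typical errors, the posterior weight of every wrong model is negligible in comparison with
that of the true model. -/
theorem exists_priorWeight_mul_marginal_le
    {r : ℕ} (hr : 1 ≤ r) {α₁ α₂ c₁ c₂ : ℝ} (hα₁ : 0 < α₁) (hα₂ : 0 < α₂) (hc₁ : 0 < c₁)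
    (hc₂ : 0 < c₂) {p : ℕ → ℕ} {X : (n : ℕ) → Matrix (Fin n) (Fin (p n)) ℝ}
    {A : (n : ℕ) → Matrix (Fin (p n)) (Fin (p n)) ℝ} {q : ℕ → ℝ} {β₀ : ℕ →₀ ℝ}
    (ht : ∀ n, 1 ≤ n → ∀ j ∈ β₀.support, j < p n) {v : ℝ} (hv : 0 < v) {ε : ℕ → ℝ}
    (hε : ∀ n, 1 ≤ n → 0 < ε n ∧ ε n < 1 ∧ DesignEigenBounds (X n) (ε n))
    (hεO : (fun n => (ε n)⁻¹) =O[atTop] fun n : ℕ => Real.log n ^ (1 / 8 : ℝ))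
    {ξ : ℝ} (hξ : ξ < 1) (hq : q =O[atTop] fun n : ℕ => (n : ℝ) ^ ξ)
    (htq : ∀ᶠ n in atTop, (β₀.support.card : ℝ) ≤ q n)
    {a₁ a₂ : ℝ} (ha₁ : 0 < a₁) (ha₂ : 0 < a₂)
    (hA : ∀ n, 1 ≤ n → EigenvaluesBetween (A n) a₁ a₂) :
    ∃ c : ℕ → ℝ, Tendsto c atTop (𝓝 0) ∧ ∀ᶠ n in atTop, 0 ≤ c n ∧
      ∀ e ∈ typicalErrors (X n) (trueModel (p n) β₀) v, ∀ k, k ≠ trueModel (p n) β₀ →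
        priorWeight (q n) c₁ c₂ k * marginal (X n) (A n) r α₁ α₂ k (response (X n) β₀ e) ≤
        c n * (priorWeight (q n) c₁ c₂ (trueModel (p n) β₀) *
          marginal (X n) (A n) r α₁ α₂ (trueModel (p n) β₀) (response (X n) β₀ e)) := by
  obtain ⟨b, hb, hβ₀⟩ := exists_pos_le_abs β₀
  set T := β₀.support.card with hT
  obtain ⟨C, hC, hup⟩ := exists_emarginal_response_le hr hα₁ hα₂ ha₂ β₀ hb hβ₀
    (δ := 1 / 20) (by norm_num) (by norm_num)
  obtain ⟨c, hc, hlow⟩ := exists_le_emarginal_response r hα₁ hα₂ ha₁ ha₂ (s₀ := v / 2)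
    (s₁ := 2 * v) (by positivity) (by positivity) β₀ hb hβ₀
  -- The last argument is the part without log n of n(W - V)/(2V), given V ≥ (9/10)vn.
  obtain ⟨C₃, E, hC₃, hE, hover⟩ := exists_overfit_ratio_le (T := T) hr hc₁ hc₂ hC hc
    ((2 * T + C) / (9 / 5 * v))
  obtain ⟨C₄, hC₄, hunder⟩ := exists_underfit_ratio_le (T := T) hr hc₁ hc₂ hC hc
  -- This is (n/2) · (b²/4) nε / V divided by nε, at the upper bound V ≤ (2v + b²)n.
  set η₀ : ℝ := b ^ 2 / (8 * (2 * v + b ^ 2)) with hη₀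
  have hη₀0 : 0 < η₀ := by positivity
  set base : ℕ → ℝ := fun n => C₃ * (ε n)⁻¹ ^ E * (n : ℝ) ^ (-(1 / 4) : ℝ) with hbase
  set under : ℕ → ℝ := fun n => Real.exp (C₄ * Real.log n - η₀ * (n * ε n)) with hunderdef
  have hε0 : ∀ n, 1 ≤ n → 0 < ε n := fun n hn => (hε n hn).1
  have hlim1 : Tendsto base atTop (𝓝 0) := tendsto_overfit_bound hε0 hεO hC₃ hE
  have hlim2 : Tendsto under atTop (𝓝 0) := tendsto_underfit_bound hε0 hεO hξ hq hη₀0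
  refine ⟨fun n => max (base n) (under n), by simpa using hlim1.max hlim2, ?_⟩
  -- With C₅(P + 1) ≤ κnε, the projections and constants together stay below vn/20, which keeps
  -- residuals comparable to vn, and below (b²/4)nε, half of the gain from a missing column.
  set κ : ℝ := min (v / 20) (b ^ 2 / 4) with hκ
  have hκ0 : 0 < κ := by rw [hκ]; positivity
  set C₅ : ℝ := 10 * v + 2 * T + C with hC₅
  have hT0 : (0 : ℝ) ≤ T := Nat.cast_nonneg T
  filter_upwards [eventually_le_mul_eps hε0 hεO hξ hq (C₅ / κ),
    eventually_le_mul_eps hε0 hεO hξ hq (T + 1), eventually_ge_atTop 1, htq,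
    eventually_inv_le_rpow hεO (show (0 : ℝ) < 1 / 2 by norm_num),
    (Real.tendsto_log_atTop.comp tendsto_natCast_atTop_atTop).eventually_ge_atTop (max 1 C₄),
    hlim1.eventually_le_const one_pos, tendsto_natCast_atTop_atTop.eventually_ge_atTop (4 / b ^ 2)]
    with n g1 g2 hn1 htqn hεn hlog hbase1 hnb
  obtain ⟨hεpos, hε1, hX⟩ := hε n hn1
  have hn1' : (1 : ℝ) ≤ n := by exact_mod_cast hn1
  have hn0 : (0 : ℝ) < n := by linarith
  have hlog1 : 1 ≤ Real.log n := (le_max_left _ _).trans hlog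
  have hlogC : C₄ ≤ Real.log n := (le_max_right _ _).trans hlog
  have hbase0 : 0 ≤ base n := by rw [hbase]; positivity
  refine ⟨hbase0.trans (le_max_left _ _), ?_⟩
  intro e he k hkt
  obtain ⟨he1, he2, he3⟩ := he
  set t := trueModel (p n) β₀ with htdef
  have htcard : t.card = T := card_trueModel (ht n hn1)
  have hnε : n * ε n ≤ n := mul_le_of_le_one_right hn0.le hε1.le
  have hεn0 : 0 < n * ε n := mul_pos hn0 hεpos
  -- size of the models under consideration
  have hqT : |q n| + T ≤ n := by
    have h1 : (|q n| + 1) * 1 ≤ (|q n| + 1) * Real.log n :=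
      mul_le_mul_of_nonneg_left hlog1 (by positivity)
    have h2 := mul_nonneg hT0 (by linarith [abs_nonneg (q n)] :
      (0 : ℝ) ≤ (|q n| + 1) * Real.log n)
    linarith
  have hTn : T ≤ n := by
    have : (T : ℝ) ≤ n := by linarith [abs_nonneg (q n)]
    exact_mod_cast this
  -- bound on the projections
  set P : ℝ := (|q n| + 1) * Real.log n with hP
  have hP0 : 0 ≤ P := by positivity
  have hκP : C₅ * (P + 1) ≤ κ * (n * ε n) := by
    have h3 := mul_le_mul_of_nonneg_left g1 hκ0.le
    rwa [← mul_assoc, mul_div_cancel₀ _ hκ0.ne'] at h3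
  have hκ1 : κ * (n * ε n) ≤ v / 20 * n :=
    mul_le_mul (min_le_left _ _) hnε hεn0.le (by positivity)
  have hκ2 : κ * (n * ε n) ≤ b ^ 2 / 4 * (n * ε n) :=
    mul_le_mul_of_nonneg_right (min_le_right _ _) hεn0.le
  have hproj : ∀ K : Finset (Fin (p n)), t ⊆ K → K.card ≤ n → ((K \ t).card : ℝ) ≤ |q n| →
      projSq (subDesign (X n) K) e ≤ 21 / 10 * v * P := by
    intro K hK1 hK2 hK3
    refine (he3 K hK1 hK2).trans ?_
    have : ((K \ t).card + 1 / 20 : ℝ) * Real.log n ≤ P :=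
      mul_le_mul_of_nonneg_right (by linarith) (by linarith)
    have := mul_le_mul_of_nonneg_left this (by positivity : 0 ≤ 21 / 10 * v)
    linarith
  set Dt := projSq (subDesign (X n) t) e with hDt
  have hDt0 : 0 ≤ Dt := projSq_nonneg _ _
  have hDt1 : Dt ≤ 2 * v * (21 / 20 * (1 / 20) * Real.log n) := by
    have := he3 t subset_rfl (htcard ▸ hTn)
    simpa using this
  have hDt2 : Dt ≤ 21 / 10 * v * P := hproj t subset_rfl (htcard ▸ hTn) (by simp)
  have hvP : 0 ≤ v * P := by positivity
  have hC0 : 0 < C := by linarith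
  have hC₅P : C₅ * (P + 1) = 10 * (v * P) + (2 * T + C) * P + 10 * v + 2 * T + C := by
    rw [hC₅]; ring
  have hTCP : 0 ≤ (2 * T + C) * P := by positivity
  set W : ℝ := e ⬝ᵥ e + Dt + 2 * T with hW
  have hvn : 0 < v * n := by positivity
  have hW0 : v / 2 * n ≤ W := by linarith
  have hW1 : W ≤ 2 * v * n := by linarith
  have hWpos : 0 < W := lt_of_lt_of_le (by positivity) hW0
  have hhb : √(ε n / n) ≤ b / 2 := by
    rw [Real.sqrt_le_left (by positivity), div_le_iff₀ hn0]
    rw [div_le_iff₀ (by positivity)] at hnb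
    nlinarith
  have hlowt := hlow n (p n) (X n) (A n) (ε n) e W hn1 (hA n hn1) hX hεpos (ht n hn1) hTn hhb
    rfl hW0 hW1
  rw [← htdef] at hlowt
  -- `marginal` is a `toReal`, which sends ∞ to 0. The upper bound, applied to the true model
  -- itself, excludes this, so the lower bound passes to real numbers.
  have hfin : emarginal (X n) (A n) r α₁ α₂ t (response (X n) β₀ e) ≠ ⊤ := by
    have hDtt : projSq (subDesign (X n) (t ∪ t)) e ≤ 21 / 10 * v * P :=
      hproj (t ∪ t) Finset.subset_union_left (by simpa [htcard] using hTn) (by simp)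
    refine ne_top_of_le_ne_top ENNReal.ofReal_ne_top (hup n (p n) (X n) (A n) a₁ (ε n) t e
      ((e ⬝ᵥ e - (1 + 1 / 20) * projSq (subDesign (X n) (t ∪ t)) e - C) / 2) hn1 (hA n hn1) ha₁ hX
      hεpos hε1 (by rw [← htdef, Finset.union_self, htcard]; exact hTn) (by linarith) (fun _ => by rw [← htdef]; linarith)
      (fun h => absurd subset_rfl h))
  rw [ENNReal.ofReal_le_iff_le_toReal hfin] at hlowt
  have hwt : priorWeight (q n) c₁ c₂ t =
      c₁ ^ (-(T : ℝ)) * (p n : ℝ) ^ (-(c₂ * T)) := by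
    rw [priorWeight, htcard, if_pos htqn]
  have hwt0 : 0 ≤ priorWeight (q n) c₁ c₂ t := by rw [hwt]; positivity
  have hmt0 : 0 ≤ marginal (X n) (A n) r α₁ α₂ t (response (X n) β₀ e) := ENNReal.toReal_nonneg
  by_cases hkq : (k.card : ℝ) ≤ q n
  swap
  · rw [priorWeight, if_neg hkq, zero_mul]
    exact mul_nonneg (hbase0.trans (le_max_left _ _)) (mul_nonneg hwt0 hmt0)
  have hwk : priorWeight (q n) c₁ c₂ k =
      c₁ ^ (-(k.card : ℝ)) * (p n : ℝ) ^ (-(c₂ * k.card)) := by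
    rw [priorWeight, if_pos hkq]
  have hwk0 : 0 ≤ priorWeight (q n) c₁ c₂ k := by rw [hwk]; positivity
  have hp1 : 1 ≤ p n := by
    by_contra h0
    have h00 : p n = 0 := by omega
    have : IsEmpty (Fin (p n)) := by rw [h00]; infer_instance
    exact hkt (Subsingleton.elim _ _)
  have hkabs : (k.card : ℝ) ≤ |q n| := hkq.trans (le_abs_self _)
  have hkn : (k ∪ t).card ≤ n := by
    have h1 : ((k ∪ t).card : ℝ) ≤ k.card + t.card := by exact_mod_cast Finset.card_union_le k t
    have : ((k ∪ t).card : ℝ) ≤ n := by rw [htcard] at h1; linarith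
    exact_mod_cast this
  have hsd : (k ∪ t) \ t = k \ t := Finset.union_sdiff_right k t
  have hsdk : ((k \ t).card : ℝ) ≤ k.card := by
    exact_mod_cast Finset.card_le_card Finset.sdiff_subset
  set D := projSq (subDesign (X n) (k ∪ t)) e with hD
  have hD0 : 0 ≤ D := projSq_nonneg _ _
  have hD2 : D ≤ 21 / 10 * v * P :=
    hproj _ Finset.subset_union_right hkn (by rw [hsd]; linarith)
  -- it suffices to compare the two bounds
  have hconclude : ∀ V R : ℝ, 0 < V → 0 ≤ R → R ≤ max (base n) (under n) →
      (t ⊆ k → V ≤ e ⬝ᵥ e - (1 + 1 / 20) * D - C) →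
      (¬ t ⊆ k → V ≤ e ⬝ᵥ e + n * ε n * (b ^ 2 / 2) - (2 + 1 / 20) * D - C) →
      c₁ ^ (-(k.card : ℝ)) * (p n : ℝ) ^ (-(c₂ * k.card)) *
          (C ^ (k.card + 1) * (n : ℝ) ^ (r * (k ∩ t).card) *
            ((n * ε n) ^ (-(((r : ℝ) + 1 / 2) * k.card)) *
              ((k.card : ℝ) / n) ^ (((r : ℝ) + 1 / 2) * k.card)) * rssFactor n V) ≤
        R * (c₁ ^ (-(T : ℝ)) * (p n : ℝ) ^ (-(c₂ * T)) *
            (c * (n : ℝ) ^ (-(((r : ℝ) + 1 / 2) * T)) * (n : ℝ)⁻¹ * √(ε n / n) ^ T *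
              rssFactor n W)) →
      priorWeight (q n) c₁ c₂ k * marginal (X n) (A n) r α₁ α₂ k (response (X n) β₀ e) ≤
        max (base n) (under n) * (priorWeight (q n) c₁ c₂ t *
          marginal (X n) (A n) r α₁ α₂ t (response (X n) β₀ e)) := by
    intro V R hV hR hRmax h1 h2 hcmp
    have hupk := hup n (p n) (X n) (A n) a₁ (ε n) k e (V / 2) hn1 (hA n hn1) ha₁ hX hεpos hε1 hkn
      (by positivity) (fun h => by rw [mul_div_cancel₀ _ two_ne_zero]; exact h1 h)
      (fun h => by rw [mul_div_cancel₀ _ two_ne_zero]; exact h2 h)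
    rw [mul_div_cancel₀ _ two_ne_zero] at hupk
    have hF := rssFactor_nonneg n hV.le
    have hmk : marginal (X n) (A n) r α₁ α₂ k (response (X n) β₀ e) ≤ _ :=
      ENNReal.toReal_le_of_le_ofReal (by positivity) hupk
    refine (mul_le_mul_of_nonneg_left hmk hwk0).trans ?_
    rw [hwk]
    refine hcmp.trans ?_
    rw [← hwt]
    refine mul_le_mul hRmax (mul_le_mul_of_nonneg_left hlowt hwt0)
      (mul_nonneg hwt0 ?_) (hR.trans hRmax)
    have := rssFactor_nonneg n hWpos.le
    positivity
  by_cases htk : t ⊆ k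
  · set d := (k \ t).card with hd
    have hkd : k.card = T + d := by
      rw [hd, Finset.card_sdiff_of_subset htk, htcard]
      have := Finset.card_le_card htk
      omega
    have hd1 : 1 ≤ d := Finset.card_pos.2 (by
      rw [Finset.sdiff_nonempty]
      exact fun h => hkt (subset_antisymm h htk))
    have hkt' : (k ∩ t).card = T := by rw [Finset.inter_eq_right.2 htk, htcard]
    have hDd : D ≤ 2 * v * (21 / 20 * (d + 1 / 20) * Real.log n) := by
      have := he3 _ Finset.subset_union_right hkn
      rwa [hsd] at this
    -- In units of 2v log n, W - V is at most (21/20)²(d + 1/20) + (21/20)/20 plus constants;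
    -- division by 9/10 stays below 5d/4 + 1/4.
    set V : ℝ := e ⬝ᵥ e - (1 + 1 / 20) * D - C with hV
    have hV0 : 9 / 10 * v * n ≤ V := by linarith
    have hVpos : 0 < V := lt_of_lt_of_le (by positivity) hV0
    have hTd : T + d ≤ n := by
      rw [← hkd]; exact (Finset.card_le_card Finset.subset_union_left).trans hkn
    have hratio : n / 2 * ((W - V) / V) ≤
        (5 / 4 * d + 1 / 4) * Real.log n + (2 * T + C) / (9 / 5 * v) := by
      have h1 : W - V ≤ 2 * v * (9 / 10) * ((5 / 4 * d + 1 / 4) * Real.log n) + (2 * T + C) := by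
        have hdl : 0 ≤ (d : ℝ) * (v * Real.log n) := by positivity
        have hvl : 0 ≤ v * Real.log n := by positivity
        linarith
      have h0 : 0 ≤ W - V := by rw [hW, hV]; linarith
      calc n / 2 * ((W - V) / V) ≤ n / 2 * ((W - V) / (9 / 10 * v * n)) := by gcongr
        _ = (W - V) / (9 / 5 * v) := by field_simp; ring
        _ ≤ (2 * v * (9 / 10) * ((5 / 4 * d + 1 / 4) * Real.log n) + (2 * T + C)) /
              (9 / 5 * v) := by gcongr
        _ = _ := by field_simp; ring
    refine hconclude V (base n ^ (d + 1)) hVpos (by positivity) ?_ (fun _ => le_rfl)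
      (fun h => absurd htk h) ?_
    · refine le_trans ?_ (le_max_left _ _)
      exact pow_le_of_le_one hbase0 hbase1 (Nat.succ_ne_zero d)
    · rw [hkd, hkt']
      exact hover n (p n) d (ε n) V W hn1 hp1 hd1 hTd hεpos hε1 hVpos hWpos hratio
  -- Half of the gain (b²/2)nε is given up to absorb all projection terms and constants, including
  -- the difference between W and e ⬝ᵥ e.
  · set V : ℝ := W + b ^ 2 / 4 * (n * ε n) with hV
    have hVpos : 0 < V := by positivity
    have hpn : (p n : ℝ) ≤ (n : ℝ) ^ 2 := by
      refine (hX.card_le hn1 hεpos).trans ?_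
      have h1 : (ε n)⁻¹ * (ε n)⁻¹ ≤ (n : ℝ) ^ (1 / 2 : ℝ) * (n : ℝ) ^ (1 / 2 : ℝ) :=
        mul_le_mul hεn hεn (by positivity) (by positivity)
      rw [← Real.rpow_add hn0, show (1 / 2 + 1 / 2 : ℝ) = 1 by norm_num, Real.rpow_one] at h1
      rw [sq]
      exact mul_le_mul_of_nonneg_left h1 hn0.le
    have hεlog : -Real.log (ε n) ≤ Real.log n / 2 := by
      have := Real.log_le_log (inv_pos.2 hεpos) hεn
      rw [Real.log_inv, Real.log_rpow hn0] at this
      linarith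
    have hratio : n / 2 * ((W - V) / V) ≤ -(η₀ * (n * ε n)) := by
      have hVn : V ≤ (2 * v + b ^ 2) * n := by
        have h1 : b ^ 2 / 4 * (n * ε n) ≤ b ^ 2 / 4 * n := by gcongr
        have h2 : 0 ≤ b ^ 2 * n := by positivity
        linarith
      have h3 : W - V = -(b ^ 2 / 4 * (n * ε n)) := by rw [hV]; ring
      rw [h3, neg_div, mul_neg, neg_le_neg_iff]
      calc η₀ * (n * ε n) = n / 2 * (b ^ 2 / 4 * (n * ε n) / ((2 * v + b ^ 2) * n)) := by
            rw [hη₀]; field_simp; ring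
        _ ≤ _ := by gcongr
    refine hconclude V (under n) hVpos (Real.exp_pos _).le (le_max_right _ _)
      (fun h => absurd h htk) (fun _ => ?_) ?_
    · rw [hV, hW]; linarith
    · refine hunder n (p n) k.card (k ∩ t).card (ε n) V W (η₀ * (n * ε n)) hn1 hp1
        ((Finset.card_le_card Finset.subset_union_left).trans hkn) ?_ hεpos hε1 hVpos hWpos hpn
        hεlog hlogC hratio
      rw [← htcard]
      exact Finset.card_le_card Finset.inter_subset_right

end Deterministic

/-! ### Typical errors have probability tending to one. -/

section Probability

theorem memLp_sq_gaussianReal (v : ℝ≥0) : MemLp (fun x : ℝ => x ^ 2) 2 (gaussianReal 0 v) := by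
  rw [memLp_two_iff_integrable_sq (by fun_prop)]
  have h := (memLp_id_gaussianReal (μ := 0) (v := v) 4).integrable_norm_pow (by norm_num)
  refine h.congr (ae_of_all _ fun x => ?_)
  simp only [id, Real.norm_eq_abs]
  rw [← pow_mul]
  exact (Even.pow_abs (by decide : Even (2 * 2)) x)

theorem integral_sq_gaussianReal (v : ℝ≥0) : ∫ x, x ^ 2 ∂(gaussianReal 0 v) = v := by
  have h := variance_of_integral_eq_zero (μ := gaussianReal 0 v) (X := id) aemeasurable_id
    (by simp)
  rw [variance_id_gaussianReal] at h
  simpa using h.symm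

/-- The concentration of the squared length of a Gaussian vector. -/
theorem measure_abs_dotProduct_self_sub_le (n : ℕ) (v : ℝ≥0) {c : ℝ} (hc : 0 < c) :
    (Measure.pi fun _ : Fin n => gaussianReal 0 v) {e | c ≤ |e ⬝ᵥ e - v * n|} ≤
      ENNReal.ofReal (n * Var[fun x => x ^ 2; gaussianReal 0 v] / c ^ 2) := by
  set ν := Measure.pi fun _ : Fin n => gaussianReal 0 v with hν
  have hmem : ∀ i : Fin n, MemLp (fun e : Fin n → ℝ => e i ^ 2) 2 ν := fun i =>
    (memLp_sq_gaussianReal v).comp_measurePreserving (measurePreserving_eval _ i)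
  have hvar := variance_sum_pi (ι := Fin n) (μ := fun _ => gaussianReal 0 v)
    (X := fun _ x => x ^ 2) fun _ => memLp_sq_gaussianReal v
  have hfun : (∑ i, fun e : Fin n → ℝ => e i ^ 2) = fun e => e ⬝ᵥ e := by
    ext e
    simp [dotProduct, sq]
  have hmean : ∫ e, e ⬝ᵥ e ∂ν = v * n := by
    simp only [dotProduct, ← sq]
    rw [integral_finsetSum _ fun i _ => (hmem i).integrable (by norm_num)]
    have : ∀ i : Fin n, ∫ e, e i ^ 2 ∂ν = v := fun i => by
      rw [← integral_sq_gaussianReal v]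
      exact integral_comp_eval (μ := fun _ : Fin n => gaussianReal 0 v) (i := i)
        (f := fun x : ℝ => x ^ 2) (by fun_prop)
    simp [this, mul_comm]
  have hmem' : MemLp (fun e : Fin n → ℝ => e ⬝ᵥ e) 2 ν := by
    rw [← hfun]
    exact memLp_finsetSum' _ fun i _ => hmem i
  have h := meas_ge_le_variance_div_sq hmem' hc
  rw [hmean] at h
  refine h.trans (le_of_eq ?_)
  rw [← hfun, hvar]
  simp

/-- K ↦ K \ t is injective on the supersets of t, so the sum is part of the binomial expansion over
all subsets. -/
theorem sum_pow_card_sdiff_le {p : ℕ} (t : Finset (Fin p)) {a : ℝ} (ha : 0 ≤ a) :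
    ∑ K : Finset (Fin p) with t ⊆ K, a ^ (K \ t).card ≤ (1 + a) ^ p := by
  have h := Fin.sum_pow_mul_eq_add_pow (n := p) a 1
  simp only [one_pow, mul_one] at h
  rw [add_comm, ← h]
  have hinj : Set.InjOn (fun K : Finset (Fin p) => K \ t)
      (Finset.univ.filter fun K : Finset (Fin p) => t ⊆ K) := by
    intro K hK L hL hKL
    have hK' : t ⊆ K := by simpa using hK
    have hL' : t ⊆ L := by simpa using hL
    rw [← Finset.sdiff_union_of_subset hK', ← Finset.sdiff_union_of_subset hL']
    exact congrArg (· ∪ t) hKL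
  rw [← Finset.sum_image (f := fun s : Finset (Fin p) => a ^ s.card) hinj]
  exact Finset.sum_le_sum_of_subset_of_nonneg (Finset.subset_univ _) fun _ _ _ => by positivity

/-- A union bound for the squared lengths of all projections. -/
theorem measure_projSq_exceeds_le {n p : ℕ} {X : Matrix (Fin n) (Fin p) ℝ} {ε : ℝ}
    (hX : DesignEigenBounds X ε) (hn : 1 ≤ n) (hε : 0 < ε) (t : Finset (Fin p)) {v : ℝ≥0}
    (hv : 0 < v) :
    (Measure.pi fun _ : Fin n => gaussianReal 0 v) {e | ∃ K : Finset (Fin p), t ⊆ K ∧ K.card ≤ n ∧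
        2 * v * (21 / 20 * ((K \ t).card + 1 / 20) * Real.log n) < projSq (subDesign X K) e} ≤
      ENNReal.ofReal (10 ^ t.card * Real.exp (p * (10 * (n : ℝ) ^ (-(103 / 100) : ℝ))) *
        (n : ℝ) ^ (-(1 / 20) : ℝ)) := by
  have hn0 : (0 : ℝ) < n := by exact_mod_cast hn
  have hn1 : (1 : ℝ) ≤ n := by exact_mod_cast hn
  set ν := Measure.pi fun _ : Fin n => gaussianReal 0 v with hν
  set a : ℝ := 10 * (n : ℝ) ^ (-(103 / 100) : ℝ) with ha
  have ha0 : 0 ≤ a := by positivity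
  have hsub : {e : Fin n → ℝ | ∃ K : Finset (Fin p), t ⊆ K ∧ K.card ≤ n ∧
      2 * v * (21 / 20 * ((K \ t).card + 1 / 20) * Real.log n) < projSq (subDesign X K) e} ⊆
      ⋃ K ∈ Finset.univ.filter fun K : Finset (Fin p) => t ⊆ K, {e | K.card ≤ n ∧
        2 * v * (21 / 20 * ((K \ t).card + 1 / 20) * Real.log n) < projSq (subDesign X K) e} := by
    rintro e ⟨K, h1, h2, h3⟩
    simp only [Set.mem_iUnion]
    exact ⟨K, by simpa using h1, h2, h3⟩
  refine (measure_mono hsub).trans ((measure_biUnion_finset_le _ _).trans ?_)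
  have hK : ∀ K ∈ Finset.univ.filter fun K : Finset (Fin p) => t ⊆ K, ν {e | K.card ≤ n ∧
        2 * v * (21 / 20 * ((K \ t).card + 1 / 20) * Real.log n) < projSq (subDesign X K) e} ≤
      ENNReal.ofReal (10 ^ t.card * (n : ℝ) ^ (-(1 / 20) : ℝ) * a ^ (K \ t).card) := by
    intro K hK
    have htK : t ⊆ K := by simpa using hK
    by_cases hKn : K.card ≤ n
    swap
    · simp [hKn]
    refine (measure_mono (fun e he => he.2)).trans ((measure_le_projSq_le (mul_pos hn0 hε)
      (fun w => (hX.quadForm_bounds hn hKn w).1) hv (θ := 99 / 100) (by norm_num) (by norm_num)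
      _).trans (ENNReal.ofReal_le_ofReal ?_))
    have h10 : (√(1 - 99 / 100 : ℝ))⁻¹ = 10 := by
      rw [show (1 - 99 / 100 : ℝ) = (1 / 10) ^ 2 by norm_num, Real.sqrt_sq (by norm_num)]
      norm_num
    have hcard : Fintype.card K = t.card + (K \ t).card := by
      rw [Fintype.card_coe, Finset.card_sdiff_of_subset htK]
      have := Finset.card_le_card htK
      omega
    rw [h10, hcard, ha, mul_pow]
    -- (99/100)(21/20) = 1.0395 exceeds 1.03, and one twentieth of it exceeds 1/20. The exponent per
    -- column must exceed 1 for the sum over nearly n columns to stay bounded; the extra 1/20 makes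
    -- the whole bound vanish.
    have he : Real.exp (-(99 / 100 * (21 / 20 * ((K \ t).card + 1 / 20) * Real.log n))) ≤
        (n : ℝ) ^ (-(1 / 20) : ℝ) * ((n : ℝ) ^ (-(103 / 100) : ℝ)) ^ (K \ t).card := by
      rw [← Real.rpow_natCast, ← Real.rpow_mul hn0.le, ← Real.rpow_add hn0,
        Real.rpow_def_of_pos hn0]
      refine Real.exp_le_exp.2 ?_
      have hl0 : 0 ≤ Real.log n := Real.log_nonneg hn1
      have h1 : 0 ≤ ((K \ t).card : ℝ) * Real.log n := by positivity
      linarith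
    rw [pow_add]
    calc _ ≤ ((n : ℝ) ^ (-(1 / 20) : ℝ) * ((n : ℝ) ^ (-(103 / 100) : ℝ)) ^ (K \ t).card) *
          (10 ^ t.card * 10 ^ (K \ t).card) := by gcongr
      _ = _ := by ring
  refine (Finset.sum_le_sum hK).trans ?_
  rw [← ENNReal.ofReal_sum_of_nonneg fun _ _ => by positivity, ← Finset.mul_sum]
  refine ENNReal.ofReal_le_ofReal ?_
  have h1 : ∑ K : Finset (Fin p) with t ⊆ K, a ^ (K \ t).card ≤ Real.exp (p * a) := by
    refine (sum_pow_card_sdiff_le t ha0).trans ?_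
    rw [Real.exp_nat_mul]
    refine pow_le_pow_left₀ (by positivity) ?_ p
    rw [add_comm]; exact Real.add_one_le_exp a
  calc _ ≤ 10 ^ t.card * (n : ℝ) ^ (-(1 / 20) : ℝ) * Real.exp (p * a) := by gcongr
    _ = _ := by ring

theorem tendsto_measure_typicalErrors_compl {p : ℕ → ℕ}
    {X : (n : ℕ) → Matrix (Fin n) (Fin (p n)) ℝ} {β₀ : ℕ →₀ ℝ}
    (ht : ∀ n, 1 ≤ n → ∀ j ∈ β₀.support, j < p n) {v : ℝ≥0} (hv : 0 < v) {ε : ℕ → ℝ}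
    (hε : ∀ n, 1 ≤ n → 0 < ε n ∧ ε n < 1 ∧ DesignEigenBounds (X n) (ε n))
    (hεO : (fun n => (ε n)⁻¹) =O[atTop] fun n : ℕ => Real.log n ^ (1 / 8 : ℝ)) :
    Tendsto (fun n => (Measure.pi fun _ : Fin n => gaussianReal 0 v)
      (typicalErrors (X n) (trueModel (p n) β₀) v)ᶜ) atTop (𝓝 0) := by
  have hv' : (0 : ℝ) < v := by exact_mod_cast hv
  set V₀ : ℝ := Var[fun x => x ^ 2; gaussianReal 0 v] with hV₀
  have hV₀0 : 0 ≤ V₀ := variance_nonneg _ _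
  set T := β₀.support.card with hT
  have hlim : Tendsto (fun n : ℕ => ENNReal.ofReal (400 * V₀ / v ^ 2 * (n : ℝ)⁻¹ +
      10 ^ T * Real.exp 10 * (n : ℝ) ^ (-(1 / 20) : ℝ))) atTop (𝓝 0) := by
    rw [← ENNReal.ofReal_zero]
    refine ENNReal.tendsto_ofReal ?_
    have h1 := (tendsto_inv_atTop_nhds_zero_nat (𝕜 := ℝ)).const_mul (400 * V₀ / v ^ 2)
    have h2 := ((tendsto_rpow_neg_atTop (show (0 : ℝ) < 1 / 20 by norm_num)).comp
      (tendsto_natCast_atTop_atTop (R := ℝ))).const_mul (10 ^ T * Real.exp 10)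
    simpa using h1.add h2
  refine tendsto_of_tendsto_of_tendsto_of_le_of_le' tendsto_const_nhds hlim
    (Eventually.of_forall fun _ => zero_le) ?_
  filter_upwards [eventually_ge_atTop 1,
    eventually_inv_le_rpow hεO (show (0 : ℝ) < 1 / 100 by norm_num)] with n hn hεn
  obtain ⟨hε0, hε1, hX⟩ := hε n hn
  have hn0 : (0 : ℝ) < n := by exact_mod_cast hn
  have hn1 : (1 : ℝ) ≤ n := by exact_mod_cast hn
  set t := trueModel (p n) β₀ with htdef
  have htcard : t.card = T := card_trueModel (ht n hn)
  have hsub : (typicalErrors (X n) t v)ᶜ ⊆ {e | v * n / 20 ≤ |e ⬝ᵥ e - v * n|} ∪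
      {e | ∃ K : Finset (Fin (p n)), t ⊆ K ∧ K.card ≤ n ∧
        2 * v * (21 / 20 * ((K \ t).card + 1 / 20) * Real.log n) <
          projSq (subDesign (X n) K) e} := by
    intro e he
    by_contra hcon
    simp only [Set.mem_union, Set.mem_ofPred_eq, not_or, not_exists, not_and, not_le, not_lt] at hcon
    have h1 := abs_lt.1 hcon.1
    exact he ⟨by linarith, by linarith, hcon.2⟩
  -- With ε⁻¹ ≤ n^(1/100), `DesignEigenBounds.card_le` gives p ≤ n^(1.02), less than the n^(1.03)
  -- that the union bound tolerates.
  have hpn : (p n : ℝ) * (10 * (n : ℝ) ^ (-(103 / 100) : ℝ)) ≤ 10 := by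
    have h1 : (ε n)⁻¹ * (ε n)⁻¹ ≤ (n : ℝ) ^ (1 / 100 : ℝ) * (n : ℝ) ^ (1 / 100 : ℝ) :=
      mul_le_mul hεn hεn (by positivity) (by positivity)
    have h2 : (p n : ℝ) ≤ n * ((n : ℝ) ^ (1 / 100 : ℝ) * (n : ℝ) ^ (1 / 100 : ℝ)) :=
      (hX.card_le hn hε0).trans (mul_le_mul_of_nonneg_left h1 hn0.le)
    have h3 : n * ((n : ℝ) ^ (1 / 100 : ℝ) * (n : ℝ) ^ (1 / 100 : ℝ)) *
        (n : ℝ) ^ (-(103 / 100) : ℝ) ≤ 1 := by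
      nth_rewrite 1 [← Real.rpow_one (n : ℝ)]
      rw [← Real.rpow_add hn0, ← Real.rpow_add hn0, ← Real.rpow_add hn0]
      exact Real.rpow_le_one_of_one_le_of_nonpos hn1 (by norm_num)
    have h4 := mul_le_mul_of_nonneg_right h2 (Real.rpow_nonneg hn0.le (-(103 / 100) : ℝ))
    linarith
  refine (measure_mono hsub).trans ((measure_union_le _ _).trans ?_)
  rw [ENNReal.ofReal_add (by positivity) (by positivity)]
  refine add_le_add ((measure_abs_dotProduct_self_sub_le n v (by positivity)).trans
    (le_of_eq ?_)) ((measure_projSq_exceeds_le hX hn hε0 t hv).trans (ENNReal.ofReal_le_ofReal ?_))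
  · congr 1
    rw [← hV₀]
    field_simp; norm_num
  · rw [htcard]
    have := Real.exp_le_exp.2 hpn
    gcongr

end Probability

/-! ### From weighted marginal densities to posterior ratios. -/

section PosteriorRatio

variable {n p : ℕ}

theorem priorWeight_nonneg {c₁ : ℝ} (hc₁ : 0 < c₁) (q c₂ : ℝ) (k : Finset (Fin p)) :
    0 ≤ priorWeight q c₁ c₂ k := by
  unfold priorWeight
  split_ifs <;> positivity

/-- Both normalizing sums are common to the two sides and nonnegative; their vanishing does no harm,
as division by zero gives 0. -/
theorem posterior_le_mul_posterior {X : Matrix (Fin n) (Fin p) ℝ} {A : Matrix (Fin p) (Fin p) ℝ}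
    {r : ℕ} {α₁ α₂ q c₁ c₂ c : ℝ} (hc₁ : 0 < c₁) {k t : Finset (Fin p)} {y : Fin n → ℝ}
    (h : priorWeight q c₁ c₂ k * marginal X A r α₁ α₂ k y ≤
      c * (priorWeight q c₁ c₂ t * marginal X A r α₁ α₂ t y)) :
    posterior X A r α₁ α₂ q c₁ c₂ k y ≤ c * posterior X A r α₁ α₂ q c₁ c₂ t y := by
  have hS : 0 ≤ ∑ l : Finset (Fin p), priorWeight q c₁ c₂ l :=
    Finset.sum_nonneg fun l _ => priorWeight_nonneg hc₁ q c₂ l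
  have hZ : 0 ≤ ∑ l : Finset (Fin p), modelPrior q c₁ c₂ l * marginal X A r α₁ α₂ l y :=
    Finset.sum_nonneg fun l _ => mul_nonneg (div_nonneg (priorWeight_nonneg hc₁ q c₂ l) hS)
      ENNReal.toReal_nonneg
  rw [posterior, posterior, ← mul_div_assoc]
  refine div_le_div_of_nonneg_right ?_ hZ
  rw [modelPrior, modelPrior, div_mul_eq_mul_div, div_mul_eq_mul_div, ← mul_div_assoc]
  exact div_le_div_of_nonneg_right h hS

theorem posterior_nonneg (X : Matrix (Fin n) (Fin p) ℝ) (A : Matrix (Fin p) (Fin p) ℝ)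
    (r : ℕ) (α₁ α₂ q c₂ : ℝ) {c₁ : ℝ} (hc₁ : 0 < c₁) (k : Finset (Fin p)) (y : Fin n → ℝ) :
    0 ≤ posterior X A r α₁ α₂ q c₁ c₂ k y := by
  have hm : ∀ l : Finset (Fin p), 0 ≤ modelPrior q c₁ c₂ l * marginal X A r α₁ α₂ l y := fun l =>
    mul_nonneg (div_nonneg (priorWeight_nonneg hc₁ q c₂ l)
      (Finset.sum_nonneg fun l _ => priorWeight_nonneg hc₁ q c₂ l)) ENNReal.toReal_nonneg
  exact div_nonneg (hm k) (Finset.sum_nonneg fun l _ => hm l)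

theorem maxPosteriorRatio_nonneg (X : Matrix (Fin n) (Fin p) ℝ) (A : Matrix (Fin p) (Fin p) ℝ)
    (r : ℕ) (α₁ α₂ q c₂ : ℝ) {c₁ : ℝ} (hc₁ : 0 < c₁) (t : Finset (Fin p)) (y : Fin n → ℝ) :
    0 ≤ maxPosteriorRatio X A r α₁ α₂ q c₁ c₂ t y :=
  Real.iSup_nonneg fun _ => div_nonneg (posterior_nonneg X A r α₁ α₂ q c₂ hc₁ _ y)
    (posterior_nonneg X A r α₁ α₂ q c₂ hc₁ _ y)

theorem maxPosteriorRatio_le {X : Matrix (Fin n) (Fin p) ℝ} {A : Matrix (Fin p) (Fin p) ℝ}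
    {r : ℕ} {α₁ α₂ q c₁ c₂ c : ℝ} (hc₁ : 0 < c₁) (hc : 0 ≤ c) {t : Finset (Fin p)} {y : Fin n → ℝ}
    (h : ∀ k, k ≠ t → priorWeight q c₁ c₂ k * marginal X A r α₁ α₂ k y ≤
      c * (priorWeight q c₁ c₂ t * marginal X A r α₁ α₂ t y)) :
    maxPosteriorRatio X A r α₁ α₂ q c₁ c₂ t y ≤ c :=
  Real.iSup_le (fun k => div_le_of_le_mul₀ (posterior_nonneg X A r α₁ α₂ q c₂ hc₁ _ y) hc
    (posterior_le_mul_posterior hc₁ (h k.1 k.2))) hc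

theorem EigenvaluesBetween.mono {A : Matrix (Fin p) (Fin p) ℝ} {a₁ a₂ b : ℝ}
    (h : EigenvaluesBetween A a₁ a₂) (hb : a₂ ≤ b) : EigenvaluesBetween A a₁ b :=
  ⟨h.1, fun i => ⟨(h.2 i).1, (h.2 i).2.trans_le hb⟩⟩

end PosteriorRatio

end HyperPMOM

end

/-! ### The consistency theorem. -/

theorem theorem5p1
    {Ω : Type*} [MeasurableSpace Ω] (μ : Measure Ω) [IsProbabilityMeasure μ]
    -- order of the pMOM prior, hyperparameters, constants of the complexity prior
    (r : ℕ) (hr : 1 ≤ r)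
    (α₁ α₂ : ℝ) (hα₁ : 0 < α₁) (hα₂ : 0 < α₂)
    (c₁ c₂ : ℝ) (hc₁ : 0 < c₁) (hc₂ : 0 < c₂)
    -- dimensions, design matrices, prior scale matrices, bounds on the model size
    (p : ℕ → ℕ) (X : (n : ℕ) → Matrix (Fin n) (Fin (p n)) ℝ)
    (A : (n : ℕ) → Matrix (Fin (p n)) (Fin (p n)) ℝ) (q : ℕ → ℝ)
    -- the true coefficients and the true model, which do not depend on the sample size
    (β₀ : ℕ →₀ ℝ) (ht : ∀ n, 1 ≤ n → ∀ j ∈ β₀.support, j < p n)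
    -- independent Gaussian errors with variance `σ₀²`
    (σ₀sq : ℝ≥0) (hσ₀ : 0 < σ₀sq)
    (e : (n : ℕ) → Fin n → Ω → ℝ)
    (he_law : ∀ n i, HasLaw (e n i) (gaussianReal 0 σ₀sq) μ)
    (he_indep : ∀ n, iIndepFun (e n) μ)
    -- eigenvalues of the Gram matrices of all models
    (ε : ℕ → ℝ) (hε : ∀ n, 1 ≤ n → 0 < ε n ∧ ε n < 1 ∧ HyperPMOM.DesignEigenBounds (X n) (ε n))
    (hεO : (fun n => (ε n)⁻¹) =O[atTop] fun n : ℕ => Real.log n ^ (1 / 8 : ℝ))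
    -- size of the models with positive prior probability
    (ξ : ℝ) (hξ : ξ < 1) (hq : q =O[atTop] fun n : ℕ => (n : ℝ) ^ ξ)
    (htq : ∀ᶠ n in atTop, (β₀.support.card : ℝ) ≤ q n)
    -- eigenvalues of the prior scale matrices
    (a₁ a₂ : ℝ) (ha₁ : 0 < a₁) (hA : ∀ n, 1 ≤ n → HyperPMOM.EigenvaluesBetween (A n) a₁ a₂)
    -- growth of the number of covariates
    (κ : ℝ) (hκ₀ : 0 < κ) (hκ₁ : κ < 1)
    (hp : (fun n => Real.log (p n)) =O[atTop] fun n : ℕ => (n : ℝ) ^ κ) :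
    TendstoInMeasure μ
      (fun n ω => HyperPMOM.maxPosteriorRatio (X n) (A n) r α₁ α₂ (q n) c₁ c₂
        (HyperPMOM.trueModel (p n) β₀)
        (HyperPMOM.response (X n) β₀ fun i => e n i ω))
      atTop (fun _ => 0) := by
  have hv : (0 : ℝ) < σ₀sq := by exact_mod_cast hσ₀
  -- The upper eigenvalue bound is enlarged to max a₂ 1 to be positive: for empty matrices the
  -- eigenvalue condition is vacuous and does not force a₂ > 0.
  obtain ⟨c, hc, hev⟩ := HyperPMOM.exists_priorWeight_mul_marginal_le hr hα₁ hα₂ hc₁ hc₂ ht hv hε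
    hεO hξ hq htq ha₁ (lt_max_of_lt_right one_pos : 0 < max a₂ 1)
    fun n hn => (hA n hn).mono (le_max_left _ _)
  rw [tendstoInMeasure_iff_dist]
  intro η hη
  refine tendsto_of_tendsto_of_tendsto_of_le_of_le' tendsto_const_nhds
    (HyperPMOM.tendsto_measure_typicalErrors_compl ht hσ₀ hε hεO)
    (Eventually.of_forall fun _ => zero_le) ?_
  filter_upwards [hev, hc.eventually_lt_const hη] with n hn hcη
  have hlaw := (he_indep n).hasLaw_pi (he_law n)
  rw [← hlaw.map_eq]
  -- The errors have the product Gaussian law by independence. The inequality between the measure of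
  -- a preimage and the image measure holds for arbitrary sets, so the typical set need not be shown
  -- measurable.
  refine le_trans (measure_mono fun ω hω => ?_) (Measure.le_map_apply hlaw.aemeasurable _)
  intro htyp
  have hle := HyperPMOM.maxPosteriorRatio_le hc₁ hn.1 (hn.2 _ htyp)
  have h0 := HyperPMOM.maxPosteriorRatio_nonneg (X n) (A n) r α₁ α₂ (q n) c₂ hc₁
    (HyperPMOM.trueModel (p n) β₀) (HyperPMOM.response (X n) β₀ fun i => e n i ω)
  rw [Set.mem_ofPred_eq, Real.dist_eq, sub_zero, abs_of_nonneg h0] at hω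
  exact absurd (hω.trans hle) (not_le.2 hcη)
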